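/- Consider the periodic KdV equation $v_t=6vv_x-v_{xxx}$, $v(x+2\pi,t)=v(x,t)$, $v$ real-valued. For all $C>0$ and $\gamma>0$ there is a constant $A=A(C,\gamma)>0$ such that for all $\delta>0$ and $K>0$ there is $\varepsilon_0=\varepsilon_0(C,\gamma,\delta,K)>0$ with the following property. Let $0<\varepsilon\le\varepsilon_0$, let $I\ni 0$ be an interval of times, and let $v\in C(I;H^1(\mathbb R/2\pi\mathbb Z))$ be a solution (in the sense of distributions) of the equation on $I$ with $\int_{-\pi}^{\pi}v(x,0)\,dx=0$ and $$\|v(\cdot,0)\|_{H^1}\le C\varepsilon^{-1},\qquad \|v(\cdot,0)\|_{H^{-1/2}}\le C\varepsilon^{1/2}.$$ Then for every $t\in I$ with $|t|\le K\varepsilon^{-\frac12+\delta}$, $$\|v(\cdot,t)-e^{-t\partial_x^3}v(\cdot,0)\|_{L^2}\le A\,\langle t\rangle\,\varepsilon^{\frac12-\gamma},\qquad \langle t\rangle=\sqrt{1+t^2}.$$ Here $\|f\|_{H^s}^2=\sum_{n\in\mathbb Z}(1+n^2)^s|\hat f(n)|^2$ with $\hat f(n)=\frac1{2\pi}\int_{-\pi}^{\pi}f(x)e^{-inx}\,dx$,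 $L^2=L^2(-\pi,\pi)$, and $e^{-t\partial_x^3}$ acts by $e^{inx}\mapsto e^{in^3t}e^{inx}$. -/

import Mathlib

open MeasureTheory Filter Topology Set
open scoped ENNReal ContDiff

noncomputable section

namespace PeriodicKdV

/-- The `n`-th Fourier coefficient `(2π)⁻¹ ∫_{-π}^{π} f(x) e^{-inx} dx` of a `2π`-periodic function. -/
def coeff (f : ℝ → ℂ) (n : ℤ) : ℂ :=
  fourierCoeffOn (neg_lt_self Real.pi_pos) f n

/-- The Sobolev norm `‖f‖_{H^s} = (∑ₙ (1 + n²)^s |f̂(n)|²)^{1/2}` on the circle, with values in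
`[0, ∞]`. -/
def sobolevNorm (s : ℝ) (f : ℝ → ℝ) : ℝ≥0∞ :=
  (∑' n : ℤ, ENNReal.ofReal ((1 + (n : ℝ) ^ 2) ^ s * ‖coeff (fun x => (f x : ℂ)) n‖ ^ 2))
    ^ (1 / 2 : ℝ)

/-- The `L²` norm over one period, with values in `[0, ∞]`. -/
def l2Norm (f : ℝ → ℂ) : ℝ≥0∞ :=
  eLpNorm f 2 (volume.restrict (Ioc (-Real.pi) Real.pi))

/-- Real-valued `2π`-periodic functions of class `H¹`. -/
structure MemH1 (f : ℝ → ℝ) : Prop where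
  periodic : Function.Periodic f (2 * Real.pi)
  memLp : MemLp f 2 (volume.restrict (Ioc (-Real.pi) Real.pi))
  finite : sobolevNorm 1 f < ⊤

/-- The linear evolution `e^{tL} f`, `L = -∂ₓ³`, of `f ∈ H¹`: since `L e^{inx} = i n³ e^{inx}`, it is
the (absolutely convergent) Fourier series `∑ₙ e^{i n³ t} f̂(n) e^{inx}`. -/
def linearFlow (t : ℝ) (f : ℝ → ℝ) (x : ℝ) : ℂ :=
  ∑' n : ℤ, Complex.exp (Complex.I * (n : ℂ) ^ 3 * (t : ℂ)) * coeff (fun y => (f y : ℂ)) n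
    * Complex.exp (Complex.I * (n : ℂ) * (x : ℂ))

/-- `v` is a real `2π`-periodic `H¹` solution of `v_t = 6 v v_x - v_{xxx}` on the set of times `I`
(an interval in applications): `v ∈ C(I; H¹)`, and the equation, written as
`v_t = ∂ₓ(3 v²) - ∂ₓ³ v`, holds weakly in `x`, that is,
`d/dt ∫ v ψ = ∫ v ψ''' - 3 ∫ v² ψ'` for every smooth `2π`-periodic `ψ`. -/
structure IsSolutionOn (I : Set ℝ) (v : ℝ → ℝ → ℝ) : Prop where
  memH1 : ∀ t ∈ I, MemH1 (v t)
  continuous : ∀ t₀ ∈ I,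
    Tendsto (fun t => sobolevNorm 1 (fun x => v t x - v t₀ x)) (𝓝[I] t₀) (𝓝 0)
  weak : ∀ ψ : ℝ → ℝ, ContDiff ℝ ∞ ψ → Function.Periodic ψ (2 * Real.pi) → ∀ t ∈ I,
    HasDerivWithinAt (fun τ => ∫ x in (-Real.pi)..Real.pi, v τ x * ψ x)
      ((∫ x in (-Real.pi)..Real.pi, v t x * iteratedDeriv 3 ψ x)
        - 3 * ∫ x in (-Real.pi)..Real.pi, (v t x) ^ 2 * deriv ψ x) I t

end PeriodicKdV

end

/-!
In the interaction representation `u_n(t) = e^{-in³t} v̂(n, t)` the linear evolution is constant,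
and the equation becomes `∂ₜ u_n = 3in ∑_{x} e^{-3in x(n-x)t} u_x u_{n-x}`. The mean of `v` is
conserved, so `u_0 = 0` and the phase `n x (n - x)` vanishes on no term that is present.
Integration by parts in time (`quadTerm`) therefore replaces the quadratic nonlinearity, which
carries a derivative, by a cubic one with weight `1 / x` and phase `(x + k)(n - k)(n - x)`. A
second integration by parts (`cubicTerm`) on the nonresonant part leaves the resonant cubic terms
and quartic terms, whose only bad factor is one derivative, because `|∂ₜ u_m| ≤ 3 |m| ‖u‖²` in
`ℓ²`; this is `derivative_eq_tsum_remainderTerm`.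

All these terms are small because of the `Ḣ^{-1/2}` norm. The sum of the absolute values of the
three factors of the cubic phase dominates `|k|^{1/2} |l|^{1/2}`, where `l = n - x - k`, as well
as `|l|` itself; cancelling one of them against such a weight leaves two kernels `|j|⁻¹`, and
`exists_star_bound` handles their trilinear forms in `ℓ²`. With `X`, `M` and `Y` bounding the
`Ḣ^{-1/2}` norm, the `ℓ²` norm and `∑ |u_n| / |n|`, this yields `exists_increment_bound`, an
estimate of `u(b) - u(a)` in `ℓ²` and in `Ḣ^{-1/2}`.

Initially `X ≲ ε^{1/2}`, and `M ≲ 1` by interpolation with `H¹`. As long as both bounds hold up to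
a factor `2`, one has `Y ≲ ε^{1/2-η}` for every `η > 0` (`exists_sumKer_bound`), and the increment
in `Ḣ^{-1/2}` is `≲ ε^{1/2} (ε^{1/2} + |t| ε^{1/2-η})`. This is a small multiple of `ε^{1/2}` for
`|t| ≤ K ε^{-1/2+δ}` and `η < δ`, so the bounds persist by continuity (`exists_reduced_bound`).
The increment in `ℓ²`, which is the distance of `v` to the linear evolution up to the factor
`√(2π)`, is then `≲ (1 + |t|) ε^{1/2}`, with a constant that depends on `C` alone.
-/

namespace PeriodicKdV

/-! ### `ℓ²` norms of sequences and a trilinear form -/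

/-- The `ℓ²` norm of a `[0, ∞]`-valued sequence. -/
noncomputable def nrm {ι : Type*} (f : ι → ℝ≥0∞) : ℝ≥0∞ := (∑' i, f i ^ 2) ^ (1 / 2 : ℝ)

theorem nrm_sq {ι : Type*} (f : ι → ℝ≥0∞) : nrm f ^ 2 = ∑' i, f i ^ 2 := by
  rw [nrm, ← ENNReal.rpow_natCast, ← ENNReal.rpow_mul]; norm_num

theorem sq_le_sq_iff_le {a b : ℝ≥0∞} : a ^ 2 ≤ b ^ 2 ↔ a ≤ b :=
  ENNReal.pow_le_pow_left_iff two_ne_zero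

theorem sq_inj_ennreal {a b : ℝ≥0∞} (h : a ^ 2 = b ^ 2) : a = b :=
  le_antisymm (sq_le_sq_iff_le.1 h.le) (sq_le_sq_iff_le.1 h.ge)

theorem nrm_le_iff {ι : Type*} (f : ι → ℝ≥0∞) (c : ℝ≥0∞) : nrm f ≤ c ↔ ∑' i, f i ^ 2 ≤ c ^ 2 := by
  rw [← nrm_sq]; exact sq_le_sq_iff_le.symm

/-- Cauchy–Schwarz. -/
theorem tsum_mul_le_nrm {ι : Type*} (f g : ι → ℝ≥0∞) :
    ∑' i, f i * g i ≤ nrm f * nrm g := by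
  let _ : MeasurableSpace ι := ⊤
  have h := ENNReal.lintegral_mul_le_Lp_mul_Lq (μ := Measure.count) (f := f) (g := g)
    Real.HolderConjugate.two_two (measurable_from_top).aemeasurable
    (measurable_from_top).aemeasurable
  simpa [lintegral_count, nrm] using h

theorem nrm_mono {ι : Type*} {f g : ι → ℝ≥0∞} (h : ∀ i, f i ≤ g i) : nrm f ≤ nrm g := by
  unfold nrm; gcongr with i; exact h i

theorem nrm_const_mul {ι : Type*} (c : ℝ≥0∞) (f : ι → ℝ≥0∞) :
    nrm (fun i => c * f i) = c * nrm f := by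
  apply sq_inj_ennreal
  simp [nrm_sq, mul_pow, ENNReal.tsum_mul_left]

theorem nrm_comp_equiv {ι κ : Type*} (e : ι ≃ κ) (f : κ → ℝ≥0∞) :
    nrm (fun i => f (e i)) = nrm f := by
  unfold nrm; rw [e.tsum_eq (fun j => f j ^ 2)]

theorem le_nrm {ι : Type*} (f : ι → ℝ≥0∞) (i : ι) : f i ≤ nrm f := by
  rw [← sq_le_sq_iff_le, nrm_sq]
  exact ENNReal.le_tsum i

/-- The weight `|j|⁻¹`, with value `0` at `j = 0`. -/
noncomputable def ker (j : ℤ) : ℝ≥0∞ := ENNReal.ofReal |(j : ℝ)|⁻¹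

theorem ker_neg (j : ℤ) : ker (-j) = ker j := by simp [ker]

theorem ker_sub_comm (i j : ℤ) : ker (i - j) = ker (j - i) := by rw [← ker_neg, neg_sub]

@[simp] theorem ker_zero : ker 0 = 0 := by simp [ker]

theorem tsum_ker_rpow {s : ℝ} (hs : 1 < s) : ∑' j, ker j ^ s ≠ ⊤ := by
  have h : Summable fun j : ℤ => |(j : ℝ)| ^ (-s) := by
    exact Real.summable_abs_int_rpow hs
  have h2 : ∀ j : ℤ, ker j ^ s ≤ ENNReal.ofReal (|(j : ℝ)| ^ (-s)) := by
    intro j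
    rw [ker, ENNReal.ofReal_rpow_of_nonneg (by positivity) (by linarith)]
    apply ENNReal.ofReal_le_ofReal
    rw [Real.rpow_neg (abs_nonneg _), Real.inv_rpow (abs_nonneg _)]
  refine ne_top_of_le_ne_top ?_ (ENNReal.tsum_le_tsum h2)
  exact h.tsum_ofReal_ne_top

theorem tsum_ker_sq : ∑' j, ker j ^ 2 ≠ ⊤ := by
  have := tsum_ker_rpow (s := 2) (by norm_num)
  simpa using this

theorem tsum_shift (f : ℤ → ℝ≥0∞) (y : ℤ) : ∑' x, f (x - y) = ∑' x, f x :=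
  (Equiv.subRight y).tsum_eq f

theorem tsum_reflect (f : ℤ → ℝ≥0∞) (y : ℤ) : ∑' x, f (y - x) = ∑' x, f x :=
  (Equiv.subLeft y).tsum_eq f

theorem mul_le_sq_add_sq (a b : ℝ≥0∞) : a * b ≤ a ^ 2 + b ^ 2 := by
  rcases le_total a b with h | h
  · calc a * b ≤ b * b := by gcongr
      _ ≤ a ^ 2 + b ^ 2 := by rw [← sq]; exact le_add_self
  · calc a * b ≤ a * a := by gcongr
      _ ≤ a ^ 2 + b ^ 2 := by rw [← sq]; exact le_self_add

/-- A trilinear estimate of Hardy–Littlewood–Sobolev type: two kernels `|j|⁻¹` joined at the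
common vertex `y`. Split `|j|⁻¹ = |j|^{-5/8} |j|^{-3/8}`, attach the factors `|j|^{-5/8}` to `f`
and the factors `|j|^{-3/8}` to `g h`, and apply Cauchy–Schwarz on `ℤ³`: the square of the former
is summable in `x` and `z`, and the fourth power of the latter is summable in `y`. -/
theorem exists_star_bound : ∃ c : ℝ≥0∞, c ≠ ⊤ ∧ ∀ f g h : ℤ → ℝ≥0∞,
    ∑' y, ∑' x, ∑' z, f y * g x * h z * (ker (x - y) * ker (z - y)) ≤
      c * (nrm f * nrm g * nrm h) := by
  set c₁ : ℝ≥0∞ := ∑' j, ker j ^ (5 / 4 : ℝ)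
  set c₂ : ℝ≥0∞ := ∑' j, ker j ^ (3 / 2 : ℝ)
  have hc₁ : c₁ ≠ ⊤ := tsum_ker_rpow (by norm_num)
  have hc₂ : c₂ ≠ ⊤ := tsum_ker_rpow (by norm_num)
  set k₁ : ℤ → ℝ≥0∞ := fun j => ker j ^ (5 / 8 : ℝ) with hk₁
  set k₂ : ℤ → ℝ≥0∞ := fun j => ker j ^ (3 / 8 : ℝ) with hk₂
  have hk : ∀ j, ker j = k₁ j * k₂ j := fun j => by
    simp only [hk₁, hk₂]
    rw [← ENNReal.rpow_add_of_nonneg _ _ (by norm_num) (by norm_num)]; norm_num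
  have hs₁ : ∀ y, ∑' x, k₁ (x - y) ^ 2 = c₁ := fun y => by
    rw [tsum_shift (fun x => k₁ x ^ 2)]
    refine tsum_congr fun j => ?_
    rw [← ENNReal.rpow_natCast, ← ENNReal.rpow_mul]; norm_num
  have hs₂ : ∀ x, ∑' y, (k₂ (x - y) ^ 2) ^ 2 = c₂ := fun y => by
    rw [tsum_reflect (fun x => (k₂ x ^ 2) ^ 2)]
    refine tsum_congr fun j => ?_
    rw [← pow_mul, ← ENNReal.rpow_natCast, ← ENNReal.rpow_mul]; norm_num
  have hs₃ : ∀ x z, ∑' y, k₂ (x - y) ^ 2 * k₂ (z - y) ^ 2 ≤ 2 * c₂ := fun x z => by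
    calc _ ≤ ∑' y, ((k₂ (x - y) ^ 2) ^ 2 + (k₂ (z - y) ^ 2) ^ 2) :=
          ENNReal.tsum_le_tsum fun y => mul_le_sq_add_sq _ _
      _ = 2 * c₂ := by rw [ENNReal.tsum_add, hs₂, hs₂, two_mul]
  refine ⟨c₁ * (2 * c₂) ^ (1 / 2 : ℝ), ENNReal.mul_ne_top hc₁
    (ENNReal.rpow_ne_top_of_nonneg (by norm_num) (ENNReal.mul_ne_top (by norm_num) hc₂)),
    fun f g h => ?_⟩
  set F : ℤ × ℤ × ℤ → ℝ≥0∞ := fun p => f p.1 * k₁ (p.2.1 - p.1) * k₁ (p.2.2 - p.1)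
  set G : ℤ × ℤ × ℤ → ℝ≥0∞ := fun p => g p.2.1 * h p.2.2 * (k₂ (p.2.1 - p.1) * k₂ (p.2.2 - p.1))
  have hFG : ∑' y, ∑' x, ∑' z, f y * g x * h z * (ker (x - y) * ker (z - y)) =
      ∑' p, F p * G p := by
    rw [ENNReal.tsum_prod']
    simp_rw [ENNReal.tsum_prod']
    refine tsum_congr fun y => tsum_congr fun x => tsum_congr fun z => ?_
    simp only [F, G, hk]; ring
  have hF : nrm F = c₁ * nrm f := by
    apply sq_inj_ennreal
    simp only [mul_pow]
    rw [nrm_sq, nrm_sq, ENNReal.tsum_prod']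
    simp_rw [ENNReal.tsum_prod', F, mul_pow, ENNReal.tsum_mul_left, hs₁, ENNReal.tsum_mul_right,
      ENNReal.tsum_mul_left, hs₁, ENNReal.tsum_mul_right]
    ring
  have hG : nrm G ≤ (2 * c₂) ^ (1 / 2 : ℝ) * (nrm g * nrm h) := by
    rw [← sq_le_sq_iff_le]
    have e : ((2 * c₂) ^ (1 / 2 : ℝ)) ^ 2 = 2 * c₂ := by
      rw [← ENNReal.rpow_natCast, ← ENNReal.rpow_mul]; norm_num
    rw [mul_pow, e, mul_pow, nrm_sq, nrm_sq, nrm_sq, ENNReal.tsum_prod', ENNReal.tsum_comm,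
      ENNReal.tsum_prod']
    calc _ ≤ ∑' x, ∑' z, g x ^ 2 * h z ^ 2 * (2 * c₂) := by
          refine ENNReal.tsum_le_tsum fun x => ENNReal.tsum_le_tsum fun z => ?_
          simp only [G, mul_pow, ENNReal.tsum_mul_left]
          gcongr
          exact hs₃ x z
      _ = _ := by
          simp_rw [ENNReal.tsum_mul_right, ENNReal.tsum_mul_left, ENNReal.tsum_mul_right]
          ring
  rw [hFG]
  calc _ ≤ nrm F * nrm G := tsum_mul_le_nrm F G
    _ ≤ (c₁ * nrm f) * ((2 * c₂) ^ (1 / 2 : ℝ) * (nrm g * nrm h)) := by rw [hF]; gcongr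
    _ = _ := by ring

/-! ### Multilinear estimates -/

/-- The weight `|j|^{-1/2}`, with value `0` at `j = 0`. -/
noncomputable def rho (j : ℤ) : ℝ≥0∞ := ENNReal.ofReal (√|(j : ℝ)|)⁻¹

/-- The weight `|j|` as an extended nonnegative real. -/
noncomputable def absE (j : ℤ) : ℝ≥0∞ := ENNReal.ofReal |(j : ℝ)|

theorem rho_mul_self (j : ℤ) : rho j * rho j = ker j := by
  rw [rho, ker, ← ENNReal.ofReal_mul (by positivity), ← mul_inv, Real.mul_self_sqrt (abs_nonneg _)]

theorem rho_sq (j : ℤ) : rho j ^ 2 = ker j := by rw [sq, rho_mul_self]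

@[simp] theorem rho_zero : rho 0 = 0 := by simp [rho]

theorem rho_neg (j : ℤ) : rho (-j) = rho j := by simp [rho]

theorem one_le_abs_cast {j : ℤ} (hj : j ≠ 0) : (1 : ℝ) ≤ |(j : ℝ)| := by
  exact_mod_cast Int.one_le_abs hj

theorem rho_le_one (j : ℤ) : rho j ≤ 1 := by
  rcases eq_or_ne j 0 with rfl | hj
  · simp
  · rw [rho, ← ENNReal.ofReal_one]
    apply ENNReal.ofReal_le_ofReal
    exact inv_le_one_of_one_le₀ (Real.one_le_sqrt.2 (one_le_abs_cast hj))

theorem ker_le_rho (j : ℤ) : ker j ≤ rho j := by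
  rw [← rho_mul_self]; exact mul_le_of_le_one_right' (rho_le_one j)

/-- The sum of the pairwise products of the three kernels `|n - x|⁻¹`, `|n - y|⁻¹`, `|x + y|⁻¹`. -/
noncomputable def pairs (n x y : ℤ) : ℝ≥0∞ :=
  ker (n - x) * ker (n - y) + ker (n - x) * ker (x + y) + ker (n - y) * ker (x + y)

/-- Each of the three products in `pairs` is a star, with centre `n`, `x` or `y` after a
reflection. -/
theorem exists_pairs_bound : ∃ c : ℝ≥0∞, c ≠ ⊤ ∧ ∀ h f g : ℤ → ℝ≥0∞,
    ∑' n, ∑' x, ∑' y, h n * f x * g y * pairs n x y ≤ c * (nrm h * nrm f * nrm g) := by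
  obtain ⟨c, hc, H⟩ := exists_star_bound
  refine ⟨3 * c, ENNReal.mul_ne_top (by norm_num) hc, fun h f g => ?_⟩
  have h1 : ∑' n, ∑' x, ∑' y, h n * f x * g y * (ker (n - x) * ker (n - y)) ≤
      c * (nrm h * nrm f * nrm g) := by
    refine le_trans (le_of_eq ?_) (H h f g)
    simp_rw [ker_sub_comm]
  have neg (g : ℤ → ℝ≥0∞) : nrm (fun z => g (-z)) = nrm g := nrm_comp_equiv (Equiv.neg ℤ) g
  have h2 : ∑' n, ∑' x, ∑' y, h n * f x * g y * (ker (n - x) * ker (x + y)) ≤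
      c * (nrm h * nrm f * nrm g) := by
    have := H f h (fun z => g (-z))
    rw [neg] at this
    refine le_trans (le_of_eq ?_) (this.trans_eq (by ring))
    rw [ENNReal.tsum_comm]
    refine tsum_congr fun x => tsum_congr fun n => ?_
    rw [← (Equiv.neg ℤ).tsum_eq]
    refine tsum_congr fun y => ?_
    simp only [Equiv.neg_apply]
    rw [ker_sub_comm y x, ← sub_eq_add_neg]; ring
  have h3 : ∑' n, ∑' x, ∑' y, h n * f x * g y * (ker (n - y) * ker (x + y)) ≤
      c * (nrm h * nrm f * nrm g) := by
    have := H g h (fun z => f (-z))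
    rw [neg] at this
    refine le_trans (le_of_eq ?_) (this.trans_eq (by ring))
    have : ∀ n, ∑' x, ∑' y, h n * f x * g y * (ker (n - y) * ker (x + y)) =
      ∑' y, ∑' x, h n * f x * g y * (ker (n - y) * ker (x + y)) := fun n => ENNReal.tsum_comm
    simp_rw [this]
    rw [ENNReal.tsum_comm]
    refine tsum_congr fun y => tsum_congr fun n => ?_
    rw [← (Equiv.neg ℤ).tsum_eq]
    refine tsum_congr fun x => ?_
    simp only [Equiv.neg_apply]
    rw [ker_sub_comm x y, neg_add_eq_sub]; ring
  calc _ = _ := by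
        simp only [pairs, mul_add, ENNReal.tsum_add]
    _ ≤ _ := add_le_add (add_le_add h1 h2) h3
    _ = _ := by ring

theorem ker_mul_three (i j k : ℤ) :
    ker i * ker j * ker k = ENNReal.ofReal (|(i : ℝ)|⁻¹ * |(j : ℝ)|⁻¹ * |(k : ℝ)|⁻¹) := by
  simp only [ker]
  rw [ENNReal.ofReal_mul (by positivity), ENNReal.ofReal_mul (by positivity)]

/-- A factor `s ≤ |i| + |j| + |k|` cancels one of the three kernels. -/
theorem ofReal_mul_ker_le {i j k : ℤ} {s : ℝ} (hs : s ≤ |(i : ℝ)| + |(j : ℝ)| + |(k : ℝ)|) :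
    ENNReal.ofReal s * (ker i * ker j * ker k) ≤ ker i * ker j + ker i * ker k + ker j * ker k := by
  rcases eq_or_ne i 0 with rfl | hi
  · simp
  rcases eq_or_ne j 0 with rfl | hj
  · simp
  rcases eq_or_ne k 0 with rfl | hk
  · simp
  have hi := one_le_abs_cast hi
  have hj := one_le_abs_cast hj
  have hk := one_le_abs_cast hk
  rw [ker_mul_three, ← ENNReal.ofReal_mul' (by positivity)]
  simp only [ker]
  rw [← ENNReal.ofReal_mul (by positivity), ← ENNReal.ofReal_mul (by positivity),
    ← ENNReal.ofReal_mul (by positivity), ← ENNReal.ofReal_add (by positivity) (by positivity),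
    ← ENNReal.ofReal_add (by positivity) (by positivity)]
  apply ENNReal.ofReal_le_ofReal
  calc s * (|(i : ℝ)|⁻¹ * |(j : ℝ)|⁻¹ * |(k : ℝ)|⁻¹) ≤
      (|(i : ℝ)| + |(j : ℝ)| + |(k : ℝ)|) * (|(i : ℝ)|⁻¹ * |(j : ℝ)|⁻¹ * |(k : ℝ)|⁻¹) := by gcongr
    _ = _ := by field_simp; ring

theorem abs_le_of_pairs (n x y : ℤ) :
    |((n - x - y : ℤ) : ℝ)| ≤ |((n - x : ℤ) : ℝ)| + |((n - y : ℤ) : ℝ)| + |((x + y : ℤ) : ℝ)| ∧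
    |(x : ℝ)| + |(y : ℝ)| ≤
      2 * (|((n - x : ℤ) : ℝ)| + |((n - y : ℤ) : ℝ)| + |((x + y : ℤ) : ℝ)|) := by
  constructor
  · have h : |n - x - y| ≤ |n - x| + |n - y| + |x + y| := by grind
    exact_mod_cast h
  · have h : |x| + |y| ≤ 2 * (|n - x| + |n - y| + |x + y|) := by grind
    exact_mod_cast h

/-- With `l = n - x - y`, the three kernels are those of `l + y`, `l + x` and `x + y`, and their sum
dominates `|l|`, so that this derivative is absorbed by one of them. -/
theorem absE_mul_ker_le_pairs (n x y : ℤ) :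
    absE (n - x - y) * (ker (n - x) * ker (n - y) * ker (x + y)) ≤ pairs n x y :=
  ofReal_mul_ker_le (abs_le_of_pairs n x y).1

theorem ker_le_rho_mul_pairs {n x y : ℤ} (hx : x ≠ 0) (hy : y ≠ 0) :
    ker (n - x) * ker (n - y) * ker (x + y) ≤ rho x * rho y * pairs n x y := by
  have hx := one_le_abs_cast hx
  have hy := one_le_abs_cast hy
  have hs : √|(x : ℝ)| * √|(y : ℝ)| ≤
      |((n - x : ℤ) : ℝ)| + |((n - y : ℤ) : ℝ)| + |((x + y : ℤ) : ℝ)| := by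
    have := (abs_le_of_pairs n x y).2
    nlinarith [sq_nonneg (√|(x : ℝ)| - √|(y : ℝ)|), Real.mul_self_sqrt (abs_nonneg (x : ℝ)),
      Real.mul_self_sqrt (abs_nonneg (y : ℝ))]
  have h1 : rho x * rho y * ENNReal.ofReal (√|(x : ℝ)| * √|(y : ℝ)|) = 1 := by
    simp only [rho]
    rw [← ENNReal.ofReal_mul (by positivity), ← ENNReal.ofReal_mul (by positivity),
      ← ENNReal.ofReal_one]
    congr 1
    have : √|(x : ℝ)| ≠ 0 := by positivity
    have : √|(y : ℝ)| ≠ 0 := by positivity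
    field_simp
  calc _ = rho x * rho y * ENNReal.ofReal (√|(x : ℝ)| * √|(y : ℝ)|) *
        (ker (n - x) * ker (n - y) * ker (x + y)) := by rw [h1, one_mul]
    _ ≤ _ := by
      rw [mul_assoc]
      gcongr
      exact ofReal_mul_ker_le hs

theorem rho_mul_rho_le {i j k : ℤ} (hk : k ≠ 0) (h : |k| ≤ 4 * (|i| * |j|)) :
    rho i * rho j ≤ 2 * rho k := by
  rcases eq_or_ne i 0 with rfl | hi
  · simp
  rcases eq_or_ne j 0 with rfl | hj
  · simp
  have hi := one_le_abs_cast hi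
  have hj := one_le_abs_cast hj
  have hk := one_le_abs_cast hk
  have h' : |(k : ℝ)| ≤ 4 * (|(i : ℝ)| * |(j : ℝ)|) := by exact_mod_cast h
  have e : (2 : ℝ≥0∞) = ENNReal.ofReal 2 := by norm_num
  simp only [rho]
  rw [e, ← ENNReal.ofReal_mul (by positivity), ← ENNReal.ofReal_mul (by positivity)]
  apply ENNReal.ofReal_le_ofReal
  have h2 : √|(k : ℝ)| ≤ 2 * (√|(i : ℝ)| * √|(j : ℝ)|) := by
    rw [← Real.sqrt_mul (abs_nonneg _)]
    apply Real.sqrt_le_iff.2 ⟨by positivity, _⟩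
    rw [mul_pow, Real.sq_sqrt (by positivity)]; linarith
  have : 0 < √|(k : ℝ)| := by positivity
  have : 0 < √|(i : ℝ)| := by positivity
  have : 0 < √|(j : ℝ)| := by positivity
  field_simp
  linarith

/-- If the frequency `y` dominates, then so do `n - y`, `x + y` and `n - x - y`. -/
theorem absE_mul_ker_le_of_dominant {n x y : ℤ} (hn : n ≠ 0) (hx : x ≠ 0)
    (h : 4 * (|n| * |x|) < |y|) :
    absE (n - x - y) * (ker (n - y) * ker (x + y)) ≤ 3 * ker y := by
  have hn1 := Int.one_le_abs hn
  have hx1 := Int.one_le_abs hx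
  have hn4 : 4 * |n| ≤ |y| := by nlinarith
  have hx4 : 4 * |x| ≤ |y| := by nlinarith
  have hy : 0 < |y| := by linarith [abs_nonneg n]
  have a1 : 2 * |n - x - y| ≤ 3 * |y| := by grind
  have a2 : 3 * |y| ≤ 4 * |n - y| := by grind
  have a3 : 3 * |y| ≤ 4 * |x + y| := by grind
  have a1' : 2 * |((n - x - y : ℤ) : ℝ)| ≤ 3 * |(y : ℝ)| := by exact_mod_cast a1
  have a2' : 3 * |(y : ℝ)| ≤ 4 * |((n - y : ℤ) : ℝ)| := by exact_mod_cast a2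
  have a3' : 3 * |(y : ℝ)| ≤ 4 * |((x + y : ℤ) : ℝ)| := by exact_mod_cast a3
  have hy' : 0 < |(y : ℝ)| := by exact_mod_cast hy
  have e : (3 : ℝ≥0∞) = ENNReal.ofReal 3 := by norm_num
  simp only [absE, ker]
  rw [e, ← ENNReal.ofReal_mul (by positivity), ← ENNReal.ofReal_mul (by positivity),
    ← ENNReal.ofReal_mul (by positivity)]
  apply ENNReal.ofReal_le_ofReal
  have p1 : 0 < |((n - y : ℤ) : ℝ)| := by linarith
  have p2 : 0 < |((x + y : ℤ) : ℝ)| := by linarith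
  rw [← mul_inv, ← div_eq_mul_inv, ← div_eq_mul_inv, div_le_div_iff₀ (by positivity) hy']
  nlinarith [mul_le_mul a2' a3' (by positivity) (by positivity)]

section Multilinear

variable (a h : ℤ → ℝ≥0∞)

/-- The `Ḣ^{-1/2}` norm. -/
noncomputable def nrmHalf (a : ℤ → ℝ≥0∞) : ℝ≥0∞ := nrm (fun n => a n * rho n)

/-- The sum of `|a n| / |n|`. -/
noncomputable def sumKer (a : ℤ → ℝ≥0∞) : ℝ≥0∞ := ∑' n, a n * ker n

theorem nrm_reflect (f : ℤ → ℝ≥0∞) (n : ℤ) : nrm (fun x => f (n - x)) = nrm f :=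
  nrm_comp_equiv (Equiv.subLeft n) f

theorem nrm_shift (f : ℤ → ℝ≥0∞) (n : ℤ) : nrm (fun x => f (x - n)) = nrm f :=
  nrm_comp_equiv (Equiv.subRight n) f

theorem tsum_conv_le (f g : ℤ → ℝ≥0∞) (n : ℤ) : ∑' x, f x * g (n - x) ≤ nrm f * nrm g := by
  refine (tsum_mul_le_nrm _ _).trans_eq ?_
  rw [nrm_reflect]

theorem nrm_mul_ker_le : nrm (fun n => a n * ker n) ≤ nrmHalf a :=
  nrm_mono fun n => by gcongr; exact ker_le_rho n

theorem nrmHalf_le_nrm : nrmHalf a ≤ nrm a :=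
  nrm_mono fun n => mul_le_of_le_one_right' (rho_le_one n)

theorem sumKer_le : sumKer a ≤ nrm ker * nrm a := by
  rw [mul_comm]; exact tsum_mul_le_nrm _ _

theorem nrm_ker_ne_top : nrm ker ≠ ⊤ :=
  ENNReal.rpow_ne_top_of_nonneg (by norm_num) tsum_ker_sq

theorem quadratic_le :
    ∑' n, h n * ∑' x, ker x * ker (n - x) * (a x * a (n - x)) ≤
      nrm h * (sumKer a * nrmHalf a) := by
  calc _ = ∑' x, a x * ker x * ∑' n, h n * (a (n - x) * ker (n - x)) := by
        simp_rw [← ENNReal.tsum_mul_left]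
        rw [ENNReal.tsum_comm]
        refine tsum_congr fun x => tsum_congr fun n => by ring
    _ ≤ ∑' x, a x * ker x * (nrm h * nrmHalf a) := by
        refine ENNReal.tsum_le_tsum fun x => ?_
        gcongr
        refine (tsum_mul_le_nrm _ _).trans ?_
        gcongr
        rw [nrm_shift (fun m => a m * ker m)]
        exact nrm_mul_ker_le a
    _ = _ := by rw [ENNReal.tsum_mul_right, sumKer]; ring

/-- On the output side, `|n|^{-1/2}` together with `|x|^{-1/2} |n - x|^{-1/2} ≲ |n|^{-1/2}` gives
the square summable weight `|n|⁻¹`. -/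
theorem quadratic_weighted_le :
    ∑' n, h n * rho n * ∑' x, ker x * ker (n - x) * (a x * a (n - x)) ≤
      2 * nrm ker * nrm h * nrmHalf a ^ 2 := by
  have key : ∀ n, rho n * ∑' x, ker x * ker (n - x) * (a x * a (n - x)) ≤
      ker n * (2 * nrmHalf a ^ 2) := by
    intro n
    rcases eq_or_ne n 0 with rfl | hn
    · simp
    calc _ ≤ rho n * ∑' x, 2 * rho n * ((a x * rho x) * (a (n - x) * rho (n - x))) := by
          refine mul_le_mul_right (ENNReal.tsum_le_tsum fun x => ?_) _
          rw [← rho_mul_self x, ← rho_mul_self (n - x)]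
          rcases eq_or_ne x 0 with rfl | hx
          · simp
          rcases eq_or_ne (n - x) 0 with hx' | hx'
          · simp [hx']
          calc _ = rho x * rho (n - x) * ((a x * rho x) * (a (n - x) * rho (n - x))) := by ring
            _ ≤ _ := by
              refine mul_le_mul_left (rho_mul_rho_le hn ?_) _
              have h1 := Int.one_le_abs hx
              have h2 := Int.one_le_abs hx'
              have : |n| ≤ |x| + |n - x| := by grind
              nlinarith
      _ = ker n * (2 * ∑' x, (a x * rho x) * (a (n - x) * rho (n - x))) := by
          rw [ENNReal.tsum_mul_left, ← rho_mul_self n]; ring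
      _ ≤ _ := by
          gcongr
          rw [sq]
          exact tsum_conv_le (fun x => a x * rho x) _ n
  calc _ ≤ ∑' n, h n * (ker n * (2 * nrmHalf a ^ 2)) := by
        refine ENNReal.tsum_le_tsum fun n => ?_
        rw [mul_assoc]; exact mul_le_mul_right (key n) _
    _ = (∑' n, h n * ker n) * (2 * nrmHalf a ^ 2) := by
        rw [← ENNReal.tsum_mul_right]; exact tsum_congr fun n => by ring
    _ ≤ (nrm h * nrm ker) * (2 * nrmHalf a ^ 2) := by gcongr; exact tsum_mul_le_nrm _ _
    _ = _ := by ring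

/-- Summation over `x + k + l = n`, with `l` in place of `x` as a summation variable. -/
theorem tsum_eliminate (φ : ℤ → ℤ → ℤ → ℝ≥0∞) (n : ℤ) :
    ∑' x, ∑' k, φ x k (n - x - k) = ∑' k, ∑' l, φ (n - k - l) k l := by
  rw [ENNReal.tsum_comm]
  refine tsum_congr fun k => ?_
  rw [← tsum_reflect _ (n - k)]
  refine tsum_congr fun l => ?_
  congr 1; ring

/-- Summation over `x + k + l = n`, with `l` in place of `k` as a summation variable. -/
theorem tsum_exchange (φ : ℤ → ℤ → ℤ → ℝ≥0∞) (n : ℤ) :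
    ∑' x, ∑' k, φ x k (n - x - k) = ∑' x, ∑' l, φ x (n - x - l) l := by
  refine tsum_congr fun x => ?_
  rw [← tsum_reflect _ (n - x)]
  refine tsum_congr fun l => ?_
  congr 1; ring

/-- The product of the three kernels attached to the phase `3 (x + k) (n - k) (n - x)` of the cubic
interaction of the frequencies `x`, `k` and `n - x - k`. -/
noncomputable def ker3 (n x k : ℤ) : ℝ≥0∞ := ker (x + k) * ker (n - k) * ker (n - x)

theorem ker3_exchange (n x l : ℤ) : ker3 n x (n - x - l) = ker3 n x l := by
  unfold ker3
  rw [show x + (n - x - l) = n - l by ring, show n - (n - x - l) = x + l by ring]; ring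

theorem ker3_eq (n x k : ℤ) : ker3 n x k = ker (n - x) * ker (n - k) * ker (x + k) := by
  unfold ker3; ring

/-- The central trilinear estimate: dividing by the phase gains enough to place two of the three
factors in `Ḣ^{-1/2}` and the third in `ℓ^∞`. -/
theorem exists_cubic_bound : ∃ c : ℝ≥0∞, c ≠ ⊤ ∧ ∀ (a h w : ℤ → ℝ≥0∞) (W : ℝ≥0∞), a 0 = 0 →
    (∀ n, w n ≤ W) →
    ∑' n, h n * ∑' x, ∑' k, ker3 n x k * (w x * a k * a (n - x - k)) ≤
      c * (W * nrm h * nrmHalf a ^ 2) := by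
  obtain ⟨c, hc, H⟩ := exists_pairs_bound
  refine ⟨c, hc, fun a h w W ha hw => ?_⟩
  calc _ = ∑' n, ∑' k, ∑' l, h n * (ker3 n (n - k - l) k * (w (n - k - l) * a k * a l)) := by
        refine tsum_congr fun n => ?_
        rw [tsum_eliminate (fun x k l => ker3 n x k * (w x * a k * a l))]
        simp_rw [ENNReal.tsum_mul_left]
    _ ≤ ∑' n, ∑' k, ∑' l, W * (h n * (a k * rho k) * (a l * rho l) * pairs n k l) := by
        refine ENNReal.tsum_le_tsum fun n => ENNReal.tsum_le_tsum fun k =>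
          ENNReal.tsum_le_tsum fun l => ?_
        rcases eq_or_ne k 0 with rfl | hk
        · simp [ha]
        rcases eq_or_ne l 0 with rfl | hl
        · simp [ha]
        have e : ker3 n (n - k - l) k = ker (n - k) * ker (n - l) * ker (k + l) := by
          unfold ker3
          rw [show n - k - l + k = n - l by ring, show n - (n - k - l) = k + l by ring]; ring
        calc _ ≤ h n * (rho k * rho l * pairs n k l * (W * a k * a l)) := by
              rw [e]
              exact mul_le_mul_right (mul_le_mul' (ker_le_rho_mul_pairs hk hl)
                (by gcongr; exact hw _)) _
          _ = _ := by ring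
    _ = W * ∑' n, ∑' k, ∑' l, (h n * (a k * rho k) * (a l * rho l) * pairs n k l) := by
        simp_rw [ENNReal.tsum_mul_left]
    _ ≤ W * (c * (nrm h * nrmHalf a * nrmHalf a)) := by
        gcongr; exact H h (fun k => a k * rho k) (fun l => a l * rho l)
    _ = _ := by ring

/-- The trilinear estimate for the terms in which the time derivative, a loss of `|n - x - k|`,
falls on a factor without the weight `|x|⁻¹`. -/
theorem exists_cubic_derivative_bound : ∃ c : ℝ≥0∞, c ≠ ⊤ ∧ ∀ (a h : ℤ → ℝ≥0∞),
    ∑' n, h n * ∑' x, ∑' k, ker3 n x k * (ker x * absE (n - x - k) * (a x * a k)) ≤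
      c * (nrm h * nrmHalf a * nrm a) := by
  obtain ⟨c, hc, H⟩ := exists_pairs_bound
  refine ⟨c, hc, fun a h => ?_⟩
  calc _ = ∑' n, ∑' x, ∑' k, h n * (a x * ker x) * a k * (absE (n - x - k) * ker3 n x k) := by
        simp_rw [← ENNReal.tsum_mul_left]
        exact tsum_congr fun n => tsum_congr fun x => tsum_congr fun k => by ring
    _ ≤ ∑' n, ∑' x, ∑' k, h n * (a x * ker x) * a k * pairs n x k := by
        gcongr with n x k
        rw [ker3_eq]
        exact absE_mul_ker_le_pairs n x k
    _ ≤ c * (nrm h * nrm (fun x => a x * ker x) * nrm a) := H h (fun x => a x * ker x) a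
    _ ≤ _ := by gcongr; exact nrm_mul_ker_le a

/-- The kernel `|n|^{-1/2} |x|^{-1/2} |n - x|⁻¹` is Hilbert–Schmidt. -/
theorem exists_hilbertSchmidt_bound : ∃ c : ℝ≥0∞, c ≠ ⊤ ∧ ∀ h f : ℤ → ℝ≥0∞,
    ∑' n, ∑' x, h n * f x * (rho n * rho x * ker (n - x)) ≤ c * (nrm h * nrm f) := by
  set c₂ : ℝ≥0∞ := ∑' j, ker j ^ 2 with hc₂
  set S : ℤ × ℤ → ℝ≥0∞ := fun p => rho p.1 * rho p.2 * ker (p.1 - p.2) with hS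
  have hSn : nrm S ≠ ⊤ := by
    refine ENNReal.rpow_ne_top_of_nonneg (by norm_num) ?_
    refine ne_top_of_le_ne_top (b := 2 * c₂ * c₂)
      (ENNReal.mul_ne_top (ENNReal.mul_ne_top (by norm_num) tsum_ker_sq) tsum_ker_sq) ?_
    calc _ = ∑' n, ∑' x, ker n * ker x * ker (n - x) ^ 2 := by
          rw [ENNReal.tsum_prod']
          simp only [hS, mul_pow, rho_sq]
      _ ≤ ∑' n, ∑' x, (ker n ^ 2 * ker (n - x) ^ 2 + ker x ^ 2 * ker (n - x) ^ 2) := by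
          gcongr with n x
          rw [← add_mul]; gcongr; exact mul_le_sq_add_sq _ _
      _ = ∑' n, ∑' x, ker n ^ 2 * ker (n - x) ^ 2 + ∑' x, ∑' n, ker x ^ 2 * ker (n - x) ^ 2 := by
          simp_rw [ENNReal.tsum_add]
          congr 1
          exact ENNReal.tsum_comm
      _ = _ := by
          simp_rw [ENNReal.tsum_mul_left, tsum_reflect (fun x => ker x ^ 2),
            tsum_shift (fun x => ker x ^ 2), ENNReal.tsum_mul_right, ← hc₂]
          ring
  refine ⟨nrm S, hSn, fun h f => ?_⟩
  have e : nrm (fun p : ℤ × ℤ => h p.1 * f p.2) = nrm h * nrm f := by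
    apply sq_inj_ennreal
    rw [mul_pow, nrm_sq, nrm_sq, nrm_sq, ENNReal.tsum_prod']
    simp_rw [mul_pow, ENNReal.tsum_mul_left, ENNReal.tsum_mul_right]
  calc _ = ∑' p : ℤ × ℤ, (h p.1 * f p.2) * S p := by rw [ENNReal.tsum_prod']
    _ ≤ nrm (fun p : ℤ × ℤ => h p.1 * f p.2) * nrm S := tsum_mul_le_nrm _ _
    _ = _ := by rw [e, mul_comm]

/-- The previous estimate with output in `Ḣ^{-1/2}`. If `|k| ≲ |n| |x|`, the weights of `n` and
`x` can be exchanged for the weight `|k|^{-1/2}`; otherwise `k` dominates, two of the kernels and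
the derivative combine to `|k|⁻¹`, and what is left is a Hilbert–Schmidt form in `n` and `x`. -/
theorem exists_cubic_derivative_weighted_bound : ∃ c : ℝ≥0∞, c ≠ ⊤ ∧ ∀ (a h : ℤ → ℝ≥0∞), a 0 = 0 →
    ∑' n, h n * rho n * ∑' x, ∑' k, ker3 n x k * (ker x * absE (n - x - k) * (a x * a k)) ≤
      c * (nrm h * (nrmHalf a ^ 2 + nrmHalf a * sumKer a)) := by
  obtain ⟨c, hc, H⟩ := exists_pairs_bound
  obtain ⟨c', hc', H'⟩ := exists_hilbertSchmidt_bound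
  refine ⟨2 * c + 3 * c', by finiteness, fun a h ha => ?_⟩
  set f : ℤ → ℝ≥0∞ := fun x => a x * rho x with hf
  have key : ∀ n x y, rho n * (ker3 n x y * (ker x * absE (n - x - y) * (a x * a y))) ≤
      2 * (f x * f y * pairs n x y) +
        3 * (f x * (rho n * rho x * ker (n - x)) * (a y * ker y)) := by
    intro n x y
    rcases eq_or_ne n 0 with rfl | hn
    · simp
    rcases eq_or_ne x 0 with rfl | hx
    · simp
    rcases eq_or_ne y 0 with rfl | hy
    · simp [ha]
    have e : rho n * (ker3 n x y * (ker x * absE (n - x - y) * (a x * a y))) =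
        f x * a y * ((rho n * rho x) * (absE (n - x - y) * ker3 n x y)) := by
      rw [hf, ← rho_mul_self x]; ring
    rw [e]
    rcases le_or_gt (|y|) (4 * (|n| * |x|)) with hle | hlt
    · refine le_trans ?_ le_self_add
      calc _ ≤ f x * a y * ((2 * rho y) * pairs n x y) := by
            refine mul_le_mul_right (mul_le_mul' (rho_mul_rho_le hy hle) ?_) _
            rw [ker3_eq]; exact absE_mul_ker_le_pairs n x y
        _ = _ := by rw [hf]; ring
    · refine le_trans ?_ le_add_self
      calc _ = f x * a y * ((rho n * rho x) *
            (absE (n - x - y) * (ker (n - y) * ker (x + y)) * ker (n - x))) := by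
            unfold ker3; ring
        _ ≤ f x * a y * ((rho n * rho x) * (3 * ker y * ker (n - x))) := by
            refine mul_le_mul_right (mul_le_mul_right (mul_le_mul_left ?_ _) _) _
            exact absE_mul_ker_le_of_dominant hn hx hlt
        _ = _ := by ring
  calc _ = ∑' n, ∑' x, ∑' y,
        h n * (rho n * (ker3 n x y * (ker x * absE (n - x - y) * (a x * a y)))) := by
        simp_rw [ENNReal.tsum_mul_left, mul_assoc]
    _ ≤ ∑' n, ∑' x, ∑' y, h n * (2 * (f x * f y * pairs n x y) +
        3 * (f x * (rho n * rho x * ker (n - x)) * (a y * ker y))) := by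
        gcongr with n x y; exact key n x y
    _ = 2 * ∑' n, ∑' x, ∑' y, h n * f x * f y * pairs n x y +
        3 * ((∑' n, ∑' x, h n * f x * (rho n * rho x * ker (n - x))) * sumKer a) := by
        simp_rw [← ENNReal.tsum_mul_right, sumKer, ← ENNReal.tsum_mul_left,
          ← ENNReal.tsum_add]
        exact tsum_congr fun n => tsum_congr fun x => tsum_congr fun y => by ring
    _ ≤ 2 * (c * (nrm h * nrm f * nrm f)) + 3 * (c' * (nrm h * nrm f) * sumKer a) := by
        gcongr
        · exact H h f f
        · exact H' h f
    _ ≤ (2 * c + 3 * c') * (nrm h * (nrm f * nrm f)) +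
          (2 * c + 3 * c') * (nrm h * (nrm f * sumKer a)) := by
        gcongr ?_ + ?_
        · calc _ = (2 * c) * (nrm h * (nrm f * nrm f)) := by ring
            _ ≤ _ := by gcongr; exact le_self_add
        · calc _ = (3 * c') * (nrm h * (nrm f * sumKer a)) := by ring
            _ ≤ _ := by gcongr; exact le_add_self
    _ = _ := by rw [nrmHalf, ← hf]; ring

/-- The resonant cubic terms: `k = -x` and `k = n` both leave the factor `a n` outside of a sum
that is bounded in `Ḣ^{-1/2}`. -/
theorem resonant_le (n : ℤ) :
    ∑' x, ∑' k, (if x + k = 0 ∨ n - k = 0 then ker x * (a x * a k * a (n - x - k)) else 0) ≤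
      2 * (nrmHalf a ^ 2 * a n) := by
  have h1 : ∑' x, ker x * (a x * a (-x) * a n) ≤ nrmHalf a ^ 2 * a n := by
    calc _ = (∑' x, (a x * rho x) * (a (-x) * rho (-x))) * a n := by
          rw [← ENNReal.tsum_mul_right]
          refine tsum_congr fun x => ?_
          rw [rho_neg, ← rho_mul_self]; ring
      _ ≤ _ := by
          gcongr
          have := tsum_conv_le (fun x => a x * rho x) (fun x => a x * rho x) 0
          simpa [sq, nrmHalf] using this
  calc _ ≤ ∑' x, ∑' k, ((if k = -x then ker x * (a x * a (-x) * a n) else 0) +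
        (if k = n then ker x * (a x * a (-x) * a n) else 0)) := by
        gcongr with x k
        by_cases hk : k = -x
        · subst hk
          refine le_trans ?_ le_self_add
          simp
        · by_cases hk' : k = n
          · subst hk'
            refine le_trans ?_ le_add_self
            rw [show k - x - k = -x by ring]
            simp only [sub_self, or_true, if_true]
            exact le_of_eq (by ring)
          · rw [if_neg (by omega)]; exact zero_le
    _ ≤ _ := by
        simp_rw [ENNReal.tsum_add, tsum_ite_eq]
        rw [two_mul]; gcongr

end Multilinear

/-! ### Majorants of the normal form terms -/

theorem nrm_add_le {ι : Type*} (f g : ι → ℝ≥0∞) : nrm (fun i => f i + g i) ≤ nrm f + nrm g := by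
  let _ : MeasurableSpace ι := ⊤
  have h := ENNReal.lintegral_Lp_add_le (μ := Measure.count) (f := f) (g := g) (p := 2)
    (measurable_from_top).aemeasurable (measurable_from_top).aemeasurable (by norm_num)
  simpa [lintegral_count, nrm] using h

/-- Duality: test sequences with finite support and finite values suffice. -/
theorem nrm_le_of_dual {T : ℤ → ℝ≥0∞} {c : ℝ≥0∞}
    (hT : ∀ h : ℤ → ℝ≥0∞, (∃ S : Finset ℤ, ∀ n ∉ S, h n = 0) → (∀ n, h n ≠ ⊤) →
      ∑' n, h n * T n ≤ c * nrm h) : nrm T ≤ c := by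
  rcases eq_or_ne c ⊤ with rfl | hc
  · exact le_top
  have hfin : ∀ n, T n ≠ ⊤ := fun n => by
    have := hT (Pi.single n 1) ⟨{n}, fun m hm => by simp [Finset.mem_singleton.not.1 hm]⟩
      (fun m => by by_cases h : m = n <;> simp [h])
    have e1 : ∑' m, (Pi.single n 1 : ℤ → ℝ≥0∞) m * T m = T n := by
      rw [tsum_eq_single n (fun m hm => by simp [hm])]; simp
    have e2 : nrm (Pi.single n 1 : ℤ → ℝ≥0∞) = 1 := by
      rw [nrm, tsum_eq_single n (fun m hm => by simp [hm])]; simp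
    rw [e1, e2, mul_one] at this
    exact ne_top_of_le_ne_top hc this
  rw [nrm_le_iff, ENNReal.tsum_eq_iSup_sum]
  refine iSup_le fun S => ?_
  classical
  set h : ℤ → ℝ≥0∞ := fun n => if n ∈ S then T n else 0 with hh
  have e1 : ∑' n, h n * T n = ∑ n ∈ S, T n ^ 2 := by
    rw [tsum_eq_sum (s := S) (fun n hn => by simp [hh, hn])]
    exact Finset.sum_congr rfl fun n hn => by simp [hh, hn, sq]
  have e2 : nrm h ^ 2 = ∑ n ∈ S, T n ^ 2 := by
    rw [nrm_sq, tsum_eq_sum (s := S) (fun n hn => by simp [hh, hn])]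
    exact Finset.sum_congr rfl fun n hn => by simp [hh, hn]
  have key := hT h ⟨S, fun n hn => by simp [hh, hn]⟩ (fun n => by
    by_cases hn : n ∈ S <;> simp [hh, hn, hfin])
  rw [e1, ← e2] at key
  rw [← e2, sq_le_sq_iff_le]
  have hnt : nrm h ≠ ⊤ := by
    intro h0
    have : nrm h ^ 2 ≠ ⊤ := by
      rw [e2]; exact ENNReal.sum_ne_top.2 fun n _ => ENNReal.pow_ne_top (hfin n)
    simp [h0] at this
  rcases eq_or_ne (nrm h) 0 with h0 | h0
  · simp [h0]
  · rw [sq] at key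
    exact (ENNReal.mul_le_mul_iff_left h0 hnt).1 key

/-- Majorant of the boundary terms produced by the two integrations by parts in time. -/
noncomputable def boundaryMajorant (a : ℤ → ℝ≥0∞) (n : ℤ) : ℝ≥0∞ :=
  (∑' x, ker x * ker (n - x) * (a x * a (n - x))) +
    2 * ∑' x, ∑' k, ker3 n x k * (ker x * a x * a k * a (n - x - k))

/-- Majorant of the time derivative of the twice transformed unknown; `m` stands for a bound of
`|∂ₜ u_n| / (3 |n|)`. The condition in the first sum describes the resonant frequencies. -/
noncomputable def derivMajorant (m : ℝ≥0∞) (a : ℤ → ℝ≥0∞) (n : ℤ) : ℝ≥0∞ :=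
  6 * (∑' x, ∑' k,
    (if x + k = 0 ∨ n - k = 0 then ker x * (a x * a k * a (n - x - k)) else 0)) +
  6 * m * ∑' x, ∑' k, ker3 n x k * (a k * a (n - x - k) +
    ker x * absE k * (a x * a (n - x - k)) + ker x * absE (n - x - k) * (a x * a k))

theorem exists_boundaryMajorant_bound : ∃ c : ℝ≥0∞, c ≠ ⊤ ∧ ∀ a h : ℤ → ℝ≥0∞, a 0 = 0 →
    ∑' n, h n * boundaryMajorant a n ≤
      c * nrm h * (nrmHalf a * sumKer a + nrmHalf a ^ 3) ∧
    ∑' n, h n * rho n * boundaryMajorant a n ≤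
      c * nrm h * (nrmHalf a ^ 2 + nrmHalf a ^ 3) := by
  obtain ⟨c, hc, H⟩ := exists_cubic_bound
  have hk := nrm_ker_ne_top
  refine ⟨1 + 2 * nrm ker + 2 * c, by finiteness, fun a h ha => ?_⟩
  have hw : ∀ n, ker n * a n ≤ nrmHalf a := fun n => by
    rw [mul_comm]
    exact (mul_le_mul_right (ker_le_rho n) _).trans (le_nrm (fun n => a n * rho n) n)
  have hcub : ∀ g : ℤ → ℝ≥0∞, nrm g ≤ nrm h → ∑' n, g n * (2 * ∑' x, ∑' k, ker3 n x k *
      (ker x * a x * a k * a (n - x - k))) ≤ 2 * c * nrm h * nrmHalf a ^ 3 := fun g hg => by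
    calc _ = 2 * ∑' n, g n * ∑' x, ∑' k, ker3 n x k * (ker x * a x * a k * a (n - x - k)) := by
          rw [← ENNReal.tsum_mul_left]; exact tsum_congr fun n => by ring
      _ ≤ 2 * (c * (nrmHalf a * nrm g * nrmHalf a ^ 2)) := by
          gcongr; exact H a g (fun x => ker x * a x) _ ha hw
      _ ≤ 2 * (c * (nrmHalf a * nrm h * nrmHalf a ^ 2)) := by gcongr
      _ = _ := by ring
  simp only [boundaryMajorant, mul_add, ENNReal.tsum_add]
  constructor
  · refine add_le_add ?_ ?_
    · refine (quadratic_le a h).trans ?_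
      calc _ = 1 * nrm h * (nrmHalf a * sumKer a) := by ring
        _ ≤ _ := by gcongr; rw [add_assoc]; exact le_self_add
    · refine (hcub h le_rfl).trans ?_
      gcongr; exact le_add_self
  · refine add_le_add ?_ ?_
    · refine (quadratic_weighted_le a h).trans ?_
      gcongr; rw [add_right_comm]; exact le_add_self
    · refine (hcub (fun n => h n * rho n) (nrmHalf_le_nrm h)).trans ?_
      gcongr; exact le_add_self

theorem exists_derivMajorant_bound : ∃ c : ℝ≥0∞, c ≠ ⊤ ∧ ∀ (m : ℝ≥0∞) (a h : ℤ → ℝ≥0∞), a 0 = 0 →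
    ∑' n, h n * derivMajorant m a n ≤
      c * nrm h * (nrmHalf a ^ 2 * nrm a + m * (nrmHalf a ^ 2 + nrmHalf a * nrm a)) ∧
    ∑' n, h n * rho n * derivMajorant m a n ≤
      c * nrm h * (nrmHalf a ^ 3 + m * (nrmHalf a ^ 2 + nrmHalf a * sumKer a)) := by
  obtain ⟨c₁, hc₁, H₁⟩ := exists_cubic_bound
  obtain ⟨c₂, hc₂, H₂⟩ := exists_cubic_derivative_bound
  obtain ⟨c₃, hc₃, H₃⟩ := exists_cubic_derivative_weighted_bound
  set c := 12 + 6 * c₁ + 12 * c₂ + 12 * c₃ with hc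
  refine ⟨c, by finiteness, fun m a h ha => ?_⟩
  have hle₀ : 12 ≤ c := by rw [hc, add_assoc, add_assoc]; exact le_self_add
  have hle₁ : 6 * c₁ + 12 * c₂ ≤ c := by
    rw [hc, add_assoc 12]; exact le_self_add.trans' le_add_self
  have hle₂ : 6 * c₁ + 12 * c₃ ≤ c := by
    rw [hc, add_right_comm (12 + 6 * c₁), add_assoc 12]; exact le_self_add.trans' le_add_self
  have hres : ∀ g : ℤ → ℝ≥0∞, ∑' n, g n * (6 * ∑' x, ∑' k,
      (if x + k = 0 ∨ n - k = 0 then ker x * (a x * a k * a (n - x - k)) else 0)) ≤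
      12 * nrmHalf a ^ 2 * ∑' n, g n * a n := fun g => by
    rw [← ENNReal.tsum_mul_left]
    refine ENNReal.tsum_le_tsum fun n => ?_
    calc _ ≤ g n * (6 * (2 * (nrmHalf a ^ 2 * a n))) := by gcongr; exact resonant_le a n
      _ = _ := by ring
  have split : ∀ g : ℤ → ℝ≥0∞, ∑' n, g n * (6 * m * ∑' x, ∑' k, ker3 n x k *
      (a k * a (n - x - k) + ker x * absE k * (a x * a (n - x - k)) +
        ker x * absE (n - x - k) * (a x * a k))) =
      6 * m * (∑' n, g n * ∑' x, ∑' k, ker3 n x k * (1 * a k * a (n - x - k))) +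
      12 * m * (∑' n, g n * ∑' x, ∑' k, ker3 n x k *
        (ker x * absE (n - x - k) * (a x * a k))) := fun g => by
    have ex : ∀ n, ∑' x, ∑' k, ker3 n x k * (ker x * absE k * (a x * a (n - x - k))) =
        ∑' x, ∑' k, ker3 n x k * (ker x * absE (n - x - k) * (a x * a k)) := fun n => by
      rw [tsum_exchange (fun x k l => ker3 n x k * (ker x * absE k * (a x * a l)))]
      simp_rw [ker3_exchange]
    rw [← ENNReal.tsum_mul_left, ← ENNReal.tsum_mul_left, ← ENNReal.tsum_add]
    refine tsum_congr fun n => ?_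
    simp_rw [mul_add (ker3 _ _ _), ENNReal.tsum_add, ex, one_mul]
    ring
  have hcub : ∀ g : ℤ → ℝ≥0∞, nrm g ≤ nrm h →
      (∑' n, g n * ∑' x, ∑' k, ker3 n x k * (1 * a k * a (n - x - k))) ≤
      c₁ * nrm h * nrmHalf a ^ 2 := fun g hg => by
    refine (H₁ a g (fun _ => 1) 1 ha (fun _ => le_rfl)).trans ?_
    rw [one_mul, mul_assoc]; gcongr
  have hρ : nrm (fun n => h n * rho n) ≤ nrm h := nrmHalf_le_nrm h
  simp only [derivMajorant]
  constructor
  · simp only [mul_add (h _), ENNReal.tsum_add, split]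
    calc _ ≤ 12 * nrmHalf a ^ 2 * (nrm h * nrm a) + (6 * m * (c₁ * nrm h * nrmHalf a ^ 2) +
          12 * m * (c₂ * (nrm h * nrmHalf a * nrm a))) := by
          refine add_le_add ((hres h).trans ?_) (add_le_add ?_ ?_)
          · gcongr; exact tsum_mul_le_nrm _ _
          · gcongr; exact hcub h le_rfl
          · gcongr; exact H₂ a h
      _ = 12 * (nrm h * (nrmHalf a ^ 2 * nrm a)) + (6 * c₁ * (nrm h * (m * nrmHalf a ^ 2)) +
          12 * c₂ * (nrm h * (m * (nrmHalf a * nrm a)))) := by ring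
      _ ≤ c * (nrm h * (nrmHalf a ^ 2 * nrm a)) + (c * (nrm h * (m * nrmHalf a ^ 2)) +
          c * (nrm h * (m * (nrmHalf a * nrm a)))) := by
          gcongr
          · exact le_self_add.trans hle₁
          · exact le_add_self.trans hle₁
      _ = _ := by ring
  · simp only [mul_add (_ * rho _), ENNReal.tsum_add, split (fun n => h n * rho n)]
    calc _ ≤ 12 * nrmHalf a ^ 2 * (nrm h * nrmHalf a) + (6 * m * (c₁ * nrm h * nrmHalf a ^ 2) +
          12 * m * (c₃ * (nrm h * (nrmHalf a ^ 2 + nrmHalf a * sumKer a)))) := by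
          refine add_le_add ((hres _).trans ?_) (add_le_add ?_ ?_)
          · gcongr
            refine le_trans (le_of_eq ?_) (tsum_mul_le_nrm _ _)
            exact tsum_congr fun n => by ring
          · exact mul_le_mul_right (hcub (fun n => h n * rho n) hρ) _
          · gcongr; exact H₃ a h ha
      _ = 12 * (nrm h * nrmHalf a ^ 3) + ((6 * c₁ + 12 * c₃) * (nrm h * (m * nrmHalf a ^ 2)) +
          12 * c₃ * (nrm h * (m * (nrmHalf a * sumKer a)))) := by ring
      _ ≤ c * (nrm h * nrmHalf a ^ 3) + (c * (nrm h * (m * nrmHalf a ^ 2)) +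
          c * (nrm h * (m * (nrmHalf a * sumKer a)))) := by
          gcongr
          exact le_add_self.trans hle₂
      _ = _ := by ring

/-! ### The interaction representation and the boundary series -/

open Complex (I)

/-- The oscillating factor `e^{-3iθt}`. -/
noncomputable def phase (θ : ℤ) (t : ℝ) : ℂ := Complex.exp (-(3 * I * θ * t))

/-- The quadratic term of the equation in the interaction representation, without its derivative
factor `3in`. -/
noncomputable def bilin (u : ℤ → ℝ → ℂ) (n : ℤ) (t : ℝ) : ℂ :=
  ∑' x : ℤ, phase (n * x * (n - x)) t * (u x t * u (n - x) t)

/-- The right-hand side of the equation in the interaction representation. -/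
noncomputable def rhs (u : ℤ → ℝ → ℂ) (n : ℤ) (t : ℝ) : ℂ := 3 * I * n * bilin u n t

/-- Mean-zero solutions of KdV in the interaction representation `u_n(t) = e^{-in³t} v̂(n, t)`, with
a bound that is uniform in time (it follows from boundedness in `H¹`). The bound only justifies the
manipulations of series; it does not enter the estimates. -/
structure IsReducedSolution (J : Set ℝ) (u : ℤ → ℝ → ℂ) : Prop where
  zero_mode : ∀ t ∈ J, u 0 t = 0
  hasDeriv : ∀ t ∈ J, ∀ n, HasDerivWithinAt (u n) (rhs u n t) J t
  bounded : ∃ H : ℝ, 0 ≤ H ∧ ∀ t ∈ J, ∀ n, ‖u n t‖ ≤ H * |(n : ℝ)|⁻¹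

theorem norm_phase (θ : ℤ) (t : ℝ) : ‖phase θ t‖ = 1 := by
  rw [phase, show -(3 * I * θ * t) = ((-(3 * θ * t) : ℝ) : ℂ) * I by push_cast; ring]
  exact Complex.norm_exp_ofReal_mul_I _

theorem enorm_phase (θ : ℤ) (t : ℝ) : ‖phase θ t‖ₑ = 1 := by
  rw [← ofReal_norm, norm_phase, ENNReal.ofReal_one]

theorem phase_add (θ φ : ℤ) (t : ℝ) : phase (θ + φ) t = phase θ t * phase φ t := by
  simp only [phase, ← Complex.exp_add]; congr 1; push_cast; ring

theorem hasDerivAt_phase (θ : ℤ) (t : ℝ) :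
    HasDerivAt (phase θ) (-(3 * I * θ) * phase θ t) t := by
  have h : HasDerivAt (fun s : ℝ => -(3 * I * θ * (s : ℂ))) (-(3 * I * θ * 1)) t :=
    ((hasDerivAt_id t).ofReal_comp.const_mul (3 * I * (θ : ℂ))).neg
  refine h.cexp.congr_deriv ?_
  rw [phase]; ring

theorem enorm_inv_intCast (j : ℤ) : ‖((j : ℂ))⁻¹‖ₑ = ker j := by
  rw [← ofReal_norm, norm_inv, Complex.norm_intCast, ker]

theorem enorm_intCast (j : ℤ) : ‖(j : ℂ)‖ₑ = absE j := by
  rw [← ofReal_norm, Complex.norm_intCast, absE]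

section RealKernel

/-- The real number `|j|⁻¹`. -/
noncomputable def rk (j : ℤ) : ℝ := |(j : ℝ)|⁻¹

theorem rk_nonneg (j : ℤ) : 0 ≤ rk j := by unfold rk; positivity

theorem rk_mul_abs_le (j : ℤ) : rk j * |(j : ℝ)| ≤ 1 := inv_mul_le_one

theorem rk_le_one (j : ℤ) : rk j ≤ 1 := by
  rcases eq_or_ne j 0 with rfl | hj
  · simp [rk]
  · exact inv_le_one_of_one_le₀ (one_le_abs_cast hj)

theorem rk_mul_le (i j : ℤ) : rk i * rk j ≤ rk i ^ 2 + rk j ^ 2 := by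
  nlinarith [sq_nonneg (rk i - rk j), sq_nonneg (rk i), sq_nonneg (rk j)]

theorem abs_mul_rk_le {m i j : ℤ} (h : |m| ≤ |i| + |j|) : |(m : ℝ)| * (rk i * rk j) ≤ 2 := by
  have h' : |(m : ℝ)| ≤ |(i : ℝ)| + |(j : ℝ)| := by exact_mod_cast h
  have hi := rk_nonneg i
  have hj := rk_nonneg j
  calc _ ≤ (|(i : ℝ)| + |(j : ℝ)|) * (rk i * rk j) := by gcongr
    _ = (rk i * |(i : ℝ)|) * rk j + rk i * (rk j * |(j : ℝ)|) := by ring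
    _ ≤ 1 * 1 + 1 * 1 := by
        gcongr
        · exact rk_mul_abs_le i
        · exact rk_le_one j
        · exact rk_le_one i
        · exact rk_mul_abs_le j
    _ = 2 := by norm_num

theorem summable_rk_sq : Summable fun j : ℤ => rk j ^ 2 := by
  have := Real.summable_abs_int_rpow (b := 2) (by norm_num)
  refine this.congr fun j => ?_
  rw [rk, Real.rpow_neg (abs_nonneg _), inv_pow]; norm_num

theorem summable_rk_sq_mul {φ : ℤ × ℤ → ℤ × ℤ} (hφ : Function.Injective φ) :
    Summable fun p => rk (φ p).1 ^ 2 * rk (φ p).2 ^ 2 := by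
  have := summable_rk_sq.mul_of_nonneg summable_rk_sq (fun j => sq_nonneg _) (fun j => sq_nonneg _)
  exact this.comp_injective hφ

/-- A summable function of `(x, k)` which dominates all terms of the cubic series. -/
noncomputable def cubicDominant (n : ℤ) (p : ℤ × ℤ) : ℝ :=
  (rk p.1 ^ 2 + rk (n - p.1) ^ 2) *
    (rk p.2 ^ 2 + rk (n - p.1 - p.2) ^ 2 + (rk (n - p.2) ^ 2 + rk (p.1 + p.2) ^ 2)) +
  rk (p.1 + p.2) ^ 2 * (rk p.2 ^ 2 + rk (n - p.2) ^ 2)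

theorem summable_cubicDominant (n : ℤ) : Summable (cubicDominant n) := by
  have key : ∀ φ : ℤ × ℤ → ℤ × ℤ, (∀ p q, φ p = φ q → p = q) →
    Summable fun p => rk (φ p).1 ^ 2 * rk (φ p).2 ^ 2 := fun φ h =>
      summable_rk_sq_mul (fun p q => h p q)
  have s1 := key (fun p => (p.1, p.2)) (by grind)
  have s2 := key (fun p => (p.1, n - p.1 - p.2)) (by grind)
  have s3 := key (fun p => (p.1, n - p.2)) (by grind)
  have s4 := key (fun p => (p.1, p.1 + p.2)) (by grind)
  have s5 := key (fun p => (n - p.1, p.2)) (by grind)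
  have s6 := key (fun p => (n - p.1, n - p.1 - p.2)) (by grind)
  have s7 := key (fun p => (n - p.1, n - p.2)) (by grind)
  have s8 := key (fun p => (n - p.1, p.1 + p.2)) (by grind)
  have s9 := key (fun p => (p.1 + p.2, p.2)) (by grind)
  have s10 := key (fun p => (p.1 + p.2, n - p.2)) (by grind)
  refine ((((s1.add s2).add (s3.add s4)).add ((s5.add s6).add (s7.add s8))).add
    (s9.add s10)).congr fun p => ?_
  simp only [cubicDominant]; ring

theorem rk_cubic_le (n x k : ℤ) :
    rk x ^ 2 * (rk k * rk (n - x - k)) ≤ cubicDominant n (x, k) := by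
  simp only [cubicDominant]
  have h := rk_mul_le k (n - x - k)
  calc _ ≤ rk x ^ 2 * (rk k ^ 2 + rk (n - x - k) ^ 2) := by gcongr
    _ ≤ (rk x ^ 2 + rk (n - x) ^ 2) *
        (rk k ^ 2 + rk (n - x - k) ^ 2 + (rk (n - k) ^ 2 + rk (x + k) ^ 2)) := by
        exact mul_le_mul (le_add_of_nonneg_right (by positivity))
          (le_add_of_nonneg_right (by positivity)) (by positivity) (by positivity)
    _ ≤ _ := le_add_of_nonneg_right (by positivity)

/-- In each term, the derivative is absorbed by `rk x` and at most one further kernel. -/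
theorem rk_deriv_le (n x k : ℤ) {H B : ℝ} (hB : 0 ≤ B) :
    rk x * (rk (x + k) * rk (n - k) * rk (n - x)) *
      (B * |(x : ℝ)| * (H * rk k) * (H * rk (n - x - k)) +
        H * rk x * (B * |(k : ℝ)|) * (H * rk (n - x - k)) +
        H * rk x * (H * rk k) * (B * |((n - x - k : ℤ) : ℝ)|)) ≤
      5 * (B * H ^ 2) * cubicDominant n (x, k) := by
  set X := rk x with hX
  set K := rk k with hK
  set L := rk (n - x - k) with hL
  set P := rk (x + k) with hP
  set Q := rk (n - k) with hQ
  set R := rk (n - x) with hR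
  have hX0 : 0 ≤ X := rk_nonneg _
  have hK0 : 0 ≤ K := rk_nonneg _
  have hL0 : 0 ≤ L := rk_nonneg _
  have hP0 : 0 ≤ P := rk_nonneg _
  have hQ0 : 0 ≤ Q := rk_nonneg _
  have hR0 : 0 ≤ R := rk_nonneg _
  have e1 : X * |(x : ℝ)| ≤ 1 := rk_mul_abs_le x
  have e2 : |(k : ℝ)| * (P * X) ≤ 2 := abs_mul_rk_le (by grind)
  have e3 : |((n - x - k : ℤ) : ℝ)| * (Q * X) ≤ 2 := abs_mul_rk_le (by grind)
  have d : cubicDominant n (x, k) = (X ^ 2 + R ^ 2) * (K ^ 2 + L ^ 2 + (Q ^ 2 + P ^ 2)) +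
    P ^ 2 * (K ^ 2 + Q ^ 2) := rfl
  have t1 : (X * |(x : ℝ)|) * L * ((R * P) * (K * Q)) ≤ cubicDominant n (x, k) := by
    calc _ ≤ 1 * 1 * ((R ^ 2 + P ^ 2) * (K ^ 2 + Q ^ 2)) := by
          gcongr
          · exact rk_le_one _
          · exact rk_mul_le _ _
          · exact rk_mul_le _ _
      _ ≤ _ := by
          rw [d]
          have : 0 ≤ X ^ 2 * (K ^ 2 + L ^ 2 + (Q ^ 2 + P ^ 2)) + R ^ 2 * (L ^ 2 + P ^ 2) := by
            positivity
          linarith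
  have t2 : (|(k : ℝ)| * (P * X)) * ((X * R) * (L * Q)) ≤ 2 * cubicDominant n (x, k) := by
    calc _ ≤ 2 * ((X ^ 2 + R ^ 2) * (L ^ 2 + Q ^ 2)) := by
          gcongr
          · exact rk_mul_le _ _
          · exact rk_mul_le _ _
      _ ≤ _ := by
          rw [d]
          have : 0 ≤ (X ^ 2 + R ^ 2) * (K ^ 2 + P ^ 2) + P ^ 2 * (K ^ 2 + Q ^ 2) := by
            positivity
          linarith
  have t3 : (|((n - x - k : ℤ) : ℝ)| * (Q * X)) * ((X * R) * (K * P)) ≤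
      2 * cubicDominant n (x, k) := by
    calc _ ≤ 2 * ((X ^ 2 + R ^ 2) * (K ^ 2 + P ^ 2)) := by
          gcongr
          · exact rk_mul_le _ _
          · exact rk_mul_le _ _
      _ ≤ _ := by
          rw [d]
          have : 0 ≤ (X ^ 2 + R ^ 2) * (L ^ 2 + Q ^ 2) + P ^ 2 * (K ^ 2 + Q ^ 2) := by
            positivity
          linarith
  calc _ = B * H ^ 2 * ((X * |(x : ℝ)|) * L * ((R * P) * (K * Q)) +
        (|(k : ℝ)| * (P * X)) * ((X * R) * (L * Q)) +
        (|((n - x - k : ℤ) : ℝ)| * (Q * X)) * ((X * R) * (K * P))) := by ring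
    _ ≤ B * H ^ 2 * (cubicDominant n (x, k) + 2 * cubicDominant n (x, k) +
        2 * cubicDominant n (x, k)) := by gcongr
    _ = _ := by ring

end RealKernel

section NormalForm

variable (u : ℤ → ℝ → ℂ) (n : ℤ)

/-- The terms of the boundary series of the first integration by parts in time. A vanishing
denominator needs no exception, as `0⁻¹ = 0` and the mode `u 0` vanishes. -/
noncomputable def quadTerm (x : ℤ) (t : ℝ) : ℂ :=
  ((x : ℂ) * ((n - x : ℤ) : ℂ))⁻¹ * (phase (n * x * (n - x)) t * (u x t * u (n - x) t))

/-- The time derivative of `quadTerm`. -/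
noncomputable def quadTermDeriv (x : ℤ) (t : ℝ) : ℂ :=
  ((x : ℂ) * ((n - x : ℤ) : ℂ))⁻¹ *
    (-(3 * I * (n * x * (n - x) : ℤ)) * phase (n * x * (n - x)) t * (u x t * u (n - x) t) +
      phase (n * x * (n - x)) t * (rhs u x t * u (n - x) t + u x t * rhs u (n - x) t))

/-- The terms of the boundary series of the second integration by parts in time. Since `0⁻¹ = 0`,
the resonant frequencies do not contribute. -/
noncomputable def cubicTerm (p : ℤ × ℤ) (t : ℝ) : ℂ :=
  ((p.1 : ℂ))⁻¹ * (((p.1 + p.2 : ℤ) : ℂ) * ((n - p.2 : ℤ) : ℂ) * ((n - p.1 : ℤ) : ℂ))⁻¹ *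
    (phase ((p.1 + p.2) * (n - p.2) * (n - p.1)) t * (u p.1 t * u p.2 t * u (n - p.1 - p.2) t))

/-- The time derivative of `cubicTerm`. -/
noncomputable def cubicTermDeriv (p : ℤ × ℤ) (t : ℝ) : ℂ :=
  ((p.1 : ℂ))⁻¹ * (((p.1 + p.2 : ℤ) : ℂ) * ((n - p.2 : ℤ) : ℂ) * ((n - p.1 : ℤ) : ℂ))⁻¹ *
    (-(3 * I * ((p.1 + p.2) * (n - p.2) * (n - p.1) : ℤ)) *
        phase ((p.1 + p.2) * (n - p.2) * (n - p.1)) t *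
        (u p.1 t * u p.2 t * u (n - p.1 - p.2) t) +
      phase ((p.1 + p.2) * (n - p.2) * (n - p.1)) t *
        (rhs u p.1 t * u p.2 t * u (n - p.1 - p.2) t + u p.1 t * rhs u p.2 t * u (n - p.1 - p.2) t
          + u p.1 t * u p.2 t * rhs u (n - p.1 - p.2) t))

/-- The sum of both boundary series. -/
noncomputable def boundaryTerm (t : ℝ) : ℂ :=
  (∑' x, quadTerm u n x t) + 2 * ∑' p, cubicTerm u n p t

variable {u} {J : Set ℝ}

theorem hasDerivAt_quadTerm {x : ℤ} {t : ℝ} (hu : ∀ m, HasDerivAt (u m) (rhs u m t) t) :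
    HasDerivAt (quadTerm u n x) (quadTermDeriv u n x t) t := by
  have := ((hasDerivAt_phase (n * x * (n - x)) t).mul ((hu x).mul (hu (n - x)))).const_mul
    ((x : ℂ) * ((n - x : ℤ) : ℂ))⁻¹
  exact this

theorem hasDerivAt_cubicTerm {p : ℤ × ℤ} {t : ℝ} (hu : ∀ m, HasDerivAt (u m) (rhs u m t) t) :
    HasDerivAt (cubicTerm u n p) (cubicTermDeriv u n p t) t := by
  have := ((hasDerivAt_phase ((p.1 + p.2) * (n - p.2) * (n - p.1)) t).mul
    (((hu p.1).mul (hu p.2)).mul (hu (n - p.1 - p.2)))).const_mul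
    (((p.1 : ℂ))⁻¹ * (((p.1 + p.2 : ℤ) : ℂ) * ((n - p.2 : ℤ) : ℂ) * ((n - p.1 : ℤ) : ℂ))⁻¹)
  refine this.congr_deriv ?_
  unfold cubicTermDeriv
  simp only [Pi.mul_apply]
  ring

theorem continuousOn_quadTerm {x : ℤ} (hu : ∀ m, ContinuousOn (u m) J) :
    ContinuousOn (quadTerm u n x) J := by
  have : ∀ θ, Continuous (phase θ) := fun θ =>
    continuous_iff_continuousAt.2 fun t => (hasDerivAt_phase θ t).continuousAt
  exact continuousOn_const.mul ((this _).continuousOn.mul ((hu _).mul (hu _)))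

theorem continuousOn_cubicTerm {p : ℤ × ℤ} (hu : ∀ m, ContinuousOn (u m) J) :
    ContinuousOn (cubicTerm u n p) J := by
  have : ∀ θ, Continuous (phase θ) := fun θ =>
    continuous_iff_continuousAt.2 fun t => (hasDerivAt_phase θ t).continuousAt
  exact continuousOn_const.mul ((this _).continuousOn.mul (((hu _).mul (hu _)).mul (hu _)))

variable {t H B : ℝ}

theorem norm_inv_intCast (j : ℤ) : ‖(j : ℂ)‖⁻¹ = rk j := by rw [Complex.norm_intCast, rk]

theorem norm_quadTerm_le (hH : 0 ≤ H) (hu : ∀ m, ‖u m t‖ ≤ H * rk m) (x : ℤ) :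
    ‖quadTerm u n x t‖ ≤ H ^ 2 * (rk x ^ 2 + rk (n - x) ^ 2) := by
  have hx := rk_nonneg x
  have hy := rk_nonneg (n - x)
  rw [quadTerm, norm_mul, norm_mul, norm_phase, norm_mul, norm_inv, norm_mul, mul_inv,
    norm_inv_intCast, norm_inv_intCast]
  calc _ ≤ rk x * rk (n - x) * (1 * ((H * rk x) * (H * rk (n - x)))) := by
        gcongr
        · exact hu _
        · exact hu _
    _ = H ^ 2 * ((rk x * rk (n - x)) * (rk x * rk (n - x))) := by ring
    _ ≤ H ^ 2 * (1 * (rk x ^ 2 + rk (n - x) ^ 2)) := by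
        gcongr
        · exact mul_le_one₀ (rk_le_one _) hy (rk_le_one _)
        · exact rk_mul_le _ _
    _ = _ := by ring

theorem norm_cubicTerm_le (hH : 0 ≤ H) (hu : ∀ m, ‖u m t‖ ≤ H * rk m) (p : ℤ × ℤ) :
    ‖cubicTerm u n p t‖ ≤ H ^ 3 * cubicDominant n p := by
  obtain ⟨x, k⟩ := p
  have h0 := rk_nonneg x
  have h1 := rk_nonneg k
  have h2 := rk_nonneg (n - x - k)
  have h3 := rk_nonneg (x + k)
  have h4 := rk_nonneg (n - k)
  have h5 := rk_nonneg (n - x)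
  simp only [cubicTerm, norm_mul, norm_phase, norm_inv, mul_inv, norm_inv_intCast]
  calc _ ≤ rk x * (1 * 1 * 1) *
        (1 * ((H * rk x) * (H * rk k) * (H * rk (n - x - k)))) := by
        gcongr
        · exact rk_le_one _
        · exact rk_le_one _
        · exact rk_le_one _
        · exact hu _
        · exact hu _
        · exact hu _
    _ = H ^ 3 * (rk x ^ 2 * (rk k * rk (n - x - k))) := by ring
    _ ≤ _ := by gcongr; exact rk_cubic_le n x k

theorem norm_quadTermDeriv_le (hH : 0 ≤ H) (hB : 0 ≤ B) (hu : ∀ m, ‖u m t‖ ≤ H * rk m)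
    (hr : ∀ m : ℤ, ‖rhs u m t‖ ≤ B * |(m : ℝ)|) (x : ℤ) :
    ‖quadTermDeriv u n x t‖ ≤
      (3 * |(n : ℝ)| * H ^ 2 + B * H) * (rk x ^ 2 + rk (n - x) ^ 2) := by
  have hx := rk_nonneg x
  have hy := rk_nonneg (n - x)
  have ex := rk_mul_abs_le x
  have ey := rk_mul_abs_le (n - x)
  rw [quadTermDeriv, norm_mul, norm_inv, norm_mul, mul_inv, norm_inv_intCast, norm_inv_intCast]
  have h1 : ‖-(3 * I * (n * x * (n - x) : ℤ)) * phase (n * x * (n - x)) t *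
      (u x t * u (n - x) t)‖ ≤ 3 * (|(n : ℝ)| * |(x : ℝ)| * |((n - x : ℤ) : ℝ)|) *
        ((H * rk x) * (H * rk (n - x))) := by
    rw [norm_mul, norm_mul, norm_phase, norm_neg, norm_mul, Complex.norm_intCast, norm_mul]
    simp only [Int.cast_mul, abs_mul, Complex.norm_I, norm_mul, mul_one]
    gcongr
    · simp
    · exact hu _
    · exact hu _
  have h2 : ‖phase (n * x * (n - x)) t * (rhs u x t * u (n - x) t + u x t * rhs u (n - x) t)‖ ≤
      (B * |(x : ℝ)|) * (H * rk (n - x)) + (H * rk x) * (B * |((n - x : ℤ) : ℝ)|) := by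
    rw [norm_mul, norm_phase, one_mul]
    refine (norm_add_le _ _).trans ?_
    rw [norm_mul, norm_mul]
    gcongr
    · exact hr _
    · exact hu _
    · exact hu _
    · exact hr _
  calc _ ≤ rk x * rk (n - x) * (3 * (|(n : ℝ)| * |(x : ℝ)| * |((n - x : ℤ) : ℝ)|) *
        ((H * rk x) * (H * rk (n - x))) + ((B * |(x : ℝ)|) * (H * rk (n - x)) +
          (H * rk x) * (B * |((n - x : ℤ) : ℝ)|))) := by
        gcongr
        exact (norm_add_le _ _).trans (add_le_add h1 h2)
    _ = 3 * |(n : ℝ)| * H ^ 2 * ((rk x * |(x : ℝ)|) * (rk (n - x) * |((n - x : ℤ) : ℝ)|) *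
          (rk x * rk (n - x))) + B * H * ((rk x * |(x : ℝ)|) * rk (n - x) ^ 2 +
          rk x ^ 2 * (rk (n - x) * |((n - x : ℤ) : ℝ)|)) := by ring
    _ ≤ 3 * |(n : ℝ)| * H ^ 2 * (1 * 1 * (rk x ^ 2 + rk (n - x) ^ 2)) +
          B * H * (1 * rk (n - x) ^ 2 + rk x ^ 2 * 1) := by
        gcongr
        exact rk_mul_le _ _
    _ = _ := by ring

theorem norm_cubicTermDeriv_le (hH : 0 ≤ H) (hB : 0 ≤ B) (hu : ∀ m, ‖u m t‖ ≤ H * rk m)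
    (hr : ∀ m : ℤ, ‖rhs u m t‖ ≤ B * |(m : ℝ)|) (p : ℤ × ℤ) :
    ‖cubicTermDeriv u n p t‖ ≤ (3 * H ^ 3 + 5 * (B * H ^ 2)) * cubicDominant n p := by
  obtain ⟨x, k⟩ := p
  have h0 := rk_nonneg x
  have h1 := rk_nonneg k
  have h2 := rk_nonneg (n - x - k)
  have h3 := rk_nonneg (x + k)
  have h4 := rk_nonneg (n - k)
  have h5 := rk_nonneg (n - x)
  have a1 : ‖-(3 * I * ((x + k) * (n - k) * (n - x) : ℤ)) *
        phase ((x + k) * (n - k) * (n - x)) t * (u x t * u k t * u (n - x - k) t)‖ ≤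
      3 * (|((x + k : ℤ) : ℝ)| * |((n - k : ℤ) : ℝ)| * |((n - x : ℤ) : ℝ)|) *
        ((H * rk x) * (H * rk k) * (H * rk (n - x - k))) := by
    rw [norm_mul, norm_mul, norm_phase, norm_neg, norm_mul, Complex.norm_intCast, norm_mul]
    simp only [Int.cast_mul, abs_mul, Complex.norm_I, norm_mul, mul_one]
    gcongr
    · simp
    · exact hu _
    · exact hu _
    · exact hu _
  have a2 : ‖phase ((x + k) * (n - k) * (n - x)) t *
        (rhs u x t * u k t * u (n - x - k) t + u x t * rhs u k t * u (n - x - k) t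
          + u x t * u k t * rhs u (n - x - k) t)‖ ≤
      B * |(x : ℝ)| * (H * rk k) * (H * rk (n - x - k)) +
        H * rk x * (B * |(k : ℝ)|) * (H * rk (n - x - k)) +
        H * rk x * (H * rk k) * (B * |((n - x - k : ℤ) : ℝ)|) := by
    rw [norm_mul, norm_phase, one_mul]
    refine (norm_add₃_le).trans ?_
    simp only [norm_mul]
    gcongr
    all_goals first | exact hu _ | exact hr _
  have b := rk_deriv_le (H := H) n x k hB
  simp only [cubicTermDeriv]
  rw [norm_mul, norm_mul, norm_inv, norm_inv, norm_mul, norm_mul, mul_inv, mul_inv]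
  simp only [norm_inv_intCast]
  calc _ ≤ rk x * (rk (x + k) * rk (n - k) * rk (n - x)) *
        (3 * (|((x + k : ℤ) : ℝ)| * |((n - k : ℤ) : ℝ)| * |((n - x : ℤ) : ℝ)|) *
        ((H * rk x) * (H * rk k) * (H * rk (n - x - k))) +
        (B * |(x : ℝ)| * (H * rk k) * (H * rk (n - x - k)) +
        H * rk x * (B * |(k : ℝ)|) * (H * rk (n - x - k)) +
        H * rk x * (H * rk k) * (B * |((n - x - k : ℤ) : ℝ)|))) := by
        gcongr
        exact (norm_add_le _ _).trans (add_le_add a1 a2)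
    _ = 3 * H ^ 3 * (((rk (x + k) * |((x + k : ℤ) : ℝ)|) * (rk (n - k) * |((n - k : ℤ) : ℝ)|) *
          (rk (n - x) * |((n - x : ℤ) : ℝ)|)) * (rk x ^ 2 * (rk k * rk (n - x - k)))) +
        rk x * (rk (x + k) * rk (n - k) * rk (n - x)) *
        (B * |(x : ℝ)| * (H * rk k) * (H * rk (n - x - k)) +
        H * rk x * (B * |(k : ℝ)|) * (H * rk (n - x - k)) +
        H * rk x * (H * rk k) * (B * |((n - x - k : ℤ) : ℝ)|)) := by ring
    _ ≤ 3 * H ^ 3 * ((1 * 1 * 1) * cubicDominant n (x, k)) +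
        5 * (B * H ^ 2) * cubicDominant n (x, k) := by
        gcongr
        · exact rk_mul_abs_le _
        · exact rk_mul_abs_le _
        · exact rk_mul_abs_le _
        · exact rk_cubic_le n x k
    _ = _ := by ring

end NormalForm

/-! ### Cancellation and the mean value inequality -/

section Cancellation

variable {u : ℤ → ℝ → ℂ} {J : Set ℝ} {t H B : ℝ}

/-- The terms left over in the time derivative after the two integrations by parts: the resonant
cubic terms, and the terms where the derivative falls on one of the unknowns. The factors of the
form `z⁻¹ * z` are indicators of `z ≠ 0`; their difference selects the resonant frequencies. -/
noncomputable def remainderTerm (u : ℤ → ℝ → ℂ) (n : ℤ) (t : ℝ) (p : ℤ × ℤ) : ℂ :=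
  6 * I * (((p.1 : ℂ))⁻¹ * ((((n - p.1 : ℤ) : ℂ))⁻¹ * ((n - p.1 : ℤ) : ℂ) -
      (((p.1 + p.2 : ℤ) : ℂ) * ((n - p.2 : ℤ) : ℂ) * ((n - p.1 : ℤ) : ℂ))⁻¹ *
      (((p.1 + p.2 : ℤ) : ℂ) * ((n - p.2 : ℤ) : ℂ) * ((n - p.1 : ℤ) : ℂ)))) *
    phase ((p.1 + p.2) * (n - p.2) * (n - p.1)) t * (u p.1 t * u p.2 t * u (n - p.1 - p.2) t) +
  2 * (((p.1 : ℂ))⁻¹ * (((p.1 + p.2 : ℤ) : ℂ) * ((n - p.2 : ℤ) : ℂ) * ((n - p.1 : ℤ) : ℂ))⁻¹ *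
    (phase ((p.1 + p.2) * (n - p.2) * (n - p.1)) t *
        (rhs u p.1 t * u p.2 t * u (n - p.1 - p.2) t + u p.1 t * rhs u p.2 t * u (n - p.1 - p.2) t
          + u p.1 t * u p.2 t * rhs u (n - p.1 - p.2) t)))

theorem summable_rk_pair (n : ℤ) : Summable fun x => rk x ^ 2 + rk (n - x) ^ 2 :=
  summable_rk_sq.add ((Equiv.subLeft n).summable_iff.2 summable_rk_sq)

/-- First cancellation: the derivative of the phase in `quadTerm` removes the quadratic
nonlinearity. The two places where the derivative can fall on an unknown are exchanged by the
reflection of the summation index. -/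
theorem rhs_add_tsum_quadTermDeriv (hH : 0 ≤ H) (hB : 0 ≤ B) (h0 : u 0 t = 0)
    (hu : ∀ m, ‖u m t‖ ≤ H * rk m) (hr : ∀ m : ℤ, ‖rhs u m t‖ ≤ B * |(m : ℝ)|) (n : ℤ) :
    rhs u n t + ∑' x, quadTermDeriv u n x t =
      2 * ∑' x : ℤ, ((x : ℂ) * ((n - x : ℤ) : ℂ))⁻¹ *
        (phase (n * x * (n - x)) t * (u x t * rhs u (n - x) t)) := by
  set A : ℤ → ℂ := fun x => ((x : ℂ) * ((n - x : ℤ) : ℂ))⁻¹ *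
        (phase (n * x * (n - x)) t * (u x t * rhs u (n - x) t)) with hA
  set E : ℤ → ℂ := fun x => phase (n * x * (n - x)) t * (u x t * u (n - x) t) with hE
  have sA : Summable A := by
    refine Summable.of_norm_bounded ((summable_rk_pair n).mul_left (H * B)) fun x => ?_
    have hx := rk_nonneg x
    have hy := rk_nonneg (n - x)
    rw [hA]
    simp only [norm_mul, norm_inv, mul_inv, norm_inv_intCast, norm_phase]
    calc _ ≤ rk x * rk (n - x) * (1 * (H * rk x * (B * |((n - x : ℤ) : ℝ)|))) := by
          gcongr
          · exact hu _
          · exact hr _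
      _ = H * B * (rk x ^ 2 * (rk (n - x) * |((n - x : ℤ) : ℝ)|)) := by ring
      _ ≤ H * B * (rk x ^ 2 * 1) := by gcongr; exact rk_mul_abs_le _
      _ ≤ _ := by
          gcongr; rw [mul_one]; exact le_add_of_nonneg_right (by positivity)
  have sE : Summable E := by
    refine Summable.of_norm_bounded ((summable_rk_pair n).mul_left (H ^ 2)) fun x => ?_
    have hx := rk_nonneg x
    have hy := rk_nonneg (n - x)
    rw [hE]
    simp only [norm_mul, norm_phase]
    calc _ ≤ 1 * (H * rk x * (H * rk (n - x))) := by
          gcongr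
          · exact hu _
          · exact hu _
      _ = H ^ 2 * (rk x * rk (n - x)) := by ring
      _ ≤ _ := by gcongr; exact rk_mul_le _ _
  have sA' : Summable fun x => A (n - x) := (Equiv.subLeft n).summable_iff.2 sA
  have eA' : ∑' x, A (n - x) = ∑' x, A x := (Equiv.subLeft n).tsum_eq A
  have key : ∀ x, quadTermDeriv u n x t = (-(3 * I * n)) * E x + (A x + A (n - x)) := by
    intro x
    simp only [quadTermDeriv, hA, hE, sub_sub_cancel]
    rw [show n * (n - x) * x = n * x * (n - x) by ring]
    rcases eq_or_ne x 0 with rfl | hx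
    · simp [h0]
    rcases eq_or_ne (n - x) 0 with hy | hy
    · simp [hy, h0]
    have hx' : (x : ℂ) ≠ 0 := by exact_mod_cast hx
    have hy' : ((n - x : ℤ) : ℂ) ≠ 0 := by exact_mod_cast hy
    rw [show ((n * x * (n - x) : ℤ) : ℂ) = n * x * ((n - x : ℤ) : ℂ) by push_cast; ring]
    field_simp
    ring
  simp_rw [key]
  rw [(sE.mul_left _).tsum_add (sA.add sA'), sA.tsum_add sA', eA', tsum_mul_left, rhs, bilin]
  ring

/-- Insertion of the equation for `u (n - x)` turns the remaining quadratic series into a cubic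
one. -/
theorem hasSum_cubic_of_quadratic (hH : 0 ≤ H) (hu : ∀ m, ‖u m t‖ ≤ H * rk m) (n : ℤ) :
    HasSum (fun p : ℤ × ℤ => 3 * I * (((p.1 : ℂ))⁻¹ *
      ((((n - p.1 : ℤ) : ℂ))⁻¹ * ((n - p.1 : ℤ) : ℂ))) *
      phase ((p.1 + p.2) * (n - p.2) * (n - p.1)) t * (u p.1 t * u p.2 t * u (n - p.1 - p.2) t))
      (∑' x : ℤ, ((x : ℂ) * ((n - x : ℤ) : ℂ))⁻¹ *
        (phase (n * x * (n - x)) t * (u x t * rhs u (n - x) t))) := by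
  set D : ℤ × ℤ → ℂ := fun p => 3 * I * (((p.1 : ℂ))⁻¹ *
      ((((n - p.1 : ℤ) : ℂ))⁻¹ * ((n - p.1 : ℤ) : ℂ))) *
      phase ((p.1 + p.2) * (n - p.2) * (n - p.1)) t *
        (u p.1 t * u p.2 t * u (n - p.1 - p.2) t) with hD
  have sD : Summable D := by
    refine Summable.of_norm_bounded ((summable_cubicDominant n).mul_left (3 * H ^ 3)) fun p => ?_
    obtain ⟨x, k⟩ := p
    have hx := rk_nonneg x
    have hk := rk_nonneg k
    have hl := rk_nonneg (n - x - k)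
    have hy := rk_nonneg (n - x)
    rw [hD]
    simp only [norm_mul, norm_inv, norm_inv_intCast, norm_phase, Complex.norm_I, mul_one,
      Complex.norm_ofNat]
    rw [Complex.norm_intCast (n - x)]
    calc _ ≤ 3 * (rk x * 1) * (H * rk x * (H * rk k) * (H * rk (n - x - k))) := by
          gcongr
          · exact rk_mul_abs_le _
          · exact hu _
          · exact hu _
          · exact hu _
      _ = 3 * H ^ 3 * (rk x ^ 2 * (rk k * rk (n - x - k))) := by ring
      _ ≤ _ := by gcongr; exact rk_cubic_le n x k
  have e : ∀ x : ℤ, ((x : ℂ) * ((n - x : ℤ) : ℂ))⁻¹ *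
      (phase (n * x * (n - x)) t * (u x t * rhs u (n - x) t)) = ∑' k, D (x, k) := by
    intro x
    rw [rhs, bilin, ← tsum_mul_left, ← tsum_mul_left, ← tsum_mul_left, ← tsum_mul_left]
    refine tsum_congr fun k => ?_
    simp only [hD]
    rw [show (x + k) * (n - k) * (n - x) = n * x * (n - x) + (n - x) * k * (n - x - k) by ring,
      phase_add, mul_inv]
    ring
  simp_rw [e]
  rw [← sD.tsum_prod]
  exact sD.hasSum

/-- The time derivative of `u_n + boundaryTerm` consists of the remainder terms alone: the
quadratic and the nonresonant cubic nonlinearities cancel. -/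
theorem derivative_eq_tsum_remainderTerm (hH : 0 ≤ H) (hB : 0 ≤ B) (h0 : u 0 t = 0)
    (hu : ∀ m, ‖u m t‖ ≤ H * rk m) (hr : ∀ m : ℤ, ‖rhs u m t‖ ≤ B * |(m : ℝ)|) (n : ℤ) :
    rhs u n t + ((∑' x, quadTermDeriv u n x t) + 2 * ∑' p, cubicTermDeriv u n p t) =
      ∑' p, remainderTerm u n t p := by
  have h1 := hasSum_cubic_of_quadratic hH hu n
  have sC : Summable fun p => cubicTermDeriv u n p t :=
    Summable.of_norm_bounded ((summable_cubicDominant n).mul_left _)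
      (norm_cubicTermDeriv_le n hH hB hu hr)
  rw [← add_assoc, rhs_add_tsum_quadTermDeriv hH hB h0 hu hr, ← h1.tsum_eq, ← tsum_mul_left,
    ← tsum_mul_left, ← (h1.summable.mul_left 2).tsum_add (sC.mul_left 2)]
  refine tsum_congr fun p => ?_
  simp only [remainderTerm, cubicTermDeriv]
  push_cast
  ring

theorem enorm_rhs_le (m : ℤ) :
    ‖rhs u m t‖ₑ ≤ 3 * absE m * nrm (fun j => ‖u j t‖ₑ) ^ 2 := by
  rw [rhs, enorm_mul, enorm_mul, enorm_intCast]
  gcongr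
  · rw [enorm_mul, ← ofReal_norm, ← ofReal_norm]; simp
  · refine enorm_tsum_le_tsum_enorm.trans ?_
    simp_rw [enorm_mul, enorm_phase, one_mul]
    rw [sq]
    exact tsum_conv_le (fun j => ‖u j t‖ₑ) _ m

theorem enorm_two_complex : ‖(2 : ℂ)‖ₑ = 2 := by
  rw [← ofReal_norm, Complex.norm_ofNat, ENNReal.ofReal_ofNat]

theorem enorm_six_complex : ‖(6 : ℂ)‖ₑ = 6 := by
  rw [← ofReal_norm, Complex.norm_ofNat, ENNReal.ofReal_ofNat]

theorem enorm_boundaryTerm_le (n : ℤ) :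
    ‖boundaryTerm u n t‖ₑ ≤ boundaryMajorant (fun j => ‖u j t‖ₑ) n := by
  rw [boundaryTerm, boundaryMajorant]
  refine (enorm_add_le _ _).trans (add_le_add ?_ ?_)
  · refine enorm_tsum_le_tsum_enorm.trans (le_of_eq (tsum_congr fun x => ?_))
    rw [quadTerm, mul_inv, enorm_mul, enorm_mul, enorm_mul, enorm_mul, enorm_phase,
      enorm_inv_intCast, enorm_inv_intCast, one_mul]
  · rw [enorm_mul, enorm_two_complex]
    gcongr
    refine enorm_tsum_le_tsum_enorm.trans (le_of_eq ?_)
    rw [ENNReal.tsum_prod']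
    refine tsum_congr fun x => tsum_congr fun k => ?_
    simp only [cubicTerm, ker3, mul_inv, enorm_mul, enorm_phase, enorm_inv_intCast]
    ring

theorem enorm_I : ‖I‖ₑ = 1 := by rw [← ofReal_norm]; simp

theorem enorm_remainderTerm_le (n : ℤ) (x k : ℤ) {m : ℝ≥0∞}
    (hm : ∀ j : ℤ, ‖rhs u j t‖ₑ ≤ 3 * absE j * m) :
    ‖remainderTerm u n t (x, k)‖ₑ ≤
      6 * (if x + k = 0 ∨ n - k = 0 then
        ker x * (‖u x t‖ₑ * ‖u k t‖ₑ * ‖u (n - x - k) t‖ₑ) else 0) +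
      6 * m * (ker3 n x k * (‖u k t‖ₑ * ‖u (n - x - k) t‖ₑ +
        ker x * absE k * (‖u x t‖ₑ * ‖u (n - x - k) t‖ₑ) +
        ker x * absE (n - x - k) * (‖u x t‖ₑ * ‖u k t‖ₑ))) := by
  refine (enorm_add_le _ _).trans (add_le_add ?_ ?_)
  · simp only
    by_cases hr : n - x = 0
    · simp [hr]
    have hr' : ((n - x : ℤ) : ℂ) ≠ 0 := by exact_mod_cast hr
    by_cases hpq : x + k = 0 ∨ n - k = 0
    · rw [if_pos hpq]
      have : ((x + k : ℤ) : ℂ) * ((n - k : ℤ) : ℂ) = 0 := by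
        rcases hpq with h | h <;> simp [h]
      rw [this]
      simp only [enorm_mul, enorm_phase, enorm_inv_intCast, enorm_I, enorm_six_complex,
        inv_mul_cancel₀ hr', zero_mul, mul_zero, sub_zero, mul_one, one_mul, mul_assoc, le_refl]
    · rw [if_neg hpq]
      push Not at hpq
      have hp' : ((x + k : ℤ) : ℂ) ≠ 0 := by exact_mod_cast hpq.1
      have hq' : ((n - k : ℤ) : ℂ) ≠ 0 := by exact_mod_cast hpq.2
      rw [inv_mul_cancel₀ hr', inv_mul_cancel₀ (mul_ne_zero (mul_ne_zero hp' hq') hr')]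
      simp
  · simp only [enorm_mul, mul_inv, enorm_phase, enorm_inv_intCast, enorm_two_complex]
    have hk1 : ker x * absE x ≤ 1 := by
      rw [ker, absE, ← ENNReal.ofReal_mul (by positivity)]
      exact (ENNReal.ofReal_le_ofReal (rk_mul_abs_le x)).trans_eq ENNReal.ofReal_one
    calc _ ≤ 2 * (ker x * ker3 n x k * (1 *
          (3 * absE x * m * ‖u k t‖ₑ * ‖u (n - x - k) t‖ₑ +
            ‖u x t‖ₑ * (3 * absE k * m) * ‖u (n - x - k) t‖ₑ +
            ‖u x t‖ₑ * ‖u k t‖ₑ * (3 * absE (n - x - k) * m)))) := by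
          unfold ker3
          gcongr
          refine (enorm_add_le _ _).trans (add_le_add ((enorm_add_le _ _).trans ?_) ?_)
          · simp only [enorm_mul]; gcongr
            · exact hm _
            · exact hm _
          · simp only [enorm_mul]; gcongr; exact hm _
      _ = 6 * m * (ker3 n x k * ((ker x * absE x) * (‖u k t‖ₑ * ‖u (n - x - k) t‖ₑ) +
          ker x * absE k * (‖u x t‖ₑ * ‖u (n - x - k) t‖ₑ) +
          ker x * absE (n - x - k) * (‖u x t‖ₑ * ‖u k t‖ₑ))) := by ring
      _ ≤ 6 * m * (ker3 n x k * (1 * (‖u k t‖ₑ * ‖u (n - x - k) t‖ₑ) +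
          ker x * absE k * (‖u x t‖ₑ * ‖u (n - x - k) t‖ₑ) +
          ker x * absE (n - x - k) * (‖u x t‖ₑ * ‖u k t‖ₑ))) := by gcongr
      _ = _ := by rw [one_mul]

theorem enorm_tsum_remainderTerm_le (n : ℤ) :
    ‖∑' p, remainderTerm u n t p‖ₑ ≤
      derivMajorant (nrm (fun j => ‖u j t‖ₑ) ^ 2) (fun j => ‖u j t‖ₑ) n := by
  refine enorm_tsum_le_tsum_enorm.trans ?_
  rw [ENNReal.tsum_prod', derivMajorant]
  refine (ENNReal.tsum_le_tsum fun x => ENNReal.tsum_le_tsum fun k =>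
    enorm_remainderTerm_le n x k enorm_rhs_le).trans (le_of_eq ?_)
  simp_rw [ENNReal.tsum_add, ENNReal.tsum_mul_left]

end Cancellation

section Evolution

variable {u : ℤ → ℝ → ℂ} {a b : ℝ}

theorem hasDerivAt_add_boundaryTerm (hu : IsReducedSolution (Icc a b) u) {B : ℝ} (hB : 0 ≤ B)
    (hr : ∀ t ∈ Icc a b, ∀ m : ℤ, ‖rhs u m t‖ ≤ B * |(m : ℝ)|) (n : ℤ) {t : ℝ}
    (ht : t ∈ Ioo a b) :
    HasDerivAt (fun s => u n s + boundaryTerm u n s) (∑' p, remainderTerm u n t p) t := by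
  obtain ⟨H, hH, hb⟩ := hu.bounded
  have hd : ∀ s ∈ Ioo a b, ∀ m, HasDerivAt (u m) (rhs u m s) s := fun s hs m =>
    (hu.hasDeriv s (Ioo_subset_Icc_self hs) m).hasDerivAt (Icc_mem_nhds hs.1 hs.2)
  have hb' : ∀ s ∈ Ioo a b, ∀ m, ‖u m s‖ ≤ H * rk m := fun s hs =>
    hb s (Ioo_subset_Icc_self hs)
  have hr' : ∀ s ∈ Ioo a b, ∀ m : ℤ, ‖rhs u m s‖ ≤ B * |(m : ℝ)| := fun s hs =>
    hr s (Ioo_subset_Icc_self hs)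
  have h0 : u 0 t = 0 := hu.zero_mode t (Ioo_subset_Icc_self ht)
  rw [← derivative_eq_tsum_remainderTerm hH hB h0 (hb' t ht) (hr' t ht) n]
  refine (hd t ht n).add (HasDerivAt.add ?_ (HasDerivAt.const_mul 2 ?_))
  · exact hasDerivAt_tsum_of_isPreconnected ((summable_rk_pair n).mul_left _) isOpen_Ioo
      isPreconnected_Ioo (fun x s hs => hasDerivAt_quadTerm n (hd s hs))
      (fun x s hs => norm_quadTermDeriv_le n hH hB (hb' s hs) (hr' s hs) x) ht
      (Summable.of_norm_bounded ((summable_rk_pair n).mul_left _)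
        (norm_quadTerm_le n hH (hb' t ht))) ht
  · exact hasDerivAt_tsum_of_isPreconnected ((summable_cubicDominant n).mul_left _) isOpen_Ioo
      isPreconnected_Ioo (fun x s hs => hasDerivAt_cubicTerm n (hd s hs))
      (fun x s hs => norm_cubicTermDeriv_le n hH hB (hb' s hs) (hr' s hs) x) ht
      (Summable.of_norm_bounded ((summable_cubicDominant n).mul_left _)
        (norm_cubicTerm_le n hH (hb' t ht))) ht

theorem continuousOn_add_boundaryTerm (hu : IsReducedSolution (Icc a b) u) (n : ℤ) :
    ContinuousOn (fun s => u n s + boundaryTerm u n s) (Icc a b) := by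
  obtain ⟨H, hH, hb⟩ := hu.bounded
  have hc : ∀ m, ContinuousOn (u m) (Icc a b) := fun m s hs =>
    (hu.hasDeriv s hs m).continuousWithinAt
  refine (hc n).add (ContinuousOn.add ?_ (continuousOn_const.mul ?_))
  · exact continuousOn_tsum (fun x => continuousOn_quadTerm n hc)
      ((summable_rk_pair n).mul_left _) (fun x s hs => norm_quadTerm_le n hH (hb s hs) x)
  · exact continuousOn_tsum (fun x => continuousOn_cubicTerm n hc)
      ((summable_cubicDominant n).mul_left _) (fun x s hs => norm_cubicTerm_le n hH (hb s hs) x)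

/-- A mean value inequality for sequences of functions, in a weighted `ℓ²` norm. The bound of the
derivative is assumed in its dual form. -/
theorem nrm_sub_le {F D : ℤ → ℝ → ℂ} (hab : a ≤ b) (hc : ∀ n, ContinuousOn (F n) (Icc a b))
    (hd : ∀ n, ∀ t ∈ Ioo a b, HasDerivAt (F n) (D n t) t) (w : ℤ → ℝ≥0∞) (hw : ∀ n, w n ≠ ⊤)
    {c : ℝ≥0∞} (hcfin : c ≠ ⊤)
    (hD : ∀ t ∈ Ioo a b, ∀ h : ℤ → ℝ≥0∞, ∑' n, h n * w n * ‖D n t‖ₑ ≤ c * nrm h) :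
    nrm (fun n => ‖F n b - F n a‖ₑ * w n) ≤ ENNReal.ofReal (b - a) * c := by
  refine nrm_le_of_dual fun h ⟨S, hS⟩ hfin => ?_
  have hnrm : nrm h ≠ ⊤ := by
    refine ENNReal.rpow_ne_top_of_nonneg (by norm_num) ?_
    rw [tsum_eq_sum (s := S) (fun n hn => by simp [hS n hn])]
    exact ENNReal.sum_ne_top.2 fun n _ => ENNReal.pow_ne_top (hfin n)
  -- The unimodular factors `z n` turn `‖F n b - F n a‖` into the increment of a real function.
  have hz : ∀ n, ∃ z : ℂ, ‖z‖ = 1 ∧ z * (F n b - F n a) = (‖F n b - F n a‖ : ℂ) := fun n => by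
    rcases eq_or_ne (F n b - F n a) 0 with h0 | h0
    · exact ⟨1, by simp, by simp [h0]⟩
    · have hn : (‖F n b - F n a‖ : ℂ) ≠ 0 := by exact_mod_cast norm_ne_zero_iff.2 h0
      refine ⟨(‖F n b - F n a‖ : ℂ) / (F n b - F n a), ?_, div_mul_cancel₀ _ h0⟩
      rw [norm_div, Complex.norm_real, norm_norm, div_self (norm_ne_zero_iff.2 h0)]
  choose z hz1 hz2 using hz
  set η : ℤ → ℝ := fun n => (h n * w n).toReal with hη
  have hη0 : ∀ n, 0 ≤ η n := fun n => ENNReal.toReal_nonneg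
  have hηE : ∀ n, ENNReal.ofReal (η n) = h n * w n := fun n =>
    ENNReal.ofReal_toReal (ENNReal.mul_ne_top (hfin n) (hw n))
  set φ : ℝ → ℝ := fun t => ∑ n ∈ S, η n * (z n * F n t).re with hφ
  have hφd : ∀ t ∈ Ioo a b, HasDerivAt φ (∑ n ∈ S, η n * (z n * D n t).re) t := fun t ht => by
    refine HasDerivAt.fun_sum fun n _ => HasDerivAt.const_mul _ ?_
    exact Complex.reCLM.hasFDerivAt.comp_hasDerivAt t ((hd n t ht).const_mul (z n))
  have hφc : ContinuousOn φ (Icc a b) := by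
    refine continuousOn_finsetSum _ fun n _ => continuousOn_const.mul ?_
    exact Complex.continuous_re.comp_continuousOn (continuousOn_const.mul (hc n))
  have hbound : ∀ t ∈ Ioo a b, ∑ n ∈ S, η n * (z n * D n t).re ≤ (c * nrm h).toReal := by
    intro t ht
    rw [← ENNReal.ofReal_le_iff_le_toReal (ENNReal.mul_ne_top hcfin hnrm)]
    refine le_trans ?_ (hD t ht h)
    refine le_trans ?_ (ENNReal.sum_le_tsum S)
    refine (ENNReal.ofReal_le_ofReal (Finset.sum_le_sum (g := fun n => η n * ‖D n t‖)
      fun n _ => ?_)).trans ?_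
    · refine mul_le_mul_of_nonneg_left ((Complex.re_le_norm _).trans ?_) (hη0 n)
      rw [norm_mul, hz1, one_mul]
    · rw [ENNReal.ofReal_sum_of_nonneg fun n _ => mul_nonneg (hη0 n) (norm_nonneg _)]
      refine Finset.sum_le_sum fun n _ => ?_
      rw [ENNReal.ofReal_mul (hη0 n), hηE, ofReal_norm]
  have hmv : φ b - φ a ≤ (c * nrm h).toReal * (b - a) := by
    refine (convex_Icc a b).image_sub_le_mul_sub_of_deriv_le hφc ?_ ?_ a (left_mem_Icc.2 hab) b
      (right_mem_Icc.2 hab) hab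
    · rw [interior_Icc]
      exact fun t ht => (hφd t ht).differentiableAt.differentiableWithinAt
    · rw [interior_Icc]
      exact fun t ht => (hφd t ht).deriv.trans_le (hbound t ht)
  have hφab : φ b - φ a = ∑ n ∈ S, η n * ‖F n b - F n a‖ := by
    rw [hφ, ← Finset.sum_sub_distrib]
    refine Finset.sum_congr rfl fun n _ => ?_
    rw [← mul_sub, ← Complex.sub_re, ← mul_sub, hz2, Complex.ofReal_re]
  calc ∑' n, h n * (‖F n b - F n a‖ₑ * w n)
      = ∑ n ∈ S, h n * (‖F n b - F n a‖ₑ * w n) :=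
        tsum_eq_sum (fun n hn => by simp [hS n hn])
    _ = ENNReal.ofReal (φ b - φ a) := by
        rw [hφab, ENNReal.ofReal_sum_of_nonneg fun n _ => mul_nonneg (hη0 n) (norm_nonneg _)]
        refine Finset.sum_congr rfl fun n _ => ?_
        rw [ENNReal.ofReal_mul (hη0 n), hηE, ofReal_norm]; ring
    _ ≤ ENNReal.ofReal ((c * nrm h).toReal * (b - a)) := ENNReal.ofReal_le_ofReal hmv
    _ = ENNReal.ofReal (b - a) * c * nrm h := by
        rw [ENNReal.ofReal_mul ENNReal.toReal_nonneg,
          ENNReal.ofReal_toReal (ENNReal.mul_ne_top hcfin hnrm)]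
        ring

end Evolution

/-! ### Increments of solutions -/

theorem nrmHalf_add_le (f g : ℤ → ℝ≥0∞) :
    nrmHalf (fun i => f i + g i) ≤ nrmHalf f + nrmHalf g := by
  unfold nrmHalf; simp_rw [add_mul]; exact nrm_add_le _ _

theorem nrmHalf_mono {f g : ℤ → ℝ≥0∞} (h : ∀ i, f i ≤ g i) : nrmHalf f ≤ nrmHalf g :=
  nrm_mono fun i => by gcongr; exact h i

/-- The increment of a solution over a time interval, in `ℓ²` and in `Ḣ^{-1/2}`, in terms of
bounds on the interval for `ℓ²` (`M`), `Ḣ^{-1/2}` (`X`) and `∑ |u_n| / |n|` (`Y`). -/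
theorem exists_increment_bound : ∃ c : ℝ, 0 ≤ c ∧ ∀ (a b : ℝ) (u : ℤ → ℝ → ℂ) (X M Y : ℝ), a ≤ b →
    0 ≤ X → 0 ≤ M → 0 ≤ Y → IsReducedSolution (Icc a b) u →
    (∀ t ∈ Icc a b, nrmHalf (fun n => ‖u n t‖ₑ) ≤ ENNReal.ofReal X) →
    (∀ t ∈ Icc a b, nrm (fun n => ‖u n t‖ₑ) ≤ ENNReal.ofReal M) →
    (∀ t ∈ Icc a b, sumKer (fun n => ‖u n t‖ₑ) ≤ ENNReal.ofReal Y) →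
    nrm (fun n => ‖u n b - u n a‖ₑ) ≤ ENNReal.ofReal
      (c * (2 * (X * Y + X ^ 3) + (b - a) * (X ^ 2 * M + M ^ 2 * (X ^ 2 + X * M)))) ∧
    nrmHalf (fun n => ‖u n b - u n a‖ₑ) ≤ ENNReal.ofReal
      (c * (2 * (X ^ 2 + X ^ 3) + (b - a) * (X ^ 3 + M ^ 2 * (X ^ 2 + X * Y)))) := by
  obtain ⟨c₁, hc₁, H₁⟩ := exists_boundaryMajorant_bound
  obtain ⟨c₂, hc₂, H₂⟩ := exists_derivMajorant_bound
  refine ⟨(c₁ + c₂).toReal, ENNReal.toReal_nonneg, fun a b u X M Y hab hX hM hY hu bX bM bY => ?_⟩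
  set c := c₁ + c₂ with hcdef
  have hcfin : c ≠ ⊤ := ENNReal.add_ne_top.2 ⟨hc₁, hc₂⟩
  have hba : 0 ≤ b - a := sub_nonneg.2 hab
  have ha := left_mem_Icc.2 hab
  have hb := right_mem_Icc.2 hab
  set X' := ENNReal.ofReal X with hX'
  set M' := ENNReal.ofReal M with hM'
  set Y' := ENNReal.ofReal Y with hY'
  set T' := ENNReal.ofReal (b - a) with hT'
  have hXf : X' ≠ ⊤ := ENNReal.ofReal_ne_top
  have hMf : M' ≠ ⊤ := ENNReal.ofReal_ne_top
  have hYf : Y' ≠ ⊤ := ENNReal.ofReal_ne_top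
  have h0 : ∀ t ∈ Icc a b, ‖u 0 t‖ₑ = 0 := fun t ht => by rw [hu.zero_mode t ht, enorm_zero]
  have hr : ∀ t ∈ Icc a b, ∀ m : ℤ, ‖rhs u m t‖ ≤ (3 * M ^ 2) * |(m : ℝ)| := fun t ht m => by
    have h1 : ‖rhs u m t‖ₑ ≤ ENNReal.ofReal ((3 * M ^ 2) * |(m : ℝ)|) := by
      refine (enorm_rhs_le m).trans ?_
      rw [ENNReal.ofReal_mul (by positivity), ENNReal.ofReal_mul (by positivity),
        ENNReal.ofReal_pow hM, ENNReal.ofReal_ofNat]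
      calc _ ≤ 3 * absE m * M' ^ 2 := by gcongr; exact bM t ht
        _ = _ := by rw [absE]; ring
    rw [← ofReal_norm] at h1
    exact (ENNReal.ofReal_le_ofReal_iff (by positivity)).1 h1
  set F : ℤ → ℝ → ℂ := fun n s => u n s + boundaryTerm u n s with hF
  have hsub : ∀ n, ‖u n b - u n a‖ₑ ≤
      ‖F n b - F n a‖ₑ + (‖boundaryTerm u n b‖ₑ + ‖boundaryTerm u n a‖ₑ) := fun n => by
    have : u n b - u n a = (F n b - F n a) + (boundaryTerm u n a - boundaryTerm u n b) := by
      simp only [hF]; ring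
    rw [this]
    refine (enorm_add_le _ _).trans ?_
    gcongr
    rw [add_comm]
    exact enorm_sub_le
  have hD : ∀ t ∈ Icc a b, ∀ n, ‖∑' p, remainderTerm u n t p‖ₑ ≤
      derivMajorant (nrm (fun j => ‖u j t‖ₑ) ^ 2) (fun j => ‖u j t‖ₑ) n := fun t ht n =>
    enorm_tsum_remainderTerm_le n
  have hFd := fun n (t : ℝ) (ht : t ∈ Ioo a b) =>
    hasDerivAt_add_boundaryTerm hu (by positivity) hr n ht
  have hFc := fun n => continuousOn_add_boundaryTerm hu n
  constructor
  · have inc := nrm_sub_le hab hFc hFd (fun _ => 1) (fun _ => ENNReal.one_ne_top)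
      (c := c * (X' ^ 2 * M' + M' ^ 2 * (X' ^ 2 + X' * M'))) (by finiteness) (fun t ht h => by
        have ht' := Ioo_subset_Icc_self ht
        have := (H₂ (nrm (fun j => ‖u j t‖ₑ) ^ 2) (fun j => ‖u j t‖ₑ) h (h0 t ht')).1
        calc _ ≤ ∑' n, h n * derivMajorant (nrm (fun j => ‖u j t‖ₑ) ^ 2) (fun j => ‖u j t‖ₑ) n := by
              refine ENNReal.tsum_le_tsum fun n => ?_
              rw [mul_one]; exact mul_le_mul_right (hD t ht' n) _
          _ ≤ _ := this
          _ ≤ c * nrm h * (X' ^ 2 * M' + M' ^ 2 * (X' ^ 2 + X' * M')) := by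
              have h1 := bX t ht'
              have h2 := bM t ht'
              gcongr
              exact le_add_self
          _ = _ := by ring)
    have bdry : ∀ t ∈ Icc a b, nrm (fun n => ‖boundaryTerm u n t‖ₑ) ≤
        c * (X' * Y' + X' ^ 3) := fun t ht => by
      refine nrm_le_of_dual fun h _ _ => ?_
      calc _ ≤ ∑' n, h n * boundaryMajorant (fun j => ‖u j t‖ₑ) n := by
            gcongr with n; exact enorm_boundaryTerm_le n
        _ ≤ _ := (H₁ _ h (h0 t ht)).1
        _ ≤ c * nrm h * (X' * Y' + X' ^ 3) := by
            have h1 := bX t ht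
            have h2 := bY t ht
            gcongr
            exact le_self_add
        _ = _ := by ring
    calc _ ≤ nrm (fun n => ‖F n b - F n a‖ₑ + (‖boundaryTerm u n b‖ₑ + ‖boundaryTerm u n a‖ₑ)) :=
          nrm_mono hsub
      _ ≤ nrm (fun n => ‖F n b - F n a‖ₑ) + (nrm (fun n => ‖boundaryTerm u n b‖ₑ) +
          nrm (fun n => ‖boundaryTerm u n a‖ₑ)) :=
          (nrm_add_le _ _).trans (by gcongr; exact nrm_add_le _ _)
      _ ≤ T' * (c * (X' ^ 2 * M' + M' ^ 2 * (X' ^ 2 + X' * M'))) +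
          (c * (X' * Y' + X' ^ 3) + c * (X' * Y' + X' ^ 3)) := by
          gcongr ?_ + (?_ + ?_)
          · simpa using inc
          · exact bdry b hb
          · exact bdry a ha
      _ = c * (2 * (X' * Y' + X' ^ 3) + T' * (X' ^ 2 * M' + M' ^ 2 * (X' ^ 2 + X' * M'))) := by
          ring
      _ = _ := by
          rw [hX', hY', hM', hT', ENNReal.ofReal_mul ENNReal.toReal_nonneg,
            ENNReal.ofReal_toReal hcfin, ENNReal.ofReal_add (by positivity) (by positivity),
            ENNReal.ofReal_mul hba, ENNReal.ofReal_mul (by norm_num),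
            ENNReal.ofReal_add (by positivity) (by positivity),
            ENNReal.ofReal_add (by positivity) (by positivity), ENNReal.ofReal_mul hX,
            ENNReal.ofReal_mul (p := X ^ 2) (by positivity),
            ENNReal.ofReal_mul (p := M ^ 2) (by positivity),
            ENNReal.ofReal_add (by positivity) (by positivity), ENNReal.ofReal_mul hX,
            ENNReal.ofReal_pow hX, ENNReal.ofReal_pow hX, ENNReal.ofReal_pow hM,
            ENNReal.ofReal_ofNat]
  · have inc := nrm_sub_le hab hFc hFd rho (fun n => ENNReal.ofReal_ne_top)
      (c := c * (X' ^ 3 + M' ^ 2 * (X' ^ 2 + X' * Y'))) (by finiteness) (fun t ht h => by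
        have ht' := Ioo_subset_Icc_self ht
        have := (H₂ (nrm (fun j => ‖u j t‖ₑ) ^ 2) (fun j => ‖u j t‖ₑ) h (h0 t ht')).2
        calc _ ≤ ∑' n, h n * rho n *
              derivMajorant (nrm (fun j => ‖u j t‖ₑ) ^ 2) (fun j => ‖u j t‖ₑ) n := by
              gcongr with n; exact hD t ht' n
          _ ≤ _ := this
          _ ≤ c * nrm h * (X' ^ 3 + M' ^ 2 * (X' ^ 2 + X' * Y')) := by
              have h1 := bX t ht'
              have h2 := bM t ht'
              have h3 := bY t ht'
              gcongr
              exact le_add_self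
          _ = _ := by ring)
    have bdry : ∀ t ∈ Icc a b, nrmHalf (fun n => ‖boundaryTerm u n t‖ₑ) ≤
        c * (X' ^ 2 + X' ^ 3) := fun t ht => by
      refine nrm_le_of_dual fun h _ _ => ?_
      calc _ ≤ ∑' n, h n * rho n * boundaryMajorant (fun j => ‖u j t‖ₑ) n := by
            refine ENNReal.tsum_le_tsum fun n => ?_
            rw [mul_comm (‖_‖ₑ), ← mul_assoc]
            gcongr; exact enorm_boundaryTerm_le n
        _ ≤ _ := (H₁ _ h (h0 t ht)).2
        _ ≤ c * nrm h * (X' ^ 2 + X' ^ 3) := by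
            have h1 := bX t ht
            gcongr
            exact le_self_add
        _ = _ := by ring
    calc _ ≤ nrmHalf (fun n => ‖F n b - F n a‖ₑ +
            (‖boundaryTerm u n b‖ₑ + ‖boundaryTerm u n a‖ₑ)) := nrmHalf_mono hsub
      _ ≤ nrmHalf (fun n => ‖F n b - F n a‖ₑ) + (nrmHalf (fun n => ‖boundaryTerm u n b‖ₑ) +
          nrmHalf (fun n => ‖boundaryTerm u n a‖ₑ)) :=
          (nrmHalf_add_le _ _).trans (by gcongr; exact nrmHalf_add_le _ _)
      _ ≤ T' * (c * (X' ^ 3 + M' ^ 2 * (X' ^ 2 + X' * Y'))) +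
          (c * (X' ^ 2 + X' ^ 3) + c * (X' ^ 2 + X' ^ 3)) := by
          gcongr ?_ + (?_ + ?_)
          · exact inc
          · exact bdry b hb
          · exact bdry a ha
      _ = c * (2 * (X' ^ 2 + X' ^ 3) + T' * (X' ^ 3 + M' ^ 2 * (X' ^ 2 + X' * Y'))) := by
          ring
      _ = _ := by
          rw [hX', hY', hM', hT', ENNReal.ofReal_mul ENNReal.toReal_nonneg,
            ENNReal.ofReal_toReal hcfin, ENNReal.ofReal_add (by positivity) (by positivity),
            ENNReal.ofReal_mul hba, ENNReal.ofReal_mul (by norm_num),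
            ENNReal.ofReal_add (by positivity) (by positivity),
            ENNReal.ofReal_add (by positivity) (by positivity),
            ENNReal.ofReal_mul (p := M ^ 2) (by positivity),
            ENNReal.ofReal_add (by positivity) (by positivity), ENNReal.ofReal_mul hX,
            ENNReal.ofReal_pow hX, ENNReal.ofReal_pow hX, ENNReal.ofReal_pow hM,
            ENNReal.ofReal_ofNat]

/-- The `ℓ¹` type sum `∑ |a_n| / |n|` is controlled by the `Ḣ^{-1/2}` and `ℓ²` norms with an
arbitrarily small loss `ε^{-η}`. Write `|j|⁻¹ = |j|^{-1/2+η} |j|^{-1/2-η}`; the second factor is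
square summable, and the square of the first is at most `ε^{-2η} (|j|⁻¹ + ε)`. -/
theorem exists_sumKer_bound {η : ℝ} (hη : 0 < η) (hη' : η ≤ 1 / 2) :
    ∃ D : ℝ, 0 ≤ D ∧ ∀ ε : ℝ, 0 < ε → ∀ (a : ℤ → ℝ≥0∞) (M : ℝ), 0 ≤ M →
      nrmHalf a ≤ ENNReal.ofReal (M * ε ^ (1 / 2 : ℝ)) → nrm a ≤ ENNReal.ofReal M →
      sumKer a ≤ ENNReal.ofReal (D * M * (ε ^ (1 / 2 : ℝ) * ε ^ (-η))) := by
  set S : ℝ≥0∞ := ∑' j, ker j ^ (1 + 2 * η) with hS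
  have hSfin : S ≠ ⊤ := tsum_ker_rpow (by linarith)
  refine ⟨√(2 * S.toReal), by positivity, fun ε hε a M hM hX hMa => ?_⟩
  set p : ℤ → ℝ≥0∞ := fun j => ker j ^ ((1 + 2 * η) / 2) with hp
  set q : ℤ → ℝ≥0∞ := fun j => ker j ^ ((1 - 2 * η) / 2) with hq
  have hpq : ∀ j, ker j = q j * p j := fun j => by
    -- The assumption `η ≤ 1/2` keeps both exponents nonnegative.
    rw [hp, hq, ← ENNReal.rpow_add_of_nonneg _ _ (by linarith) (by linarith)]
    rw [show (1 - 2 * η) / 2 + (1 + 2 * η) / 2 = 1 by ring, ENNReal.rpow_one]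
  have hp2 : nrm p ^ 2 = S := by
    rw [nrm_sq]
    refine tsum_congr fun j => ?_
    rw [hp, ← ENNReal.rpow_natCast, ← ENNReal.rpow_mul]
    congr 1; push_cast; ring
  have hq2 : ∀ j, j ≠ 0 → q j ^ 2 ≤ ENNReal.ofReal (ε ^ (-(2 * η))) *
      (ker j + ENNReal.ofReal ε) := fun j hj => by
    have hj1 := one_le_abs_cast hj
    have hj0 : 0 < |(j : ℝ)|⁻¹ := by positivity
    have e : q j ^ 2 = ENNReal.ofReal (|(j : ℝ)|⁻¹ ^ (1 - 2 * η)) := by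
      rw [hq, ← ENNReal.rpow_natCast, ← ENNReal.rpow_mul, ker,
        ENNReal.ofReal_rpow_of_nonneg hj0.le (by push_cast; linarith)]
      congr 2; push_cast; ring
    rw [e, ker, ← ENNReal.ofReal_add hj0.le hε.le, ← ENNReal.ofReal_mul (by positivity)]
    apply ENNReal.ofReal_le_ofReal
    rcases le_total (|(j : ℝ)|⁻¹) ε with h | h
    · calc _ ≤ ε ^ (1 - 2 * η) := by gcongr; linarith
        _ = ε ^ (-(2 * η)) * ε := by
          rw [← Real.rpow_add_one hε.ne']; congr 1; ring
        _ ≤ _ := by gcongr; linarith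
    · calc _ = |(j : ℝ)|⁻¹ ^ (-(2 * η)) * |(j : ℝ)|⁻¹ := by
            rw [← Real.rpow_add_one hj0.ne']; congr 1; ring
        _ ≤ ε ^ (-(2 * η)) * |(j : ℝ)|⁻¹ := by
            gcongr ?_ * _
            exact Real.rpow_le_rpow_of_nonpos hε h (by linarith)
        _ ≤ _ := by gcongr; linarith
  have hsum : sumKer a ≤ nrm (fun j => if j = 0 then 0 else a j * q j) * nrm p := by
    refine le_trans (ENNReal.tsum_le_tsum fun j => ?_) (tsum_mul_le_nrm _ _)
    rcases eq_or_ne j 0 with rfl | hj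
    · simp
    · rw [if_neg hj, mul_assoc, ← hpq]
  rw [← sq_le_sq_iff_le]
  calc sumKer a ^ 2 ≤ nrm (fun j => if j = 0 then 0 else a j * q j) ^ 2 * S := by
        rw [← hp2, ← mul_pow]; gcongr
    _ ≤ (∑' j, ENNReal.ofReal (ε ^ (-(2 * η))) *
          ((a j * rho j) ^ 2 + ENNReal.ofReal ε * a j ^ 2)) * S := by
        rw [nrm_sq]
        gcongr with j
        rcases eq_or_ne j 0 with rfl | hj
        · simp
        · rw [if_neg hj, mul_pow, mul_pow, rho_sq]
          calc _ ≤ a j ^ 2 * (ENNReal.ofReal (ε ^ (-(2 * η))) *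
                (ker j + ENNReal.ofReal ε)) := by gcongr; exact hq2 j hj
            _ = _ := by ring
    _ = ENNReal.ofReal (ε ^ (-(2 * η))) * (nrmHalf a ^ 2 + ENNReal.ofReal ε * nrm a ^ 2) * S := by
        rw [ENNReal.tsum_mul_left, ENNReal.tsum_add, ENNReal.tsum_mul_left, nrmHalf, nrm_sq, nrm_sq]
    _ ≤ ENNReal.ofReal (ε ^ (-(2 * η))) * (ENNReal.ofReal (M * ε ^ (1 / 2 : ℝ)) ^ 2 +
          ENNReal.ofReal ε * ENNReal.ofReal M ^ 2) * S := by gcongr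
    _ = ENNReal.ofReal (ε ^ (-(2 * η)) * ((M * ε ^ (1 / 2 : ℝ)) ^ 2 + ε * M ^ 2) * S.toReal) := by
        rw [ENNReal.ofReal_mul (q := S.toReal) (by positivity),
          ENNReal.ofReal_mul (p := ε ^ (-(2 * η))) (by positivity),
          ENNReal.ofReal_add (by positivity) (by positivity), ENNReal.ofReal_mul hε.le,
          ENNReal.ofReal_pow (by positivity), ENNReal.ofReal_pow hM, ENNReal.ofReal_toReal hSfin]
    _ = _ := by
        rw [← ENNReal.ofReal_pow (by positivity)]
        congr 1
        have e1 : (ε ^ (1 / 2 : ℝ)) ^ 2 = ε := by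
          rw [← Real.rpow_natCast, ← Real.rpow_mul hε.le]; norm_num
        have e2 : (ε ^ (-η)) ^ 2 = ε ^ (-(2 * η)) := by
          rw [← Real.rpow_natCast, ← Real.rpow_mul hε.le]; congr 1; push_cast; ring
        rw [mul_pow, mul_pow, mul_pow, mul_pow, e1, e2, Real.sq_sqrt (by positivity)]
        ring

/-- Continuity method: a continuous function that can only be at most `3/2` as long as it was at
most `2` before stays at most `2`. -/
theorem le_two_of_bootstrap {f : ℝ → ℝ} (hf : ContinuousOn f (Icc 0 1))
    (h0 : f 0 ≤ 3 / 2)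
    (h : ∀ τ ∈ Icc (0 : ℝ) 1, (∀ σ ∈ Icc 0 τ, f σ ≤ 2) → f τ ≤ 3 / 2) :
    ∀ τ ∈ Icc (0 : ℝ) 1, f τ ≤ 2 := by
  by_contra! hcon
  obtain ⟨τ, hτ, hτ2⟩ := hcon
  set S : Set ℝ := {σ | σ ∈ Icc (0 : ℝ) 1 ∧ 2 ≤ f σ} with hS
  have hSc : IsCompact S := by
    have : S = Icc (0 : ℝ) 1 ∩ f ⁻¹' Ici 2 := rfl
    rw [this]
    exact isCompact_Icc.of_isClosed_subset (hf.preimage_isClosed_of_isClosed isClosed_Icc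
      isClosed_Ici) inter_subset_left
  obtain ⟨σ, ⟨hσ, hσ2⟩, hmin⟩ := hSc.exists_isLeast ⟨τ, hτ, hτ2.le⟩
  have hlt : ∀ r ∈ Icc 0 σ, f r ≤ 2 := by
    intro r hr
    by_contra! hr2
    obtain ⟨r', hr', hr'2⟩ := intermediate_value_Icc hr.1
      (hf.mono (Icc_subset_Icc_right (hr.2.trans hσ.2)))
      (show (2 : ℝ) ∈ Icc (f 0) (f r) from ⟨by linarith, hr2.le⟩)
    have h1 : σ ≤ r' := hmin ⟨⟨hr'.1, hr'.2.trans (hr.2.trans hσ.2)⟩, hr'2.ge⟩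
    have h2 : r' = r := le_antisymm hr'.2 (hr.2.trans h1)
    rw [h2] at hr'2; linarith
  linarith [h σ hσ hlt]

/-! ### The bootstrap argument -/

theorem le_add_nrm_sub {u v : ℤ → ℂ} :
    nrm (fun n => ‖v n‖ₑ) ≤ nrm (fun n => ‖u n‖ₑ) + nrm (fun n => ‖v n - u n‖ₑ) := by
  refine (nrm_mono fun n => ?_).trans (nrm_add_le _ _)
  calc ‖v n‖ₑ = ‖u n + (v n - u n)‖ₑ := by rw [add_sub_cancel]
    _ ≤ _ := enorm_add_le _ _

theorem le_add_nrmHalf_sub {u v : ℤ → ℂ} :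
    nrmHalf (fun n => ‖v n‖ₑ) ≤ nrmHalf (fun n => ‖u n‖ₑ) + nrmHalf (fun n => ‖v n - u n‖ₑ) := by
  refine (nrmHalf_mono fun n => ?_).trans (nrmHalf_add_le _ _)
  calc ‖v n‖ₑ = ‖u n + (v n - u n)‖ₑ := by rw [add_sub_cancel]
    _ ≤ _ := enorm_add_le _ _

/-- If the `ℓ²` and `Ḣ^{-1/2}` norms stay below twice their initial bounds, then the increment is
of size `(1 + |t|) ε^{1/2}` in `ℓ²`, and small in `Ḣ^{-1/2}`. The constant `A` must not depend on
`δ` and `K`: the `ℓ²` bound therefore uses `sumKer_le`, and only the `Ḣ^{-1/2}` bound uses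
`exists_sumKer_bound`, whose constant depends on `δ` through `η`. -/
theorem exists_bootstrap_step {C₁ : ℝ} (hC₁ : 0 < C₁) : ∃ A : ℝ, 0 < A ∧ ∀ δ : ℝ, 0 < δ →
    ∀ K : ℝ, 0 < K → ∃ ε₀ : ℝ, 0 < ε₀ ∧ ∀ ε : ℝ, 0 < ε → ε ≤ ε₀ →
    ∀ (a b : ℝ) (u : ℤ → ℝ → ℂ), a ≤ b → IsReducedSolution (Icc a b) u →
    b - a ≤ K * ε ^ (-1 / 2 + δ) →
    (∀ t ∈ Icc a b, nrmHalf (fun n => ‖u n t‖ₑ) ≤ ENNReal.ofReal (2 * C₁ * ε ^ (1 / 2 : ℝ))) →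
    (∀ t ∈ Icc a b, nrm (fun n => ‖u n t‖ₑ) ≤ ENNReal.ofReal (2 * C₁)) →
    nrm (fun n => ‖u n b - u n a‖ₑ) ≤ ENNReal.ofReal (A * (1 + (b - a)) * ε ^ (1 / 2 : ℝ)) ∧
    nrm (fun n => ‖u n b - u n a‖ₑ) ≤ ENNReal.ofReal (C₁ / 2) ∧
    nrmHalf (fun n => ‖u n b - u n a‖ₑ) ≤ ENNReal.ofReal (C₁ / 2 * ε ^ (1 / 2 : ℝ)) := by
  obtain ⟨c, hc, H⟩ := exists_increment_bound
  set κ : ℝ := (nrm ker).toReal with hκ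
  have hκ0 : 0 ≤ κ := ENNReal.toReal_nonneg
  set M : ℝ := 2 * C₁ with hM
  have hM0 : 0 < M := by positivity
  set A₀ : ℝ := c * (2 * (κ * M ^ 2 + M ^ 3) + (M ^ 3 + 2 * M ^ 4)) with hA₀
  have hA₀0 : 0 ≤ A₀ := by positivity
  refine ⟨A₀ + 1, by positivity, fun δ hδ K hK => ?_⟩
  -- Any `η` below `δ` works; `η ≤ 1/2` is required by `exists_sumKer_bound`.
  set η : ℝ := min δ 1 / 2 with hη
  have hη0 : 0 < η := by positivity
  have hη1 : η ≤ 1 / 2 := by rw [hη]; linarith [min_le_right δ 1]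
  have hηδ : 0 < δ - η := by
    have := min_le_left δ 1
    rw [hη]; linarith
  obtain ⟨D, hD, HD⟩ := exists_sumKer_bound hη0 hη1
  set A₁ : ℝ := c * (2 * (M ^ 2 + M ^ 3)) with hA₁
  set A₂ : ℝ := c * (M ^ 3 + M ^ 4 + D * M ^ 4) with hA₂
  have hA₁0 : 0 ≤ A₁ := by positivity
  have hA₂0 : 0 ≤ A₂ := by positivity
  have lim : ∀ s : ℝ, 0 < s → Tendsto (fun ε : ℝ => ε ^ s) (𝓝[>] 0) (𝓝 0) := fun s hs => by
    have := (Real.continuousAt_rpow_const 0 s (Or.inr hs.le)).tendsto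
    rw [Real.zero_rpow hs.ne'] at this
    exact this.mono_left nhdsWithin_le_nhds
  have lim1 : Tendsto (fun ε : ℝ => A₀ * (ε ^ (1 / 2 : ℝ) + K * ε ^ δ)) (𝓝[>] 0) (𝓝 0) := by
    simpa using ((lim _ (by norm_num)).add ((lim δ hδ).const_mul K)).const_mul A₀
  have lim2 : Tendsto (fun ε : ℝ => A₁ * ε ^ (1 / 2 : ℝ) + A₂ * (K * ε ^ (δ - η)))
      (𝓝[>] 0) (𝓝 0) := by
    simpa using ((lim (1 / 2) (by norm_num)).const_mul A₁).add
      (((lim _ hηδ).const_mul K).const_mul A₂)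
  have ev : ∀ᶠ ε : ℝ in 𝓝[>] 0, A₀ * (ε ^ (1 / 2 : ℝ) + K * ε ^ δ) < C₁ / 2 ∧
      A₁ * ε ^ (1 / 2 : ℝ) + A₂ * (K * ε ^ (δ - η)) < C₁ / 2 ∧ ε ≤ 1 :=
    (lim1.eventually_lt_const (by positivity)).and ((lim2.eventually_lt_const (by positivity)).and
      (mem_of_superset (Ioc_mem_nhdsGT one_pos) fun x hx => hx.2))
  obtain ⟨ε₀, hε₀, hsub⟩ := mem_nhdsGT_iff_exists_Ioc_subset.1 ev
  refine ⟨ε₀, hε₀, fun ε hε hεε₀ a b u hab hu hT bX bM => ?_⟩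
  obtain ⟨s1, s2, hε1⟩ := hsub ⟨hε, hεε₀⟩
  set e : ℝ := ε ^ (1 / 2 : ℝ) with he
  have he0 : 0 < e := by positivity
  have he1 : e ≤ 1 := Real.rpow_le_one hε.le hε1 (by norm_num)
  set T : ℝ := b - a with hTdef
  have hT0 : 0 ≤ T := sub_nonneg.2 hab
  have hg1 : 1 ≤ ε ^ (-η) := Real.one_le_rpow_of_pos_of_le_one_of_nonpos hε hε1 (by linarith)
  have hTe : T * e ≤ K * ε ^ δ := by
    calc T * e ≤ K * ε ^ (-1 / 2 + δ) * e := by gcongr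
      _ = K * ε ^ δ := by
        rw [he, mul_assoc, ← Real.rpow_add hε]; congr 2; ring
  have hTe' : T * e * ε ^ (-η) ≤ K * ε ^ (δ - η) := by
    calc _ ≤ K * ε ^ δ * ε ^ (-η) := by gcongr
      _ = _ := by rw [mul_assoc, ← Real.rpow_add hε, sub_eq_add_neg]
  have h1 := (H a b u (M * e) M (κ * M) hab (by positivity) hM0.le (by positivity) hu bX bM
    (fun t ht => by
      refine (sumKer_le _).trans ?_
      rw [ENNReal.ofReal_mul hκ0, hκ, ENNReal.ofReal_toReal nrm_ker_ne_top]
      gcongr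
      exact bM t ht)).1
  have h2 := (H a b u (M * e) M (D * M * (e * ε ^ (-η))) hab (by positivity) hM0.le
    (by positivity) hu bX bM (fun t ht => HD ε hε _ M hM0.le (bX t ht) (bM t ht))).2
  have e2 : e ^ 2 ≤ e := by nlinarith
  have e3 : e ^ 3 ≤ e ^ 2 := pow_le_pow_of_le_one he0.le he1 (by norm_num)
  have b1 : c * (2 * (M * e * (κ * M) + (M * e) ^ 3) + T * ((M * e) ^ 2 * M + M ^ 2 *
      ((M * e) ^ 2 + M * e * M))) ≤ A₀ * (1 + T) * e := by
    calc _ = c * (2 * (κ * M ^ 2 * e + M ^ 3 * e ^ 3) +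
          T * (M ^ 3 * e ^ 2 + M ^ 4 * e ^ 2 + M ^ 4 * e)) := by ring
      _ ≤ c * (2 * (κ * M ^ 2 * e + M ^ 3 * e) + T * (M ^ 3 * e + M ^ 4 * e + M ^ 4 * e)) := by
          gcongr; exact e3.trans e2
      _ = c * (2 * (κ * M ^ 2 + M ^ 3)) * e + c * (M ^ 3 + 2 * M ^ 4) * (T * e) := by ring
      _ ≤ A₀ * e + A₀ * (T * e) := by
          have : 0 ≤ c * (2 * (κ * M ^ 2 + M ^ 3)) := by positivity
          have : 0 ≤ c * (M ^ 3 + 2 * M ^ 4) := by positivity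
          have : A₀ = c * (2 * (κ * M ^ 2 + M ^ 3)) + c * (M ^ 3 + 2 * M ^ 4) := by
            rw [hA₀]; ring
          gcongr <;> linarith
      _ = _ := by ring
  have b2 : c * (2 * ((M * e) ^ 2 + (M * e) ^ 3) + T * ((M * e) ^ 3 + M ^ 2 *
      ((M * e) ^ 2 + M * e * (D * M * (e * ε ^ (-η)))))) ≤ C₁ / 2 * e := by
    calc _ = c * (2 * (M ^ 2 * e ^ 2 + M ^ 3 * e ^ 3)) +
          c * (T * (M ^ 3 * e ^ 3 * 1 + M ^ 4 * e ^ 2 * 1 + D * M ^ 4 * e ^ 2 * ε ^ (-η))) := by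
          ring
      _ ≤ c * (2 * (M ^ 2 * e ^ 2 + M ^ 3 * e ^ 2)) +
          c * (T * (M ^ 3 * e ^ 2 * ε ^ (-η) + M ^ 4 * e ^ 2 * ε ^ (-η) +
            D * M ^ 4 * e ^ 2 * ε ^ (-η))) := by gcongr
      _ = (A₁ * e + A₂ * (T * e * ε ^ (-η))) * e := by rw [hA₁, hA₂]; ring
      _ ≤ (A₁ * e + A₂ * (K * ε ^ (δ - η))) * e := by gcongr
      _ ≤ _ := by gcongr
  refine ⟨h1.trans (ENNReal.ofReal_le_ofReal (b1.trans ?_)),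
    h1.trans (ENNReal.ofReal_le_ofReal (b1.trans ?_)), h2.trans (ENNReal.ofReal_le_ofReal b2)⟩
  · gcongr; linarith
  · calc A₀ * (1 + T) * e = A₀ * (e + T * e) := by ring
      _ ≤ A₀ * (e + K * ε ^ δ) := by gcongr
      _ ≤ _ := s1.le

/-- Near-linear evolution in the interaction representation: the bootstrap assumption of
`exists_bootstrap_step` is removed by continuity in time. -/
theorem exists_reduced_bound {C₁ : ℝ} (hC₁ : 0 < C₁) : ∃ A : ℝ, 0 < A ∧ ∀ δ : ℝ, 0 < δ →
    ∀ K : ℝ, 0 < K → ∃ ε₀ : ℝ, 0 < ε₀ ∧ ∀ ε : ℝ, 0 < ε → ε ≤ ε₀ →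
    ∀ (I : Set ℝ) (u : ℤ → ℝ → ℂ), I.OrdConnected → (0 : ℝ) ∈ I →
    (∀ a b, Icc a b ⊆ I → IsReducedSolution (Icc a b) u) →
    (∀ t ∈ I, nrm (fun n => ‖u n t‖ₑ) ≠ ⊤) →
    ContinuousOn (fun t => (nrm (fun n => ‖u n t‖ₑ)).toReal) I →
    ContinuousOn (fun t => (nrmHalf (fun n => ‖u n t‖ₑ)).toReal) I →
    nrmHalf (fun n => ‖u n 0‖ₑ) ≤ ENNReal.ofReal (C₁ * ε ^ (1 / 2 : ℝ)) →
    nrm (fun n => ‖u n 0‖ₑ) ≤ ENNReal.ofReal C₁ →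
    ∀ t ∈ I, |t| ≤ K * ε ^ (-1 / 2 + δ) →
      nrm (fun n => ‖u n t - u n 0‖ₑ) ≤ ENNReal.ofReal (A * (1 + |t|) * ε ^ (1 / 2 : ℝ)) := by
  obtain ⟨A, hA, HA⟩ := exists_bootstrap_step hC₁
  refine ⟨A, hA, fun δ hδ K hK => ?_⟩
  obtain ⟨ε₀, hε₀, H⟩ := HA δ hδ K hK
  refine ⟨ε₀, hε₀, fun ε hε hεε₀ I u hI h0I hu hfin cM cX hX0 hM0 t ht htK => ?_⟩
  have he0 : 0 < ε ^ (1 / 2 : ℝ) := by positivity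
  set e : ℝ := ε ^ (1 / 2 : ℝ) with he
  have hfinX : ∀ s ∈ I, nrmHalf (fun n => ‖u n s‖ₑ) ≠ ⊤ := fun s hs =>
    ne_top_of_le_ne_top (hfin s hs) (nrmHalf_le_nrm _)
  -- Negative times reduce to the interval `[s, 0]`, as the increment is symmetric in its endpoints.
  have step : ∀ s ∈ I, |s| ≤ |t| →
      (∀ r ∈ uIcc 0 s, nrmHalf (fun n => ‖u n r‖ₑ) ≤ ENNReal.ofReal (2 * C₁ * e)) →
      (∀ r ∈ uIcc 0 s, nrm (fun n => ‖u n r‖ₑ) ≤ ENNReal.ofReal (2 * C₁)) →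
      nrm (fun n => ‖u n s - u n 0‖ₑ) ≤ ENNReal.ofReal (A * (1 + |s|) * e) ∧
      nrm (fun n => ‖u n s - u n 0‖ₑ) ≤ ENNReal.ofReal (C₁ / 2) ∧
      nrmHalf (fun n => ‖u n s - u n 0‖ₑ) ≤ ENNReal.ofReal (C₁ / 2 * e) := by
    intro s hs hst bX bM
    rcases le_total 0 s with h | h
    · rw [uIcc_of_le h] at bX bM
      have := H ε hε hεε₀ 0 s u h (hu 0 s (hI.out h0I hs))
        (by rw [sub_zero, ← abs_of_nonneg h]; exact hst.trans htK) bX bM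
      rw [sub_zero] at this
      rwa [abs_of_nonneg h]
    · rw [uIcc_of_ge h] at bX bM
      have := H ε hε hεε₀ s 0 u h (hu s 0 (hI.out hs h0I))
        (by rw [zero_sub, ← abs_of_nonpos h]; exact hst.trans htK) bX bM
      rw [zero_sub, ← abs_of_nonpos h] at this
      simpa only [enorm_sub_rev] using this
  -- The larger of both norms relative to their initial bounds, along the segment from `0` to `t`.
  set f : ℝ → ℝ := fun τ => max ((nrm (fun n => ‖u n (τ * t)‖ₑ)).toReal / C₁)
    ((nrmHalf (fun n => ‖u n (τ * t)‖ₑ)).toReal / (C₁ * e)) with hf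
  have hmem : ∀ τ ∈ Icc (0 : ℝ) 1, τ * t ∈ I ∧ |τ * t| ≤ |t| := fun τ hτ => by
    constructor
    · have h1 : τ * t ∈ uIcc (0 * t) (1 * t) := by
        rw [← image_mul_const_uIcc, uIcc_of_le zero_le_one]
        exact ⟨τ, hτ, rfl⟩
      rw [zero_mul, one_mul] at h1
      exact hI.uIcc_subset h0I ht h1
    · rw [abs_mul, abs_of_nonneg hτ.1]
      exact mul_le_of_le_one_left (abs_nonneg _) hτ.2
  have hfc : ContinuousOn f (Icc 0 1) := by
    have hm : MapsTo (fun τ => τ * t) (Icc (0 : ℝ) 1) I := fun τ hτ => (hmem τ hτ).1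
    have hc : ContinuousOn (fun τ => τ * t) (Icc (0 : ℝ) 1) := by fun_prop
    exact ((cM.comp hc hm).div_const _).sup ((cX.comp hc hm).div_const _)
  have f_le : ∀ τ ∈ Icc (0 : ℝ) 1, ∀ B : ℝ, 0 ≤ B → (f τ ≤ B ↔
      nrm (fun n => ‖u n (τ * t)‖ₑ) ≤ ENNReal.ofReal (B * C₁) ∧
      nrmHalf (fun n => ‖u n (τ * t)‖ₑ) ≤ ENNReal.ofReal (B * (C₁ * e))) := fun τ hτ B hB => by
    rw [hf, max_le_iff, div_le_iff₀ hC₁, div_le_iff₀ (by positivity),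
      ENNReal.le_ofReal_iff_toReal_le (hfin _ (hmem τ hτ).1) (by positivity),
      ENNReal.le_ofReal_iff_toReal_le (hfinX _ (hmem τ hτ).1) (by positivity)]
  have hstep : ∀ τ ∈ Icc (0 : ℝ) 1, (∀ σ ∈ Icc 0 τ, f σ ≤ 2) →
      nrm (fun n => ‖u n (τ * t) - u n 0‖ₑ) ≤ ENNReal.ofReal (A * (1 + |τ * t|) * e) ∧
      nrm (fun n => ‖u n (τ * t) - u n 0‖ₑ) ≤ ENNReal.ofReal (C₁ / 2) ∧
      nrmHalf (fun n => ‖u n (τ * t) - u n 0‖ₑ) ≤ ENNReal.ofReal (C₁ / 2 * e) := by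
    intro τ hτ hσ
    have hr : ∀ r ∈ uIcc 0 (τ * t), ∃ σ ∈ Icc 0 τ, σ * t = r := fun r hr => by
      have h1 : r ∈ uIcc (0 * t) (τ * t) := by rwa [zero_mul]
      rw [← image_mul_const_uIcc, uIcc_of_le hτ.1] at h1
      exact h1
    refine step _ (hmem τ hτ).1 (hmem τ hτ).2 (fun r hr' => ?_) (fun r hr' => ?_)
    · obtain ⟨σ, hσ1, rfl⟩ := hr r hr'
      have := ((f_le σ ⟨hσ1.1, hσ1.2.trans hτ.2⟩ 2 (by norm_num)).1 (hσ σ hσ1)).2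
      rwa [← mul_assoc] at this
    · obtain ⟨σ, hσ1, rfl⟩ := hr r hr'
      exact ((f_le σ ⟨hσ1.1, hσ1.2.trans hτ.2⟩ 2 (by norm_num)).1 (hσ σ hσ1)).1
  have hboot := le_two_of_bootstrap hfc
    ((f_le 0 (left_mem_Icc.2 zero_le_one) _ (by norm_num)).2 (by
      rw [zero_mul]
      refine ⟨hM0.trans (ENNReal.ofReal_le_ofReal ?_), hX0.trans (ENNReal.ofReal_le_ofReal ?_)⟩
      · linarith
      · have : 0 < C₁ * e := by positivity
        linarith))
    (fun τ hτ hσ => by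
      obtain ⟨-, g1, g2⟩ := hstep τ hτ hσ
      rw [f_le τ hτ _ (by norm_num)]
      constructor
      · refine (le_add_nrm_sub (u := fun n => u n 0)).trans ((add_le_add hM0 g1).trans_eq ?_)
        rw [← ENNReal.ofReal_add (by positivity) (by positivity)]; congr 1; ring
      · refine (le_add_nrmHalf_sub (u := fun n => u n 0)).trans ((add_le_add hX0 g2).trans_eq ?_)
        rw [← ENNReal.ofReal_add (by positivity) (by positivity)]; congr 1; ring)
  simpa using (hstep 1 (right_mem_Icc.2 zero_le_one) hboot).1

/-! ### Fourier coefficients -/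

open scoped ComplexConjugate

/-- Lebesgue measure on one period. -/
noncomputable abbrev periodMeasure : Measure ℝ := volume.restrict (Ioc (-Real.pi) Real.pi)

theorem fourier_period_apply (n : ℤ) (x : ℝ) :
    fourier n (x : AddCircle (Real.pi - -Real.pi)) = Complex.exp (I * n * x) := by
  rw [fourier_coe_apply]
  congr 1
  have : (Real.pi : ℂ) ≠ 0 := by exact_mod_cast Real.pi_ne_zero
  push_cast
  rw [sub_neg_eq_add, ← two_mul]
  field_simp

theorem coeff_eq_integral (f : ℝ → ℂ) (n : ℤ) :
    coeff f n = (2 * Real.pi : ℂ)⁻¹ *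
      ∫ x in (-Real.pi)..Real.pi, Complex.exp (-(I * n * x)) * f x := by
  rw [coeff, fourierCoeffOn_eq_integral]
  simp only [fourier_period_apply, smul_eq_mul, Complex.real_smul]
  congr 1
  · push_cast; rw [one_div]; congr 1; ring
  · congr 1; ext x; congr 2; push_cast; ring

/-- Parseval's identity for the product of two functions. -/
theorem hasSum_conj_coeff_mul_coeff {f g : ℝ → ℂ} (hf : MemLp f 2 periodMeasure)
    (hg : MemLp g 2 periodMeasure) :
    HasSum (fun n => conj (coeff f n) * coeff g n)
      ((2 * Real.pi : ℂ)⁻¹ * ∫ x in (-Real.pi)..Real.pi, conj (f x) * g x) := by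
  have := Fact.mk (by linarith [Real.pi_pos] : 0 < Real.pi - -Real.pi)
  have e : -Real.pi + (Real.pi - -Real.pi) = Real.pi := by ring
  have lift : ∀ {f : ℝ → ℂ}, MemLp f 2 periodMeasure →
      MemLp (AddCircle.liftIoc (Real.pi - -Real.pi) (-Real.pi) f) 2
        (AddCircle.haarAddCircle (T := Real.pi - -Real.pi)) := fun {f} hf => by
    rw [periodMeasure] at hf
    nth_rw 2 [← e] at hf
    exact hf.memLp_liftIoc.haarAddCircle
  have hF := lift hf
  have hG := lift hg
  have key := fourierBasis.hasSum_inner_mul_inner hF.toLp hG.toLp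
  have e1 : ∀ {f : ℝ → ℂ} (hF : MemLp (AddCircle.liftIoc (Real.pi - -Real.pi) (-Real.pi) f) 2
        (AddCircle.haarAddCircle (T := Real.pi - -Real.pi))) (n : ℤ),
      inner ℂ (fourierBasis n) hF.toLp = coeff f n := fun {f} hF n => by
    rw [← HilbertBasis.repr_apply_apply, fourierBasis_repr, fourierCoeff_congr_ae hF.coeFn_toLp]
    rfl
  set F' := hF.toLp
  set G' := hG.toLp
  have e2 : inner ℂ F' G' =
      (2 * Real.pi : ℂ)⁻¹ * ∫ x in (-Real.pi)..Real.pi, conj (f x) * g x := by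
    rw [L2.inner_def]
    have h1 : ∫ x, inner ℂ (F' x) (G' x)
          ∂(AddCircle.haarAddCircle (T := Real.pi - -Real.pi)) =
        ∫ x, AddCircle.liftIoc (Real.pi - -Real.pi) (-Real.pi) (fun y => conj (f y) * g y) x
          ∂(AddCircle.haarAddCircle (T := Real.pi - -Real.pi)) := by
      refine integral_congr_ae ?_
      filter_upwards [hF.coeFn_toLp, hG.coeFn_toLp] with x h1 h2
      rw [h1, h2, RCLike.inner_apply']
      rfl
    rw [h1, AddCircle.integral_haarAddCircle, AddCircle.integral_liftIoc_eq_intervalIntegral, e,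
      Complex.real_smul]
    congr 1
    push_cast; congr 1; ring
  rw [← e2]
  refine key.congr_fun fun n => ?_
  rw [← inner_conj_symm, e1, e1]

theorem intervalIntegrable_ofReal {f : ℝ → ℝ} {a b : ℝ} (hf : IntervalIntegrable f volume a b) :
    IntervalIntegrable (fun x => (f x : ℂ)) volume a b :=
  ⟨hf.1.ofReal, hf.2.ofReal⟩

/-- Coefficients of a real function in terms of its cosine and sine integrals. -/
theorem coeff_ofReal {f : ℝ → ℝ} (hf : IntervalIntegrable f volume (-Real.pi) Real.pi) (n : ℤ) :
    coeff (fun x => (f x : ℂ)) n = (2 * Real.pi : ℂ)⁻¹ *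
      (((∫ x in (-Real.pi)..Real.pi, f x * Real.cos (n * x) : ℝ) : ℂ) -
        I * ((∫ x in (-Real.pi)..Real.pi, f x * Real.sin (n * x) : ℝ) : ℂ)) := by
  rw [coeff_eq_integral, ← intervalIntegral.integral_ofReal, ← intervalIntegral.integral_ofReal,
    ← intervalIntegral.integral_const_mul I, ← intervalIntegral.integral_sub]
  · congr 1
    refine intervalIntegral.integral_congr fun x _ => ?_
    rw [show -(I * n * x) = ((-(n * x) : ℝ) : ℂ) * I by push_cast; ring, Complex.exp_mul_I,
      ← Complex.ofReal_cos, ← Complex.ofReal_sin, Real.cos_neg, Real.sin_neg]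
    push_cast; ring
  · exact intervalIntegrable_ofReal (hf.mul_continuousOn (by fun_prop))
  · exact (intervalIntegrable_ofReal (hf.mul_continuousOn (by fun_prop))).const_mul I

theorem conj_coeff_ofReal {f : ℝ → ℝ} (hf : IntervalIntegrable f volume (-Real.pi) Real.pi)
    (n : ℤ) : conj (coeff (fun x => (f x : ℂ)) n) = coeff (fun x => (f x : ℂ)) (-n) := by
  rw [coeff_ofReal hf, coeff_ofReal hf]
  have h1 : ∫ x in (-Real.pi)..Real.pi, f x * Real.cos ((-n : ℤ) * x) =
      ∫ x in (-Real.pi)..Real.pi, f x * Real.cos (n * x) := by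
    refine intervalIntegral.integral_congr fun x _ => ?_
    simp
  have h2 : ∫ x in (-Real.pi)..Real.pi, f x * Real.sin ((-n : ℤ) * x) =
      -∫ x in (-Real.pi)..Real.pi, f x * Real.sin (n * x) := by
    rw [← intervalIntegral.integral_neg]
    refine intervalIntegral.integral_congr fun x _ => ?_
    simp
  rw [h1, h2]
  simp [Complex.conj_ofReal, map_ofNat]

theorem intervalIntegrable_of_memLp {f : ℝ → ℝ} (hf : MemLp f 2 periodMeasure) :
    IntervalIntegrable f volume (-Real.pi) Real.pi :=
  (intervalIntegrable_iff_integrableOn_Ioc_of_le (by linarith [Real.pi_pos])).2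
    (hf.integrable one_le_two)

theorem intervalIntegrable_sq_of_memLp {f : ℝ → ℝ} (hf : MemLp f 2 periodMeasure) :
    IntervalIntegrable (fun x => f x ^ 2) volume (-Real.pi) Real.pi :=
  (intervalIntegrable_iff_integrableOn_Ioc_of_le (by linarith [Real.pi_pos])).2 hf.integrable_sq

theorem coeff_sub {f g : ℝ → ℝ} (hf : MemLp f 2 periodMeasure) (hg : MemLp g 2 periodMeasure)
    (n : ℤ) : coeff (fun x => ((f x - g x : ℝ) : ℂ)) n =
      coeff (fun x => (f x : ℂ)) n - coeff (fun x => (g x : ℂ)) n := by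
  rw [coeff_eq_integral, coeff_eq_integral, coeff_eq_integral, ← mul_sub,
    ← intervalIntegral.integral_sub]
  · simp only [Complex.ofReal_sub, mul_sub]
  · exact (intervalIntegrable_ofReal (intervalIntegrable_of_memLp hf)).continuousOn_mul
      (by fun_prop)
  · exact (intervalIntegrable_ofReal (intervalIntegrable_of_memLp hg)).continuousOn_mul
      (by fun_prop)

/-- The Fourier coefficients of a square are a convolution. -/
theorem coeff_sq {f : ℝ → ℝ} (hf : MemLp f 2 periodMeasure) (n : ℤ) :
    coeff (fun x => ((f x ^ 2 : ℝ) : ℂ)) n =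
      ∑' a, coeff (fun x => (f x : ℂ)) a * coeff (fun x => (f x : ℂ)) (n - a) := by
  have hfC : MemLp (fun x => (f x : ℂ)) 2 periodMeasure := hf.ofReal
  have hF : MemLp (fun x : ℝ => Complex.exp (I * n * x) * (f x : ℂ)) 2 periodMeasure := by
    refine hfC.of_le ((Continuous.aestronglyMeasurable (by fun_prop)).mul hfC.1)
      (Eventually.of_forall fun x => ?_)
    rw [norm_mul, show I * n * x = ((n * x : ℝ) : ℂ) * I by push_cast; ring,
      Complex.norm_exp_ofReal_mul_I, one_mul]
  have key := (hasSum_conj_coeff_mul_coeff hF hfC).tsum_eq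
  rw [coeff_eq_integral]
  calc _ = (2 * Real.pi : ℂ)⁻¹ * ∫ x in (-Real.pi)..Real.pi,
        conj (Complex.exp (I * n * x) * (f x : ℂ)) * (f x : ℂ) := by
        congr 1
        refine intervalIntegral.integral_congr fun x _ => ?_
        simp only [map_mul, ← Complex.exp_conj, Complex.conj_I, Complex.conj_ofReal, map_intCast]
        push_cast
        rw [show -I * (n : ℂ) * x = -(I * n * x) by ring]
        ring
    _ = _ := by
        rw [← key]
        refine tsum_congr fun m => ?_
        rw [mul_comm]
        congr 1
        have : coeff (fun x : ℝ => Complex.exp (I * n * x) * (f x : ℂ)) m =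
            coeff (fun x => (f x : ℂ)) (m - n) := by
          rw [coeff_eq_integral, coeff_eq_integral]
          congr 1
          refine intervalIntegral.integral_congr fun x _ => ?_
          rw [← mul_assoc, ← Complex.exp_add]
          congr 2; push_cast; ring
        rw [this, conj_coeff_ofReal (intervalIntegrable_of_memLp hf), neg_sub]

theorem sobolevNorm_eq_nrm (s : ℝ) (f : ℝ → ℝ) :
    sobolevNorm s f = nrm (fun n : ℤ => ‖coeff (fun x => (f x : ℂ)) n‖ₑ *
      ENNReal.ofReal ((1 + (n : ℝ) ^ 2) ^ (s / 2))) := by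
  rw [sobolevNorm, nrm]
  congr 1
  refine tsum_congr fun n => ?_
  have h0 : (0 : ℝ) < 1 + (n : ℝ) ^ 2 := by positivity
  rw [← ofReal_norm, ← ENNReal.ofReal_mul (norm_nonneg _), ← ENNReal.ofReal_pow (by positivity),
    mul_pow, ← Real.rpow_natCast (_ ^ (s / 2)), ← Real.rpow_mul h0.le]
  congr 1
  rw [mul_comm]; congr 2; push_cast; ring

/-- The coefficients of an absolutely convergent Fourier series. -/
theorem coeff_tsum {b : ℤ → ℂ} (hb : Summable fun n => ‖b n‖) (n : ℤ) :
    coeff (fun x => ∑' m : ℤ, b m * Complex.exp (I * m * x)) n = b n := by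
  have hn1 : ∀ (m : ℤ) (x : ℝ), ‖Complex.exp (I * m * x)‖ = 1 := fun m x => by
    rw [show I * m * x = ((m * x : ℝ) : ℂ) * I by push_cast; ring, Complex.norm_exp_ofReal_mul_I]
  have hn2 : ∀ (m : ℤ) (x : ℝ), ‖Complex.exp (-(I * m * x))‖ = 1 := fun m x => by
    rw [show -(I * m * x) = ((-(m * x) : ℝ) : ℂ) * I by push_cast; ring,
      Complex.norm_exp_ofReal_mul_I]
  have hs : ∀ x : ℝ, Summable fun m : ℤ => b m * Complex.exp (I * m * x) := fun x =>
    Summable.of_norm_bounded hb fun m => by rw [norm_mul, hn1, mul_one]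
  have horth : ∀ m : ℤ, ∫ x in (-Real.pi)..Real.pi,
      Complex.exp (-(I * n * x)) * (b m * Complex.exp (I * m * x)) =
        if m = n then 2 * Real.pi * b n else 0 := fun m => by
    have e : ∀ x : ℝ, Complex.exp (-(I * n * x)) * (b m * Complex.exp (I * m * x)) =
        b m * Complex.exp ((I * (m - n)) * x) := fun x => by
      rw [mul_left_comm, ← Complex.exp_add]; congr 2; ring
    simp_rw [e]
    rw [intervalIntegral.integral_const_mul]
    split_ifs with h
    · subst h; simp; ring
    · have hc : I * ((m : ℂ) - n) ≠ 0 :=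
        mul_ne_zero Complex.I_ne_zero (sub_ne_zero.2 (by exact_mod_cast h))
      rw [integral_exp_mul_complex hc]
      have : Complex.exp (I * (m - n) * Real.pi) =
          Complex.exp (I * (m - n) * ((-Real.pi : ℝ) : ℂ)) := by
        rw [Complex.exp_eq_exp_iff_exists_int]
        exact ⟨m - n, by push_cast; ring⟩
      rw [this]; simp
  have key := intervalIntegral.hasSum_integral_of_dominated_convergence (μ := volume)
    (a := -Real.pi) (b := Real.pi)
    (F := fun (m : ℤ) (x : ℝ) => Complex.exp (-(I * n * x)) * (b m * Complex.exp (I * m * x)))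
    (f := fun x => Complex.exp (-(I * n * x)) * ∑' m : ℤ, b m * Complex.exp (I * m * x))
    (fun m _ => ‖b m‖)
    (fun m => Continuous.aestronglyMeasurable (by fun_prop))
    (fun m => Eventually.of_forall fun x _ => by
      rw [norm_mul, norm_mul, hn1, hn2, one_mul, mul_one])
    (Eventually.of_forall fun x _ => hb)
    intervalIntegrable_const
    (Eventually.of_forall fun x _ => (hs x).hasSum.mul_left _)
  rw [coeff_eq_integral, ← key.tsum_eq]
  simp_rw [horth, tsum_ite_eq]
  have : (Real.pi : ℂ) ≠ 0 := by exact_mod_cast Real.pi_ne_zero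
  field_simp

/-- Parseval: the factor `√(2π)` comes from the unnormalised measure in `l2Norm`. -/
theorem l2Norm_eq {w : ℝ → ℂ} (hw : MemLp w 2 periodMeasure) :
    l2Norm w = ENNReal.ofReal √(2 * Real.pi) * nrm (fun n => ‖coeff w n‖ₑ) := by
  have h := hasSum_sq_fourierCoeffOn (neg_lt_self Real.pi_pos) hw
  have h0 : 0 ≤ ∫ x in (-Real.pi)..Real.pi, ‖w x‖ ^ 2 :=
    intervalIntegral.integral_nonneg (by linarith [Real.pi_pos]) fun x _ => by positivity
  have e1 : nrm (fun n => ‖coeff w n‖ₑ) ^ 2 =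
      ENNReal.ofReal ((2 * Real.pi)⁻¹ * ∫ x in (-Real.pi)..Real.pi, ‖w x‖ ^ 2) := by
    rw [nrm_sq, show (2 * Real.pi)⁻¹ = (Real.pi - -Real.pi)⁻¹ by congr 1; ring, ← smul_eq_mul,
      ← h.tsum_eq, ENNReal.ofReal_tsum_of_nonneg (fun n => by positivity) h.summable]
    refine tsum_congr fun n => ?_
    rw [ENNReal.ofReal_pow (norm_nonneg _), ofReal_norm]; rfl
  have e2 : l2Norm w ^ 2 = ENNReal.ofReal (∫ x in (-Real.pi)..Real.pi, ‖w x‖ ^ 2) := by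
    rw [l2Norm, hw.eLpNorm_eq_integral_rpow_norm two_ne_zero ENNReal.ofNat_ne_top,
      ← ENNReal.ofReal_pow (by positivity), ← Real.rpow_natCast, ← Real.rpow_mul (by positivity),
      intervalIntegral.integral_of_le (by linarith [Real.pi_pos])]
    simp
  apply sq_inj_ennreal
  rw [e2, mul_pow, e1, ← ENNReal.ofReal_pow (by positivity), Real.sq_sqrt (by positivity),
    ← ENNReal.ofReal_mul (by positivity)]
  congr 1
  have := Real.pi_ne_zero
  field_simp

/-! ### KdV in Fourier variables -/

/-- The Fourier coefficients of `v t`. -/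
noncomputable def modes (v : ℝ → ℝ → ℝ) (n : ℤ) (t : ℝ) : ℂ := coeff (fun x => (v t x : ℂ)) n

/-- The interaction representation `u_n(t) = e^{-in³t} v̂(n, t)`. -/
noncomputable def interaction (v : ℝ → ℝ → ℝ) (n : ℤ) (t : ℝ) : ℂ :=
  Complex.exp (-(I * n ^ 3 * t)) * modes v n t

theorem norm_exp_cubic (n : ℤ) (t : ℝ) : ‖Complex.exp (-(I * n ^ 3 * t))‖ = 1 := by
  rw [show -(I * n ^ 3 * t) = ((-(n ^ 3 * t) : ℝ) : ℂ) * I by push_cast; ring]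
  exact Complex.norm_exp_ofReal_mul_I _

theorem enorm_interaction (v : ℝ → ℝ → ℝ) (n : ℤ) (t : ℝ) :
    ‖interaction v n t‖ₑ = ‖modes v n t‖ₑ := by
  rw [interaction, enorm_mul, ← ofReal_norm (Complex.exp _), norm_exp_cubic, ENNReal.ofReal_one,
    one_mul]

theorem deriv_trig (n A B : ℝ) :
    deriv (fun x : ℝ => A * Real.cos (n * x) + B * Real.sin (n * x)) =
      fun x => (n * B) * Real.cos (n * x) + (-(n * A)) * Real.sin (n * x) := by
  ext x
  have h : HasDerivAt (fun x : ℝ => n * x) n x := by simpa using (hasDerivAt_id x).const_mul n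
  refine ((h.cos.const_mul A).add (h.sin.const_mul B)).deriv.trans ?_
  ring

theorem iteratedDeriv_three_trig (n A B : ℝ) :
    iteratedDeriv 3 (fun x : ℝ => A * Real.cos (n * x) + B * Real.sin (n * x)) =
      fun x => (-(n ^ 3 * B)) * Real.cos (n * x) + (n ^ 3 * A) * Real.sin (n * x) := by
  rw [iteratedDeriv_succ, iteratedDeriv_succ, iteratedDeriv_one, deriv_trig, deriv_trig,
    deriv_trig]
  ext x; ring

section Solution

variable {J : Set ℝ} {v : ℝ → ℝ → ℝ}

/-- The weak formulation tested with a trigonometric function. -/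
theorem IsSolutionOn.hasDerivWithinAt_trig (hv : IsSolutionOn J v) (n : ℤ) (A B : ℝ) {t : ℝ}
    (ht : t ∈ J) :
    HasDerivWithinAt (fun τ => A * (∫ x in (-Real.pi)..Real.pi, v τ x * Real.cos (n * x)) +
        B * ∫ x in (-Real.pi)..Real.pi, v τ x * Real.sin (n * x))
      ((-(n ^ 3 * B)) * (∫ x in (-Real.pi)..Real.pi, v t x * Real.cos (n * x)) +
        (n ^ 3 * A) * (∫ x in (-Real.pi)..Real.pi, v t x * Real.sin (n * x)) -
        3 * ((n * B) * (∫ x in (-Real.pi)..Real.pi, v t x ^ 2 * Real.cos (n * x)) +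
          (-(n * A)) * ∫ x in (-Real.pi)..Real.pi, v t x ^ 2 * Real.sin (n * x))) J t := by
  have split : ∀ (f : ℝ → ℝ) (A B : ℝ), IntervalIntegrable f volume (-Real.pi) Real.pi →
      ∫ x in (-Real.pi)..Real.pi, f x * (A * Real.cos (n * x) + B * Real.sin (n * x)) =
      A * (∫ x in (-Real.pi)..Real.pi, f x * Real.cos (n * x)) +
        B * ∫ x in (-Real.pi)..Real.pi, f x * Real.sin (n * x) := fun f A B hf => by
    rw [← intervalIntegral.integral_const_mul, ← intervalIntegral.integral_const_mul,
      ← intervalIntegral.integral_add]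
    · refine intervalIntegral.integral_congr fun x _ => ?_
      ring
    · exact (hf.mul_continuousOn (by fun_prop)).const_mul A
    · exact (hf.mul_continuousOn (by fun_prop)).const_mul B
  have hi : ∀ τ ∈ J, IntervalIntegrable (v τ) volume (-Real.pi) Real.pi := fun τ hτ =>
    intervalIntegrable_of_memLp (hv.memH1 τ hτ).memLp
  have hi2 := intervalIntegrable_sq_of_memLp (hv.memH1 t ht).memLp
  have hper : Function.Periodic
      (fun x : ℝ => A * Real.cos (n * x) + B * Real.sin (n * x)) (2 * Real.pi) := fun x => by
    simp only
    rw [mul_add, Real.cos_add_int_mul_two_pi, Real.sin_add_int_mul_two_pi]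
  have key := hv.weak _ (by fun_prop) hper t ht
  rw [iteratedDeriv_three_trig, deriv_trig, split _ _ _ (hi t ht), split _ _ _ hi2] at key
  exact key.congr (fun τ hτ => (split _ _ _ (hi τ hτ)).symm) (split _ _ _ (hi t ht)).symm

/-- The equation in Fourier variables. -/
theorem IsSolutionOn.hasDerivWithinAt_modes (hv : IsSolutionOn J v) (n : ℤ) {t : ℝ}
    (ht : t ∈ J) :
    HasDerivWithinAt (modes v n)
      (I * n ^ 3 * modes v n t + 3 * I * n * ∑' a, modes v a t * modes v (n - a) t) J t := by
  have h1 := (hv.hasDerivWithinAt_trig n 1 0 ht).ofReal_comp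
  have h2 := (hv.hasDerivWithinAt_trig n 0 1 ht).ofReal_comp
  have h3 := (h1.sub (h2.const_mul I)).const_mul (2 * Real.pi : ℂ)⁻¹
  have hL := (hv.memH1 t ht).memLp
  have e : ∀ τ ∈ J, modes v n τ = (2 * Real.pi : ℂ)⁻¹ *
      (((∫ x in (-Real.pi)..Real.pi, v τ x * Real.cos (n * x) : ℝ) : ℂ) -
        I * ((∫ x in (-Real.pi)..Real.pi, v τ x * Real.sin (n * x) : ℝ) : ℂ)) := fun τ hτ =>
    coeff_ofReal (intervalIntegrable_of_memLp (hv.memH1 τ hτ).memLp) n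
  have esq := coeff_ofReal (intervalIntegrable_sq_of_memLp hL) n
  rw [coeff_sq hL] at esq
  have e4 : ∑' a, modes v a t * modes v (n - a) t = _ := esq
  refine (h3.congr (fun τ hτ => ?_) ?_).congr_deriv ?_
  · rw [e τ hτ]
    simp only [Pi.sub_apply, one_mul, zero_mul, add_zero, zero_add]
  · rw [e t ht]
    simp only [Pi.sub_apply, one_mul, zero_mul, add_zero, zero_add]
  · rw [e t ht, e4]
    push_cast
    linear_combination (2 * Real.pi : ℂ)⁻¹ *
      ((n : ℂ) ^ 3 * ((∫ x in (-Real.pi)..Real.pi, v t x * Real.sin (n * x) : ℝ) : ℂ) +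
        3 * n * ((∫ x in (-Real.pi)..Real.pi, v t x ^ 2 * Real.sin (n * x) : ℝ) : ℂ)) *
          Complex.I_sq

/-- Conservation of the mean. -/
theorem IsSolutionOn.modes_zero (hv : IsSolutionOn J v) (hI : J.OrdConnected)
    (h0 : (0 : ℝ) ∈ J) (hmean : ∫ x in (-Real.pi)..Real.pi, v 0 x = 0) {t : ℝ} (ht : t ∈ J) :
    modes v 0 t = 0 := by
  have h : ∀ s ∈ J, HasDerivWithinAt (modes v 0) 0 J s := fun s hs =>
    (hv.hasDerivWithinAt_modes 0 hs).congr_deriv (by simp)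
  have hc := hI.convex.norm_image_sub_le_of_norm_hasDerivWithin_le (C := 0) h
    (fun s _ => by simp) h0 ht
  have e : modes v 0 0 = 0 := by
    rw [modes, coeff_ofReal (intervalIntegrable_of_memLp (hv.memH1 0 h0).memLp)]
    simp [hmean]
  rw [e, zero_mul, sub_zero] at hc
  exact norm_le_zero_iff.1 hc

theorem IsSolutionOn.hasDerivWithinAt_interaction (hv : IsSolutionOn J v) (n : ℤ) {t : ℝ}
    (ht : t ∈ J) :
    HasDerivWithinAt (interaction v n) (rhs (interaction v) n t) J t := by
  have h1 : HasDerivAt (fun s : ℝ => Complex.exp (-(I * n ^ 3 * s)))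
      (Complex.exp (-(I * n ^ 3 * t)) * (-(I * n ^ 3 * 1))) t := by
    have : HasDerivAt (fun s : ℝ => -(I * (n : ℂ) ^ 3 * s)) (-(I * n ^ 3 * 1)) t :=
      ((hasDerivAt_id t).ofReal_comp.const_mul (I * (n : ℂ) ^ 3)).neg
    exact this.cexp
  refine (h1.hasDerivWithinAt.mul (hv.hasDerivWithinAt_modes n ht)).congr_deriv ?_
  have e : ∀ a : ℤ, phase (n * a * (n - a)) t * (interaction v a t * interaction v (n - a) t) =
      Complex.exp (-(I * n ^ 3 * t)) * (modes v a t * modes v (n - a) t) := fun a => by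
    simp only [phase, interaction]
    rw [show Complex.exp (-(I * n ^ 3 * t)) = Complex.exp (-(3 * I * (n * a * (n - a) : ℤ) * t)) *
        (Complex.exp (-(I * a ^ 3 * t)) * Complex.exp (-(I * (n - a : ℤ) ^ 3 * t))) by
      rw [← Complex.exp_add, ← Complex.exp_add]; congr 1; push_cast; ring]
    ring
  rw [rhs, bilin]
  simp_rw [e]
  rw [tsum_mul_left]
  ring

/-- Weighted `ℓ²` norms of the coefficients with a weight below `(1 + n²)^{1/2}` are continuous
in time. -/
theorem IsSolutionOn.continuousOn_nrm (hv : IsSolutionOn J v) {w : ℤ → ℝ≥0∞}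
    (hw : ∀ n : ℤ, w n ≤ ENNReal.ofReal ((1 + (n : ℝ) ^ 2) ^ (1 / 2 : ℝ))) :
    (∀ t ∈ J, nrm (fun n => ‖modes v n t‖ₑ * w n) ≠ ⊤) ∧
    ContinuousOn (fun t => (nrm (fun n => ‖modes v n t‖ₑ * w n)).toReal) J := by
  set g : ℝ → ℝ≥0∞ := fun t => nrm (fun n => ‖modes v n t‖ₑ * w n) with hg
  have hfin : ∀ t ∈ J, g t ≠ ⊤ := fun t ht => by
    refine ne_top_of_le_ne_top (hv.memH1 t ht).finite.ne ?_
    rw [sobolevNorm_eq_nrm]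
    exact nrm_mono fun n => mul_le_mul_right (hw n) _
  refine ⟨hfin, fun t₀ ht₀ => ?_⟩
  set d : ℝ → ℝ≥0∞ := fun t => sobolevNorm 1 (fun x => v t x - v t₀ x) with hd
  have hdiff : ∀ t ∈ J, nrm (fun n => ‖modes v n t - modes v n t₀‖ₑ * w n) ≤ d t := fun t ht => by
    change _ ≤ sobolevNorm 1 (fun x => v t x - v t₀ x)
    rw [sobolevNorm_eq_nrm]
    refine nrm_mono fun n => ?_
    rw [coeff_sub (hv.memH1 t ht).memLp (hv.memH1 t₀ ht₀).memLp]
    exact mul_le_mul_right (hw n) _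
  have h1 : ∀ t ∈ J, g t ≤ g t₀ + d t := fun t ht => by
    refine le_trans ?_ (add_le_add_right (hdiff t ht) _)
    refine (nrm_mono fun n => ?_).trans (nrm_add_le _ _)
    rw [← add_mul]
    gcongr
    calc ‖modes v n t‖ₑ = ‖modes v n t₀ + (modes v n t - modes v n t₀)‖ₑ := by
          rw [add_sub_cancel]
      _ ≤ _ := enorm_add_le _ _
  have h2 : ∀ t ∈ J, g t₀ - d t ≤ g t := fun t ht => by
    rw [tsub_le_iff_right]
    refine le_trans ?_ (add_le_add_right (hdiff t ht) _)
    refine (nrm_mono fun n => ?_).trans (nrm_add_le _ _)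
    rw [← add_mul]
    gcongr
    calc ‖modes v n t₀‖ₑ = ‖modes v n t - (modes v n t - modes v n t₀)‖ₑ := by
          rw [sub_sub_cancel]
      _ ≤ _ := enorm_sub_le
  have hlim := hv.continuous t₀ ht₀
  have l1 : Tendsto (fun t => g t₀ + d t) (𝓝[J] t₀) (𝓝 (g t₀)) := by
    simpa using (tendsto_const_nhds (x := g t₀)).add hlim
  have l2 : Tendsto (fun t => g t₀ - d t) (𝓝[J] t₀) (𝓝 (g t₀)) := by
    simpa using ENNReal.Tendsto.sub (tendsto_const_nhds (x := g t₀)) hlim (Or.inl (hfin t₀ ht₀))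
  have l3 : Tendsto g (𝓝[J] t₀) (𝓝 (g t₀)) :=
    tendsto_of_tendsto_of_tendsto_of_le_of_le' l2 l1
      (eventually_mem_nhdsWithin.mono h2) (eventually_mem_nhdsWithin.mono h1)
  exact (ENNReal.tendsto_toReal (hfin t₀ ht₀)).comp l3

theorem one_le_bracket (n : ℤ) : (1 : ℝ) ≤ (1 + (n : ℝ) ^ 2) ^ (1 / 2 : ℝ) :=
  Real.one_le_rpow (by linarith [sq_nonneg (n : ℝ)]) (by norm_num)

theorem abs_le_bracket (n : ℤ) : |(n : ℝ)| ≤ (1 + (n : ℝ) ^ 2) ^ (1 / 2 : ℝ) := by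
  rw [← Real.sqrt_eq_rpow, ← Real.sqrt_sq_eq_abs]
  exact Real.sqrt_le_sqrt (by linarith)

theorem IsSolutionOn.isReducedSolution (hv : IsSolutionOn J v) (hI : J.OrdConnected)
    (h0 : (0 : ℝ) ∈ J) (hmean : ∫ x in (-Real.pi)..Real.pi, v 0 x = 0) {a b : ℝ}
    (hab : Icc a b ⊆ J) : IsReducedSolution (Icc a b) (interaction v) := by
  refine ⟨fun t ht => ?_, fun t ht n => (hv.hasDerivWithinAt_interaction n (hab ht)).mono hab, ?_⟩
  · rw [interaction, hv.modes_zero hI h0 hmean (hab ht), mul_zero]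
  · obtain ⟨hfin, hc⟩ := hv.continuousOn_nrm (w := absE) fun n =>
      ENNReal.ofReal_le_ofReal (abs_le_bracket n)
    obtain ⟨H, hH⟩ := isCompact_Icc.exists_bound_of_continuousOn (hc.mono hab)
    refine ⟨max H 0, le_max_right _ _, fun t ht n => ?_⟩
    rcases eq_or_ne n 0 with rfl | hn
    · simp [interaction, hv.modes_zero hI h0 hmean (hab ht)]
    · have hn1 := one_le_abs_cast hn
      rw [← div_eq_mul_inv, le_div_iff₀ (by linarith), interaction, norm_mul, norm_exp_cubic,
        one_mul]
      have h1 := le_nrm (fun n => ‖modes v n t‖ₑ * absE n) n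
      have h2 := ENNReal.toReal_mono (hfin t (hab ht)) h1
      rw [ENNReal.toReal_mul, toReal_enorm, absE, ENNReal.toReal_ofReal (abs_nonneg _)] at h2
      exact h2.trans ((le_abs_self _).trans ((hH t ht).trans (le_max_left _ _)))

end Solution

/-- Interpolation of `L²` between `H^{-1/2}` and `H¹`, with the frequency `ε⁻¹` as threshold. -/
theorem nrm_coeff_le {C ε : ℝ} (hC : 0 < C) (hε : 0 < ε) {f : ℝ → ℝ}
    (h1 : sobolevNorm 1 f ≤ ENNReal.ofReal (C * ε⁻¹))
    (h2 : sobolevNorm (-1 / 2) f ≤ ENNReal.ofReal (C * ε ^ (1 / 2 : ℝ))) :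
    nrm (fun n => ‖coeff (fun x => (f x : ℂ)) n‖ₑ) ≤ ENNReal.ofReal (2 * C) := by
  rw [sobolevNorm_eq_nrm] at h1 h2
  have key : ∀ n : ℤ, (1 : ℝ) ≤ ε⁻¹ * ((1 + (n : ℝ) ^ 2) ^ (-1 / 2 / 2 : ℝ)) ^ 2 +
      ε ^ 2 * ((1 + (n : ℝ) ^ 2) ^ (1 / 2 : ℝ)) ^ 2 := fun n => by
    have hp : (0 : ℝ) < 1 + (n : ℝ) ^ 2 := by positivity
    have e : ((1 + (n : ℝ) ^ 2) ^ (-1 / 2 / 2 : ℝ)) ^ 2 = (√(1 + (n : ℝ) ^ 2))⁻¹ := by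
      rw [← Real.rpow_natCast, ← Real.rpow_mul hp.le, Real.sqrt_eq_rpow, ← Real.rpow_neg hp.le]
      congr 1; norm_num
    rw [e, ← Real.sqrt_eq_rpow]
    set y := √(1 + (n : ℝ) ^ 2)
    have hy : 0 < y := by positivity
    rcases le_total (ε * y) 1 with h | h
    · have : 1 ≤ ε⁻¹ * y⁻¹ := by
        rw [← mul_inv]; exact (one_le_inv₀ (by positivity)).2 h
      have : 0 ≤ ε ^ 2 * y ^ 2 := by positivity
      linarith
    · have : 1 ≤ ε ^ 2 * y ^ 2 := by rw [← mul_pow]; exact one_le_pow₀ h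
      have : 0 ≤ ε⁻¹ * y⁻¹ := by positivity
      linarith
  rw [← sq_le_sq_iff_le, nrm_sq]
  have h1' := pow_le_pow_left' h1 2
  have h2' := pow_le_pow_left' h2 2
  rw [nrm_sq] at h1' h2'
  calc _ ≤ ∑' n : ℤ, (ENNReal.ofReal ε⁻¹ * (‖coeff (fun x => (f x : ℂ)) n‖ₑ *
          ENNReal.ofReal ((1 + (n : ℝ) ^ 2) ^ (-1 / 2 / 2 : ℝ))) ^ 2 +
        ENNReal.ofReal (ε ^ 2) * (‖coeff (fun x => (f x : ℂ)) n‖ₑ *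
          ENNReal.ofReal ((1 + (n : ℝ) ^ 2) ^ (1 / 2 : ℝ))) ^ 2) := by
        refine ENNReal.tsum_le_tsum fun n => ?_
        calc _ = ‖coeff (fun x => (f x : ℂ)) n‖ₑ ^ 2 * ENNReal.ofReal 1 := by simp
          _ ≤ ‖coeff (fun x => (f x : ℂ)) n‖ₑ ^ 2 * ENNReal.ofReal
              (ε⁻¹ * ((1 + (n : ℝ) ^ 2) ^ (-1 / 2 / 2 : ℝ)) ^ 2 +
                ε ^ 2 * ((1 + (n : ℝ) ^ 2) ^ (1 / 2 : ℝ)) ^ 2) :=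
              mul_le_mul_right (ENNReal.ofReal_le_ofReal (key n)) _
          _ = _ := by
              rw [ENNReal.ofReal_add (by positivity) (by positivity),
                ENNReal.ofReal_mul (p := ε⁻¹) (by positivity),
                ENNReal.ofReal_mul (p := ε ^ 2) (by positivity),
                ENNReal.ofReal_pow (p := _ ^ (-1 / 2 / 2 : ℝ)) (by positivity),
                ENNReal.ofReal_pow (p := _ ^ (1 / 2 : ℝ)) (by positivity)]
              ring
    _ ≤ ENNReal.ofReal ε⁻¹ * ENNReal.ofReal (C * ε ^ (1 / 2 : ℝ)) ^ 2 +
        ENNReal.ofReal (ε ^ 2) * ENNReal.ofReal (C * ε⁻¹) ^ 2 := by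
        rw [ENNReal.tsum_add, ENNReal.tsum_mul_left, ENNReal.tsum_mul_left]
        gcongr
    _ = ENNReal.ofReal (2 * C ^ 2) := by
        rw [← ENNReal.ofReal_pow (by positivity), ← ENNReal.ofReal_pow (by positivity),
          ← ENNReal.ofReal_mul (by positivity), ← ENNReal.ofReal_mul (by positivity),
          ← ENNReal.ofReal_add (by positivity) (by positivity)]
        congr 1
        have : (ε ^ (1 / 2 : ℝ)) ^ 2 = ε := by
          rw [← Real.rpow_natCast, ← Real.rpow_mul hε.le]; norm_num
        rw [mul_pow, this]
        field_simp; ring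
    _ ≤ ENNReal.ofReal (2 * C) ^ 2 := by
        rw [← ENNReal.ofReal_pow (by positivity)]
        exact ENNReal.ofReal_le_ofReal (by nlinarith)

theorem nrmHalf_coeff_le (f : ℝ → ℝ) :
    nrmHalf (fun n => ‖coeff (fun x => (f x : ℂ)) n‖ₑ) ≤ 2 * sobolevNorm (-1 / 2) f := by
  rw [sobolevNorm_eq_nrm, ← nrm_const_mul]
  refine nrm_mono fun n => ?_
  rw [mul_left_comm]
  gcongr
  rcases eq_or_ne n 0 with rfl | hn
  · simp
  have hn1 := one_le_abs_cast hn
  have hn2 : (1 : ℝ) ≤ (n : ℝ) ^ 2 := by rw [← sq_abs]; exact one_le_pow₀ hn1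
  have hp : (0 : ℝ) < 1 + (n : ℝ) ^ 2 := by positivity
  rw [rho, show (2 : ℝ≥0∞) = ENNReal.ofReal 2 by norm_num, ← ENNReal.ofReal_mul (by norm_num)]
  apply ENNReal.ofReal_le_ofReal
  have e : (1 + (n : ℝ) ^ 2) ^ (-1 / 2 / 2 : ℝ) = (√√(1 + (n : ℝ) ^ 2))⁻¹ := by
    rw [Real.sqrt_eq_rpow, Real.sqrt_eq_rpow, ← Real.rpow_mul hp.le, ← Real.rpow_neg hp.le]
    congr 1; norm_num
  rw [e, ← div_eq_mul_inv, ← one_div, div_le_div_iff₀ (by positivity) (by positivity), one_mul]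
  have h1 : √(1 + (n : ℝ) ^ 2) ≤ 2 * |(n : ℝ)| := by
    apply Real.sqrt_le_iff.2 ⟨by positivity, _⟩
    rw [mul_pow, sq_abs]; linarith
  apply Real.sqrt_le_iff.2 ⟨by positivity, _⟩
  rw [mul_pow, Real.sq_sqrt (abs_nonneg _)]; linarith

/-- The distance to the linear evolution, in the interaction representation. -/
theorem l2Norm_sub_linearFlow {f g : ℝ → ℝ} (hf : MemH1 f) (hg : MemH1 g)
    (hg0 : coeff (fun x => (g x : ℂ)) 0 = 0) (t : ℝ) :
    l2Norm (fun x => (f x : ℂ) - linearFlow t g x) = ENNReal.ofReal √(2 * Real.pi) *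
      nrm (fun n : ℤ => ‖Complex.exp (-(I * n ^ 3 * t)) * coeff (fun x => (f x : ℂ)) n -
        coeff (fun x => (g x : ℂ)) n‖ₑ) := by
  set b : ℤ → ℂ := fun n => Complex.exp (I * (n : ℂ) ^ 3 * (t : ℂ)) * coeff (fun y => (g y : ℂ)) n
    with hb
  have hexp : ∀ n : ℤ, ‖Complex.exp (I * (n : ℂ) ^ 3 * (t : ℂ))‖ = 1 := fun n => by
    rw [show I * (n : ℂ) ^ 3 * t = ((n ^ 3 * t : ℝ) : ℂ) * I by push_cast; ring]
    exact Complex.norm_exp_ofReal_mul_I _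
  have hbn : ∀ n, ‖b n‖ = ‖coeff (fun y => (g y : ℂ)) n‖ := fun n => by
    rw [hb, norm_mul, hexp, one_mul]
  have hsum : Summable fun n => ‖b n‖ := by
    simp_rw [hbn]
    have h1 : ∑' n, ‖coeff (fun y => (g y : ℂ)) n‖ₑ ≠ ⊤ := by
      have h2 : sobolevNorm 1 g * nrm ker ≠ ⊤ := ENNReal.mul_ne_top hg.finite.ne nrm_ker_ne_top
      refine ne_top_of_le_ne_top h2 ?_
      rw [sobolevNorm_eq_nrm]
      refine le_trans (ENNReal.tsum_le_tsum fun n => ?_) (tsum_mul_le_nrm _ _)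
      rcases eq_or_ne n 0 with rfl | hn
      · simp [hg0]
      · have hn1 := one_le_abs_cast hn
        rw [mul_assoc, ker, ← ENNReal.ofReal_mul (by positivity)]
        refine le_mul_of_one_le_right' ?_
        rw [← ENNReal.ofReal_one]
        apply ENNReal.ofReal_le_ofReal
        rw [← div_eq_mul_inv, one_le_div (by linarith)]
        exact abs_le_bracket n
    have := ENNReal.summable_toReal h1
    simpa using this
  have hflow : linearFlow t g = fun x : ℝ => ∑' m : ℤ, b m * Complex.exp (I * m * x) := rfl
  have hcont : Continuous (linearFlow t g) := by
    rw [hflow]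
    refine continuous_tsum (fun m => by fun_prop) hsum fun m x => ?_
    rw [norm_mul, show I * m * x = ((m * x : ℝ) : ℂ) * I by push_cast; ring,
      Complex.norm_exp_ofReal_mul_I, mul_one]
  have hflowL : MemLp (linearFlow t g) 2 periodMeasure := by
    have hbd : ∀ x, ‖linearFlow t g x‖ ≤ ∑' n, ‖b n‖ := fun x => by
      rw [hflow]
      refine tsum_of_norm_bounded hsum.hasSum fun m => ?_
      rw [norm_mul, show I * m * x = ((m * x : ℝ) : ℂ) * I by push_cast; ring,
        Complex.norm_exp_ofReal_mul_I, mul_one]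
    exact MemLp.of_bound hcont.aestronglyMeasurable _ (Eventually.of_forall hbd)
  have hfL : MemLp (fun x => (f x : ℂ)) 2 periodMeasure := hf.memLp.ofReal
  have hdL : MemLp (fun x => (f x : ℂ) - linearFlow t g x) 2 periodMeasure := hfL.sub hflowL
  rw [l2Norm_eq hdL]
  congr 2
  ext n
  have hc : coeff (fun x => (f x : ℂ) - linearFlow t g x) n =
      coeff (fun x => (f x : ℂ)) n - b n := by
    rw [← coeff_tsum hsum n, ← hflow, coeff_eq_integral, coeff_eq_integral, coeff_eq_integral,
      ← mul_sub, ← intervalIntegral.integral_sub]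
    · simp only [mul_sub]
    · exact (intervalIntegrable_ofReal (intervalIntegrable_of_memLp hf.memLp)).continuousOn_mul
        (by fun_prop)
    · exact (hcont.intervalIntegrable _ _).continuousOn_mul (by fun_prop)
  have e : Complex.exp (-(I * n ^ 3 * t)) * coeff (fun x => (f x : ℂ)) n -
      coeff (fun x => (g x : ℂ)) n =
      Complex.exp (-(I * n ^ 3 * t)) * (coeff (fun x => (f x : ℂ)) n - b n) := by
    rw [hb, mul_sub, ← mul_assoc, ← Complex.exp_add, neg_add_cancel, Complex.exp_zero, one_mul]
  rw [e, enorm_mul, ← ofReal_norm (Complex.exp _), norm_exp_cubic, ENNReal.ofReal_one, one_mul]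
  exact congrArg _ hc

end PeriodicKdV

theorem theorem1 (C : ℝ) (hC : 0 < C) (γ : ℝ) (hγ : 0 < γ) :
    ∃ A : ℝ, 0 < A ∧ ∀ δ : ℝ, 0 < δ → ∀ K : ℝ, 0 < K →
      ∃ ε₀ : ℝ, 0 < ε₀ ∧ ∀ ε : ℝ, 0 < ε → ε ≤ ε₀ →
        ∀ (I : Set ℝ) (v : ℝ → ℝ → ℝ), I.OrdConnected → (0 : ℝ) ∈ I →
          PeriodicKdV.IsSolutionOn I v →
          (∫ x in (-Real.pi)..Real.pi, v 0 x) = 0 →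
          PeriodicKdV.sobolevNorm 1 (v 0) ≤ ENNReal.ofReal (C * ε⁻¹) →
          PeriodicKdV.sobolevNorm (-1 / 2) (v 0) ≤ ENNReal.ofReal (C * ε ^ (1 / 2 : ℝ)) →
          ∀ t ∈ I, |t| ≤ K * ε ^ (-1 / 2 + δ) →
            PeriodicKdV.l2Norm
                (fun x => (v t x : ℂ) - PeriodicKdV.linearFlow t (v 0) x)
              ≤ ENNReal.ofReal (A * Real.sqrt (1 + t ^ 2) * ε ^ (1 / 2 - γ)) := by
  obtain ⟨A, hA, H⟩ := PeriodicKdV.exists_reduced_bound (C₁ := 2 * C) (by positivity)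
  have hpi : 0 < √(2 * Real.pi) := Real.sqrt_pos.2 (by positivity)
  refine ⟨√(2 * Real.pi) * (A * 2), by positivity, fun δ hδ K hK => ?_⟩
  obtain ⟨ε₀, hε₀, H⟩ := H δ hδ K hK
  refine ⟨min ε₀ 1, by positivity, fun ε hε hεε₀ I v hI h0 hv hmean h1 h2 t ht htK => ?_⟩
  have hM := hv.continuousOn_nrm (w := fun _ => 1) fun n => by
    rw [← ENNReal.ofReal_one]; exact ENNReal.ofReal_le_ofReal (PeriodicKdV.one_le_bracket n)
  have hX := hv.continuousOn_nrm (w := PeriodicKdV.rho) fun n => by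
    refine (PeriodicKdV.rho_le_one n).trans ?_
    rw [← ENNReal.ofReal_one]; exact ENNReal.ofReal_le_ofReal (PeriodicKdV.one_le_bracket n)
  simp only [mul_one] at hM
  have key := H ε hε (hεε₀.trans (min_le_left _ _)) I (PeriodicKdV.interaction v) hI h0
    (fun a b hab => hv.isReducedSolution hI h0 hmean hab)
    (by simpa only [PeriodicKdV.enorm_interaction] using hM.1)
    (by simpa only [PeriodicKdV.enorm_interaction] using hM.2)
    (by simpa only [PeriodicKdV.enorm_interaction, PeriodicKdV.nrmHalf] using hX.2)
    (by
      simp only [PeriodicKdV.enorm_interaction]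
      refine (PeriodicKdV.nrmHalf_coeff_le (v 0)).trans ((mul_le_mul_right h2 2).trans_eq ?_)
      rw [mul_assoc 2 C, ENNReal.ofReal_mul (p := 2) (by norm_num), ENNReal.ofReal_ofNat])
    (by
      simp only [PeriodicKdV.enorm_interaction]
      exact PeriodicKdV.nrm_coeff_le hC hε h1 h2)
    t ht htK
  rw [PeriodicKdV.l2Norm_sub_linearFlow (hv.memH1 t ht) (hv.memH1 0 h0)
    (hv.modes_zero hI h0 hmean h0)]
  have e0 : ∀ n, PeriodicKdV.interaction v n 0 =
      PeriodicKdV.coeff (fun x => (v 0 x : ℂ)) n := fun n => by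
    simp [PeriodicKdV.interaction, PeriodicKdV.modes]
  simp only [e0] at key
  refine (mul_le_mul_right key _).trans ?_
  rw [← ENNReal.ofReal_mul hpi.le]
  apply ENNReal.ofReal_le_ofReal
  have ht2 : 1 + |t| ≤ 2 * √(1 + t ^ 2) := by
    have a1 : 1 ≤ √(1 + t ^ 2) := Real.one_le_sqrt.2 (by linarith [sq_nonneg t])
    have a2 : |t| ≤ √(1 + t ^ 2) := Real.abs_le_sqrt (by linarith)
    linarith
  have hεγ : ε ^ (1 / 2 : ℝ) ≤ ε ^ (1 / 2 - γ) :=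
    Real.rpow_le_rpow_of_exponent_ge hε (hεε₀.trans (min_le_right _ _)) (by linarith)
  calc √(2 * Real.pi) * (A * (1 + |t|) * ε ^ (1 / 2 : ℝ))
      ≤ √(2 * Real.pi) * (A * (2 * √(1 + t ^ 2)) * ε ^ (1 / 2 - γ)) := by gcongr
    _ = _ := by ring
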